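/- Let $a_0,a_1,a_2,a_3\in(0,\pi)$ and $k_j:=e^{ia_j}$. Let $V=\mathbb C^2$ carry the hermitian form $\langle v,w\rangle=v_0\overline{w_0}-v_1\overline{w_1}$, let $\mathrm{B}V=\{p\in\mathbb P V:\langle p,p\rangle>0\}$ be the hyperbolic plane, put $\mathrm{ta}(p,q)=\frac{\langle p,q\rangle\langle q,p\rangle}{\langle p,p\rangle\langle q,q\rangle}$, and let $R_{c,k}:p\mapsto(\bar k-k)\frac{\langle p,c\rangle}{\langle c,c\rangle}c+kp$ (for $|k|=1$, the rotation about $c\in\mathrm{B}V$ by the angle $\mathrm{Arg}\,k^2$). Let $S=S(a_0,a_1,a_2,a_3)$ be the space, with the quotient topology, of all quadruples of rotations $R_j=R_{c_j,k_j}$, $c_j\in\mathrm{B}V$, satisfying in $\mathrm{PU}(1,1)$ the relation $R_3R_2R_1R_0=1$ (first type) or $R_0R_1R_2R_3=1$ (second type), considered up to conjugation in $\mathrm{PU}(1,1)$. A point of $S$ is a hexagon with vertices $c_1,p_1,c_2,p_2,c_3,p_3$, where $p_3=c_0$, $p_1=R_1^{\pm1}p_3$, $p_2=R_2^{\pm1}p_1$,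 $p_3=R_3^{\pm1}p_2$ ($+$ for the first type, $-$ for the second). Put $t_j=\mathrm{ta}(c_j,p_j)$ and $t'_j=\mathrm{ta}(c_j,p_{j+1})$ for $j=1,2,3$ (indices modulo $3$). Write $x^g=gxg^{-1}$. The modifications $n_1,n_2,n_3:S\to S$ transform $R_3R_2R_1R_0=1$ respectively into $R_0^{R_3^{-1}}R_1R_2^{R_1^{-1}}R_3=1$, $R_0^{R_3^{-1}}R_1^{R_2}R_2R_3=1$, $R_0^{R_1}R_1R_2^{R_3}R_3=1$, and $R_0R_1R_2R_3=1$ respectively into $R_3R_2^{R_1}R_1R_0^{R_3}=1$, $R_3R_2R_1^{R_2^{-1}}R_0^{R_3}=1$, $R_3R_2^{R_3^{-1}}R_1R_0^{R_1^{-1}}=1$; they are involutions that alter the type. Let $A_j$ be the fixed point set of $n_j$, hexagons of different types with the same triple $(t_1,t_2,t_3)$ being identified; let $H_j$ and $H'_j$ be given by $t_j\le t'_j$ and $t_j\ge t'_j$. Finally, let $u_j=t_j(\bar k_j-k_j)+k_j$ and $e_1(t_1,t_2,t_3)=|u_1|^2+|u_2|^2+|u_3|^2-1-2\,\mathrm{Re}(\bar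 k_0u_1u_2u_3)$. Suppose that $a_j+a_k\le\pi$ for all $j\ne k$ or that $a_j+a_k\ge\pi$ for all $j\ne k$. Then $S$ has exactly one noncompact connected component $C_1$ of each type, namely the set of all hexagons of this type with $e_1(t_1,t_2,t_3)=0$; the map $(t_1,t_2,t_3)$ embeds it topologically into $\mathbb R^3$ with image $\{t_1,t_2,t_3\ge1,\ e_1(t_1,t_2,t_3)=0\}$, and $C_1$ is regarded as this surface. The surface $C_1$ is smooth if and only if not all $a_j$ equal $\frac\pi2$, and in this case the differential of $e_1$ does not vanish at any point of $C_1$. If $C_1$ is smooth, then it is a smooth plane, the curves $A_1\cap C_1$, $A_2\cap C_1$, $A_3\cap C_1$ are pairwise disjoint smooth lines, each line $A_j\cap C_1$ divides the plane $C_1$ into the two parts $H_j\cap C_1$ and $H'_j\cap C_1$ (there is a smooth embedding of $\mathbb R^2$ onto $C_1$ under which the line and the two parts correspond to a straight line and the two closed half-planes bounded by it), and $A_k\cap C_1\subset H_j\cap C_1$ for all $j,k\in\{1,2,3\}$. -/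

import Mathlib

open Topology
open scoped ContDiff

namespace HexSpace

noncomputable section

/-- The complex plane `ℂ²` underlying the model space. -/
abbrev V : Type := Fin 2 → ℂ

/-- The hermitian form of signature `(1,1)` on `V`, linear in the first argument. -/
def herm (v w : V) : ℂ :=
  v 0 * (starRingEnd ℂ) (w 0) - v 1 * (starRingEnd ℂ) (w 1)

/-- A vector represents a point of the hyperbolic plane `{p ∈ ℙV | ⟨p,p⟩ > 0}` iff it is positive
(`⟨v,v⟩` is always a real number). Two positive vectors represent the same point iff they are
proportional. -/
def IsPos (v : V) : Prop := 0 < (herm v v).re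

/-- The tance of two points: it equals `cosh² (dist / 2)`. -/
def ta (p q : V) : ℝ :=
  (herm p q * herm q p / (herm p p * herm q q)).re

/-- `R_{c,k} : p ↦ (k̄ - k) (⟨p,c⟩ / ⟨c,c⟩) c + k p`; for a positive `c` and `|k| = 1` this is the
counterclockwise rotation about `c` by the angle `Arg k²`. -/
def rot (c : V) (k : ℂ) : Module.End ℂ V where
  toFun p := (((starRingEnd ℂ) k - k) * (herm p c / herm c c)) • c + k • p
  map_add' p q := by
    ext i
    simp only [herm, Pi.add_apply, Pi.smul_apply, smul_eq_mul]
    ring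
  map_smul' r p := by
    ext i
    simp only [herm, Pi.add_apply, Pi.smul_apply, smul_eq_mul, RingHom.id_apply]
    ring

/-- `k_j = exp (i a_j)`. -/
def kk (a : Fin 4 → ℝ) (j : Fin 4) : ℂ := Complex.exp ((a j : ℂ) * Complex.I)

/-- An endomorphism of `V` that acts as the identity on `ℙV`. -/
def IsScalar (T : Module.End ℂ V) : Prop := ∃ r : ℂ, T = r • (1 : Module.End ℂ V)

/-- The two types of hexagons (the two cyclic orders of the labels `1, 2, 3`). -/
inductive HexType
  | first
  | second

instance : TopologicalSpace HexType := ⊥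

/-- The other type. -/
def HexType.swap : HexType → HexType
  | .first => .second
  | .second => .first

/-- `R_j = R_{c_j, k_j}` for hexagons of the first type and its inverse `R_{c_j, k̄_j}` for those of
the second type. The consecutive vertices `p` are `p₁ = R₁^{±1} p₃`, `p₂ = R₂^{±1} p₁`,
`p₃ = R₃^{±1} p₂`, with the sign `+` for the first type and `-` for the second one. -/
def turn (a : Fin 4 → ℝ) (c : Fin 4 → V) (j : Fin 4) : HexType → Module.End ℂ V
  | .first => rot (c j) (kk a j)
  | .second => rot (c j) ((starRingEnd ℂ) (kk a j))

/-- The relation between the rotations `R_j = R_{c_j, k_j}` in `PU(1,1)`: it is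
`R₃ R₂ R₁ R₀ = 1` for the first type and `R₀ R₁ R₂ R₃ = 1` for the second type. -/
def Relation (a : Fin 4 → ℝ) (c : Fin 4 → V) : HexType → Prop
  | .first => IsScalar (rot (c 3) (kk a 3) * rot (c 2) (kk a 2) *
      rot (c 1) (kk a 1) * rot (c 0) (kk a 0))
  | .second => IsScalar (rot (c 0) (kk a 0) * rot (c 1) (kk a 1) *
      rot (c 2) (kk a 2) * rot (c 3) (kk a 3))

/-- A hexagon, i.e. a relation in `PU(1,1)` between four rotations `R₀, R₁, R₂, R₃` in the conjugacy
classes of the counterclockwise rotations by `2a₀, 2a₁, 2a₂, 2a₃`. A member of the `j`-th class is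
given by its fixed point `c j` (a positive vector, up to proportionality), the point `c 0` is the
vertex `p₃` of the hexagon. -/
structure Hexagon (a : Fin 4 → ℝ) where
  type : HexType
  c : Fin 4 → V
  pos : ∀ j, IsPos (c j)
  rel : Relation a c type

instance (a : Fin 4 → ℝ) : TopologicalSpace (Hexagon a) :=
  TopologicalSpace.induced (fun h => (h.type, h.c)) inferInstance

/-- The elements of the unitary group `U(1,1)`. -/
def IsUnitary (g : V ≃ₗ[ℂ] V) : Prop := ∀ v w, herm (g v) (g w) = herm v w

/-- Two quadruples of vectors give quadruples of points congruent by an orientation-preserving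
isometry of the hyperbolic plane, i.e. by an element of `PU(1,1)`. -/
def Congr (c d : Fin 4 → V) : Prop :=
  ∃ g : V ≃ₗ[ℂ] V, IsUnitary g ∧ ∃ r : Fin 4 → ℂ, (∀ j, r j ≠ 0) ∧ ∀ j, d j = r j • g (c j)

theorem Congr.refl (c : Fin 4 → V) : Congr c c :=
  ⟨LinearEquiv.refl ℂ V, fun _ _ => rfl, fun _ => 1, fun _ => one_ne_zero, fun j => by simp⟩

theorem Congr.symm {c d : Fin 4 → V} (h : Congr c d) : Congr d c := by
  obtain ⟨g, hg, r, hr, h⟩ := h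
  refine ⟨g.symm, fun v w => ?_, fun j => (r j)⁻¹, fun j => inv_ne_zero (hr j), fun j => ?_⟩
  · rw [← hg]; simp
  · rw [h j]; simp [smul_smul, hr j]

theorem Congr.trans {c d e : Fin 4 → V} (h : Congr c d) (h' : Congr d e) : Congr c e := by
  obtain ⟨g, hg, r, hr, h⟩ := h
  obtain ⟨g', hg', r', hr', h'⟩ := h'
  refine ⟨g.trans g', fun v w => ?_, fun j => r' j * r j, fun j => mul_ne_zero (hr' j) (hr j),
    fun j => ?_⟩
  · simp [hg' _ _, hg _ _]
  · rw [h' j, h j]; simp [smul_smul]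

instance hexSetoid (a : Fin 4 → ℝ) : Setoid (Hexagon a) where
  r x y := x.type = y.type ∧ Congr x.c y.c
  iseqv := ⟨fun _ => ⟨rfl, Congr.refl _⟩, fun h => ⟨h.1.symm, h.2.symm⟩,
    fun h h' => ⟨h.1.trans h'.1, h.2.trans h'.2⟩⟩

/-- The space `S(a₀,a₁,a₂,a₃)` of hexagons of both types, considered up to `PU(1,1)`, with the
quotient topology. -/
def S (a : Fin 4 → ℝ) : Type := Quotient (hexSetoid a)

instance (a : Fin 4 → ℝ) : TopologicalSpace (S a) :=
  inferInstanceAs (TopologicalSpace (Quotient (hexSetoid a)))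

/-- The vertices `p₁, p₂, p₃` (with indices `0, 1, 2`). -/
def pt (a : Fin 4 → ℝ) (τ : HexType) (c : Fin 4 → V) : Fin 3 → V :=
  ![turn a c 1 τ (c 0), turn a c 2 τ (turn a c 1 τ (c 0)), c 0]

/-- `t_j = ta (c_j, p_j)`; the index `j : Fin 3` stands for `j + 1`. -/
def tVec (a : Fin 4 → ℝ) (τ : HexType) (c : Fin 4 → V) (j : Fin 3) : ℝ :=
  ta (c j.succ) (pt a τ c j)

/-- `t'_j = ta (c_j, p_{j+1})` (the indices of the `p`'s are modulo `3`). -/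
def tVec' (a : Fin 4 → ℝ) (τ : HexType) (c : Fin 4 → V) (j : Fin 3) : ℝ :=
  ta (c j.succ) (pt a τ c (j + 1))

/-- The modifications `n₁, n₂, n₃` (with indices `0, 1, 2`) at the level of the fixed points of the
rotations. With `x^g := g x g⁻¹`, they transform the relation `R₃ R₂ R₁ R₀ = 1` into
`R₀^(R₃⁻¹) R₁ R₂^(R₁⁻¹) R₃ = 1`, `R₀^(R₃⁻¹) R₁^(R₂) R₂ R₃ = 1`, `R₀^(R₁) R₁ R₂^(R₃) R₃ = 1`,
and the relation `R₀ R₁ R₂ R₃ = 1` into `R₃ R₂^(R₁) R₁ R₀^(R₃) = 1`,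
`R₃ R₂ R₁^(R₂⁻¹) R₀^(R₃) = 1`, `R₃ R₂^(R₃⁻¹) R₁ R₀^(R₁⁻¹) = 1`; the fixed point of `x^g` is the
image under `g` of that of `x`. -/
def modif (a : Fin 4 → ℝ) (τ : HexType) (c : Fin 4 → V) : Fin 3 → Fin 4 → V :=
  ![![turn a c 3 τ.swap (c 0), c 1, turn a c 1 τ.swap (c 2), c 3],
    ![turn a c 3 τ.swap (c 0), turn a c 2 τ (c 1), c 2, c 3],
    ![turn a c 1 τ (c 0), c 1, turn a c 3 τ (c 2), c 3]]

/-! Elementary facts that make the maps descend to `S a`. -/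

theorem IsPos.ne {c : V} (h : IsPos c) : herm c c ≠ 0 := by
  intro h0
  simp [IsPos, h0] at h

theorem herm_smul_smul (r s : ℂ) (v w : V) :
    herm (r • v) (s • w) = r * (starRingEnd ℂ) s * herm v w := by
  simp only [herm, Pi.smul_apply, smul_eq_mul, map_mul]
  ring

theorem herm_add_left (u v w : V) : herm (u + v) w = herm u w + herm v w := by
  simp only [herm, Pi.add_apply]; ring

theorem herm_add_right (u v w : V) : herm u (v + w) = herm u v + herm u w := by
  simp only [herm, Pi.add_apply, map_add]; ring

theorem herm_smul_left (r : ℂ) (v w : V) : herm (r • v) w = r * herm v w := by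
  simp only [herm, Pi.smul_apply, smul_eq_mul]; ring

theorem herm_smul_right (r : ℂ) (v w : V) :
    herm v (r • w) = (starRingEnd ℂ) r * herm v w := by
  simp only [herm, Pi.smul_apply, smul_eq_mul, map_mul]; ring

theorem herm_conj (v w : V) : (starRingEnd ℂ) (herm v w) = herm w v := by
  simp [herm]; ring

theorem rot_apply (c : V) (k : ℂ) (p : V) :
    rot c k p = (((starRingEnd ℂ) k - k) * (herm p c / herm c c)) • c + k • p := rfl

theorem ta_smul {r s : ℂ} (hr : r ≠ 0) (hs : s ≠ 0) (v w : V) :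
    ta (r • v) (s • w) = ta v w := by
  have hr' : (starRingEnd ℂ) r ≠ 0 := by simpa using hr
  have hs' : (starRingEnd ℂ) s ≠ 0 := by simpa using hs
  have h0 : r * (starRingEnd ℂ) r * (s * (starRingEnd ℂ) s) ≠ 0 := by positivity
  unfold ta
  congr 1
  rw [herm_smul_smul, herm_smul_smul, herm_smul_smul, herm_smul_smul, ← mul_div_mul_left
    (herm v w * herm w v) (herm v v * herm w w) h0]
  congr 1 <;> ring

theorem ta_unitary {g : V ≃ₗ[ℂ] V} (hg : IsUnitary g) (v w : V) : ta (g v) (g w) = ta v w := by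
  simp only [ta, hg _ _]

theorem rot_congr {g : V ≃ₗ[ℂ] V} (hg : IsUnitary g) {r : ℂ} (hr : r ≠ 0) (c : V) (k : ℂ)
    (p : V) : rot (r • g c) k (g p) = g (rot c k p) := by
  have hr' : (starRingEnd ℂ) r ≠ 0 := by simpa using hr
  simp only [rot_apply, map_add, map_smul, herm_smul_left, herm_smul_right, hg _ _, smul_smul]
  congr 2
  by_cases h : herm c c = 0
  · simp [h]
  · field_simp

theorem turn_congr {g : V ≃ₗ[ℂ] V} (hg : IsUnitary g) {r : Fin 4 → ℂ} (hr : ∀ j, r j ≠ 0)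
    {c d : Fin 4 → V} (h : ∀ j, d j = r j • g (c j)) (a : Fin 4 → ℝ) (j : Fin 4) (τ : HexType)
    (p : V) : turn a d j τ (g p) = g (turn a c j τ p) := by
  cases τ <;> simp only [turn, h j] <;> exact rot_congr hg (hr j) _ _ _

theorem kk_mul_conj (a : Fin 4 → ℝ) (j : Fin 4) : kk a j * (starRingEnd ℂ) (kk a j) = 1 := by
  rw [Complex.mul_conj, Complex.normSq_eq_norm_sq, kk, Complex.norm_exp_ofReal_mul_I]
  simp

theorem rot_mul_conj {c : V} (hc : IsPos c) {k : ℂ} (hk : k * (starRingEnd ℂ) k = 1) :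
    rot c k * rot c ((starRingEnd ℂ) k) = 1 := by
  have h := hc.ne
  refine LinearMap.ext fun p => ?_
  simp only [Module.End.mul_apply, Module.End.one_apply]
  rw [rot_apply c _ p, rot_apply, herm_add_left, herm_smul_left, herm_smul_left]
  ext i
  simp only [Pi.add_apply, Pi.smul_apply, smul_eq_mul, Complex.conj_conj]
  field_simp
  linear_combination (p i * herm c c) * hk

theorem rot_unitary {c : V} (hc : IsPos c) {k : ℂ} (hk : k * (starRingEnd ℂ) k = 1) (v w : V) :
    herm (rot c k v) (rot c k w) = herm v w := by
  have h := hc.ne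
  simp only [rot_apply, herm_add_left, herm_add_right, herm_smul_left, herm_smul_right, map_mul,
    map_div₀, map_sub, Complex.conj_conj, herm_conj]
  field_simp
  linear_combination (herm v w * herm c c) * hk

theorem turn_mul_swap {a : Fin 4 → ℝ} {c : Fin 4 → V} (hc : ∀ j, IsPos (c j)) (j : Fin 4)
    (τ : HexType) : turn a c j τ * turn a c j τ.swap = 1 := by
  cases τ
  · exact rot_mul_conj (hc j) (kk_mul_conj a j)
  · have := rot_mul_conj (hc j) (k := (starRingEnd ℂ) (kk a j))
      (by rw [Complex.conj_conj, mul_comm]; exact kk_mul_conj a j)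
    rwa [Complex.conj_conj] at this

theorem HexType.swap_swap (τ : HexType) : τ.swap.swap = τ := by cases τ <;> rfl

theorem turn_swap_mul {a : Fin 4 → ℝ} {c : Fin 4 → V} (hc : ∀ j, IsPos (c j)) (j : Fin 4)
    (τ : HexType) : turn a c j τ.swap * turn a c j τ = 1 := by
  simpa [HexType.swap_swap] using turn_mul_swap (a := a) hc j τ.swap

theorem turn_unitary {a : Fin 4 → ℝ} {c : Fin 4 → V} (hc : ∀ j, IsPos (c j)) (j : Fin 4)
    (τ : HexType) (v w : V) : herm (turn a c j τ v) (turn a c j τ w) = herm v w := by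
  cases τ
  · exact rot_unitary (hc j) (kk_mul_conj a j) v w
  · exact rot_unitary (hc j)
      (by rw [Complex.conj_conj, mul_comm]; exact kk_mul_conj a j) v w

/-- `turn` as an invertible map. -/
def turnU (a : Fin 4 → ℝ) (c : Fin 4 → V) (hc : ∀ j, IsPos (c j)) (j : Fin 4) (τ : HexType) :
    (Module.End ℂ V)ˣ :=
  ⟨turn a c j τ, turn a c j τ.swap, turn_mul_swap hc j τ, turn_swap_mul hc j τ⟩

theorem IsScalar.conj {u v : (Module.End ℂ V)ˣ} (h : IsScalar (u : Module.End ℂ V)) :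
    IsScalar ((v * u * v⁻¹ : (Module.End ℂ V)ˣ) : Module.End ℂ V) := by
  obtain ⟨r, hr⟩ := h
  exact ⟨r, by simp [hr]⟩

theorem IsScalar.inv {u : (Module.End ℂ V)ˣ} (h : IsScalar (u : Module.End ℂ V)) :
    IsScalar ((u⁻¹ : (Module.End ℂ V)ˣ) : Module.End ℂ V) := by
  obtain ⟨r, hr⟩ := h
  have h1 : (u : Module.End ℂ V) * ((u⁻¹ : (Module.End ℂ V)ˣ) : Module.End ℂ V) = 1 := u.mul_inv
  have hr0 : r ≠ 0 := by
    rintro rfl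
    rw [hr, zero_smul, zero_mul] at h1
    exact zero_ne_one h1
  refine ⟨r⁻¹, ?_⟩
  rw [hr, smul_mul_assoc, one_mul] at h1
  rw [← h1, smul_smul, inv_mul_cancel₀ hr0, one_smul]

theorem turnU_swap (a : Fin 4 → ℝ) (c : Fin 4 → V) (hc : ∀ j, IsPos (c j)) (j : Fin 4)
    (τ : HexType) : turnU a c hc j τ.swap = (turnU a c hc j τ)⁻¹ := by
  refine Units.ext ?_
  rfl

/-- Both forms of the relation say that the product `T₃ T₂ T₁ T₀` of the `turn`s is trivial. -/
theorem relation_iff (a : Fin 4 → ℝ) (c : Fin 4 → V) (hc : ∀ j, IsPos (c j)) (τ : HexType) :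
    Relation a c τ ↔ IsScalar ((turnU a c hc 3 τ * turnU a c hc 2 τ * turnU a c hc 1 τ *
      turnU a c hc 0 τ : (Module.End ℂ V)ˣ) : Module.End ℂ V) := by
  cases τ
  · exact Iff.rfl
  · have key : turnU a c hc 3 .second * turnU a c hc 2 .second * turnU a c hc 1 .second *
        turnU a c hc 0 .second = (turnU a c hc 0 .first * turnU a c hc 1 .first *
        turnU a c hc 2 .first * turnU a c hc 3 .first)⁻¹ := by
      have h : ∀ j, turnU a c hc j .second = (turnU a c hc j .first)⁻¹ :=
        fun j => turnU_swap a c hc j .first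
      rw [h, h, h, h]; group
    rw [key]
    constructor
    · intro h
      exact IsScalar.inv h
    · intro h
      have := IsScalar.inv h
      rw [inv_inv] at this
      exact this

theorem modif_pos {a : Fin 4 → ℝ} {c : Fin 4 → V} (hc : ∀ j, IsPos (c j)) (τ : HexType)
    (i : Fin 3) (j : Fin 4) : IsPos (modif a τ c i j) := by
  have h : ∀ l m σ, IsPos (turn a c l σ (c m)) := fun l m σ => by
    unfold IsPos
    rw [turn_unitary hc]
    exact hc m
  fin_cases i <;> fin_cases j <;> simp only [modif] <;>
    simp [h, hc]

/-- The rotation about `T c_m`, with `T` a `turn`, is conjugate by `T` to that about `c_m`. -/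
theorem turnU_conj {a : Fin 4 → ℝ} {c d : Fin 4 → V} (hc : ∀ j, IsPos (c j))
    (hd : ∀ j, IsPos (d j)) (l m : Fin 4) (σ τ : HexType) (h : d m = turn a c l σ (c m)) :
    turnU a d hd m τ = turnU a c hc l σ * turnU a c hc m τ * (turnU a c hc l σ)⁻¹ := by
  rw [eq_mul_inv_iff_mul_eq]
  refine Units.ext (LinearMap.ext fun p => ?_)
  let g : V ≃ₗ[ℂ] V := LinearEquiv.ofLinearMap (turn a c l σ) (turn a c l σ.swap)
    (turn_mul_swap hc l σ) (turn_swap_mul hc l σ)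
  have hg : IsUnitary g := fun v w => turn_unitary hc l σ v w
  have hdm : d m = (1 : ℂ) • g (c m) := by rw [one_smul]; exact h
  change turn a d m τ (g p) = g (turn a c m τ p)
  cases τ <;> simp only [turn, hdm] <;> exact rot_congr hg one_ne_zero _ _ _

theorem turnU_same {a : Fin 4 → ℝ} {c d : Fin 4 → V} (hc : ∀ j, IsPos (c j))
    (hd : ∀ j, IsPos (d j)) (m : Fin 4) (τ : HexType) (h : d m = c m) :
    turnU a d hd m τ = turnU a c hc m τ := by
  refine Units.ext ?_
  cases τ <;> simp only [turnU, turn, h]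

theorem modif_rel {a : Fin 4 → ℝ} {c : Fin 4 → V} (hc : ∀ j, IsPos (c j)) {τ : HexType}
    (i : Fin 3) (h : Relation a c τ) : Relation a (modif a τ c i) τ.swap := by
  rw [relation_iff a c hc] at h
  rw [relation_iff a _ (modif_pos hc τ i)]
  fin_cases i
  · rw [turnU_conj hc (modif_pos hc τ _) 3 0 τ.swap τ.swap rfl,
      turnU_conj hc (modif_pos hc τ _) 1 2 τ.swap τ.swap rfl,
      turnU_same hc (modif_pos hc τ _) 1 τ.swap rfl,
      turnU_same hc (modif_pos hc τ _) 3 τ.swap rfl]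
    simp only [turnU_swap]
    convert (IsScalar.conj (v := (turnU a c hc 3 τ)⁻¹ * turnU a c hc 0 τ)
      (IsScalar.inv h)) using 2
    group
  · rw [turnU_conj hc (modif_pos hc τ _) 3 0 τ.swap τ.swap rfl,
      turnU_conj hc (modif_pos hc τ _) 2 1 τ τ.swap rfl,
      turnU_same hc (modif_pos hc τ _) 2 τ.swap rfl,
      turnU_same hc (modif_pos hc τ _) 3 τ.swap rfl]
    simp only [turnU_swap]
    convert (IsScalar.conj (v := (turnU a c hc 3 τ)⁻¹ * turnU a c hc 0 τ)
      (IsScalar.inv h)) using 2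
    group
  · rw [turnU_conj hc (modif_pos hc τ _) 1 0 τ τ.swap rfl,
      turnU_conj hc (modif_pos hc τ _) 3 2 τ τ.swap rfl,
      turnU_same hc (modif_pos hc τ _) 1 τ.swap rfl,
      turnU_same hc (modif_pos hc τ _) 3 τ.swap rfl]
    simp only [turnU_swap]
    convert (IsScalar.conj (v := turnU a c hc 1 τ * turnU a c hc 0 τ)
      (IsScalar.inv h)) using 2
    group

theorem pt_congr {g : V ≃ₗ[ℂ] V} (hg : IsUnitary g) {r : Fin 4 → ℂ} (hr : ∀ j, r j ≠ 0)
    {c d : Fin 4 → V} (h : ∀ j, d j = r j • g (c j)) (a : Fin 4 → ℝ) (τ : HexType) (i : Fin 3) :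
    pt a τ d i = r 0 • g (pt a τ c i) := by
  have ht := fun j p => turn_congr hg hr h a j τ p
  fin_cases i <;> simp [pt, h 0, ht]

theorem ta_congr {c d : Fin 4 → V} (h : Congr c d) (a : Fin 4 → ℝ) (τ : HexType) (m : Fin 4)
    (i : Fin 3) : ta (d m) (pt a τ d i) = ta (c m) (pt a τ c i) := by
  obtain ⟨g, hg, r, hr, h⟩ := h
  rw [pt_congr hg hr h, h m, ta_smul (hr m) (hr 0), ta_unitary hg]

theorem modif_congr {c d : Fin 4 → V} (h : Congr c d) (a : Fin 4 → ℝ) (τ : HexType) (i : Fin 3) :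
    Congr (modif a τ c i) (modif a τ d i) := by
  obtain ⟨g, hg, r, hr, h⟩ := h
  have ht := fun j σ p => turn_congr hg hr h a j σ p
  refine ⟨g, hg, r, hr, fun j => ?_⟩
  fin_cases i <;> fin_cases j <;> simp [modif, h 0, h 1, h 2, h 3, ht]

/-- The type of a point of `S a`. -/
def S.type {a : Fin 4 → ℝ} : S a → HexType :=
  Quotient.lift Hexagon.type fun _ _ h => h.1

/-- The triple `(t₁, t₂, t₃)` of a point of `S a`. -/
def S.t {a : Fin 4 → ℝ} : S a → Fin 3 → ℝ :=
  Quotient.lift (fun x => tVec a x.type x.c) fun x y h => by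
    funext j
    simp only [tVec]
    rw [← h.1, ta_congr h.2]

/-- The triple `(t'₁, t'₂, t'₃)` of a point of `S a`. -/
def S.t' {a : Fin 4 → ℝ} : S a → Fin 3 → ℝ :=
  Quotient.lift (fun x => tVec' a x.type x.c) fun x y h => by
    funext j
    simp only [tVec']
    rw [← h.1, ta_congr h.2]

/-- The modification `n_j` of hexagons. -/
def Hexagon.n {a : Fin 4 → ℝ} (j : Fin 3) (x : Hexagon a) : Hexagon a :=
  ⟨x.type.swap, modif a x.type x.c j, modif_pos x.pos x.type j, modif_rel x.pos j x.rel⟩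

/-- The modifications `n₁, n₂, n₃` acting on `S a`; they alter the type. -/
def S.n {a : Fin 4 → ℝ} (j : Fin 3) : S a → S a :=
  Quotient.map (Hexagon.n j) fun x y h => by
    obtain ⟨h1, h2⟩ := h
    refine ⟨congrArg HexType.swap h1, ?_⟩
    have := modif_congr h2 a x.type j
    simp only [Hexagon.n]
    rw [← h1]
    exact this

/-- `A_j`, the set of fixed points of the involution `n_j`. Since `n_j` alters the type, points of
different types with the same triple `(t₁, t₂, t₃)` are identified here. -/
def A (a : Fin 4 → ℝ) (j : Fin 3) : Set (S a) := {P | (P.n j).t = P.t}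

/-- The part `H_j`, given by `t_j ≤ t'_j`. -/
def H (a : Fin 4 → ℝ) (j : Fin 3) : Set (S a) := {P | P.t j ≤ P.t' j}

/-- The part `H'_j`, given by `t_j ≥ t'_j`. -/
def H' (a : Fin 4 → ℝ) (j : Fin 3) : Set (S a) := {P | P.t' j ≤ P.t j}

/-- `u_j = t_j (k̄_j - k_j) + k_j` for `j = 1, 2, 3`. -/
def u (a : Fin 4 → ℝ) (t : Fin 3 → ℝ) (j : Fin 3) : ℂ :=
  (t j : ℂ) * ((starRingEnd ℂ) (kk a j.succ) - kk a j.succ) + kk a j.succ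

/-- `e₁ = |u₁|² + |u₂|² + |u₃|² - 1 - 2 Re (k̄₀ u₁ u₂ u₃)`. -/
def e₁ (a : Fin 4 → ℝ) (t : Fin 3 → ℝ) : ℝ :=
  ‖u a t 0‖ ^ 2 + ‖u a t 1‖ ^ 2 + ‖u a t 2‖ ^ 2 - 1 -
    2 * ((starRingEnd ℂ) (kk a 0) * u a t 0 * u a t 1 * u a t 2).re

/-- The points of `S a` of the given type that satisfy the equation `e₁ (t₁, t₂, t₃) = 0`. -/
def C₁ (a : Fin 4 → ℝ) (τ : HexType) : Set (S a) := {P | P.type = τ ∧ e₁ a P.t = 0}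

/-- `C` is a noncompact connected component of `X`. -/
def IsNoncompactComponent {X : Type*} [TopologicalSpace X] (C : Set X) : Prop :=
  (∃ x, C = connectedComponent x) ∧ ¬ IsCompact C

/-- A smooth (embedded) surface in `ℝ³`: locally the zero set of a smooth function with a nonzero
differential. -/
def IsSmoothSurface (M : Set (Fin 3 → ℝ)) : Prop :=
  ∀ x ∈ M, ∃ U : Set (Fin 3 → ℝ), IsOpen U ∧ x ∈ U ∧ ∃ f : (Fin 3 → ℝ) → ℝ,
    ContDiffOn ℝ ∞ f U ∧ fderiv ℝ f x ≠ 0 ∧ M ∩ U = {y ∈ U | f y = 0}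

/-- A smooth embedding of a Euclidean space into another one. -/
def IsSmoothEmb {E F : Type*} [NormedAddCommGroup E] [NormedSpace ℝ E] [NormedAddCommGroup F]
    [NormedSpace ℝ F] (f : E → F) : Prop :=
  ContDiff ℝ ∞ f ∧ IsEmbedding f ∧ ∀ x, Function.Injective (fderiv ℝ f x)

/-- `L` is a smooth line: the image of `ℝ` under a smooth embedding. -/
def IsSmoothLine (L : Set (Fin 3 → ℝ)) : Prop :=
  ∃ γ : ℝ → Fin 3 → ℝ, IsSmoothEmb γ ∧ Set.range γ = L

/-- `M ⊂ ℝ³` is a smooth plane, the image of `ℝ²` under a smooth embedding, and `L` divides it into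
the two parts `N` and `N'`: for a suitable such embedding, `L`, `N`, `N'` correspond to a straight
line and to the two closed half-planes that it bounds. -/
def DividesSmoothPlane (M L N N' : Set (Fin 3 → ℝ)) : Prop :=
  ∃ Φ : ℝ × ℝ → Fin 3 → ℝ, IsSmoothEmb Φ ∧ Set.range Φ = M ∧
    Φ '' {q | q.1 = 0} = L ∧ Φ '' {q | q.1 ≤ 0} = N ∧ Φ '' {q | 0 ≤ q.1} = N'

end

end HexSpace

open HexSpace

namespace HexSpace

-- A rotation R_{c,k} with |k| = 1 preserves both the hermitian form and the area form of V. A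
-- relation in PU(1,1) therefore lifts to R₃R₂R₁R₀ = δ with δ = ±1, where for the second type the
-- inverse rotations are taken. Put p₃ = (1,0), p₁ = R₁p₃, p₂ = R₂p₁. The inner products of
-- consecutive vertices are the u_j up to conjugation and a unit factor, and each centre is
-- recovered as p' - kp from consecutive vertices p, p'. So a hexagon is the same thing, up to
-- U(1,1), as three unit vectors with prescribed Gram matrix. Three vectors in a plane have
-- vanishing Gram determinant; this is the equation `eEq a δ t = 0`, and δ = 1 gives e₁ = 0.
-- Conversely, every solution with all t_j ≥ 1 comes from exactly one hexagon of each type up to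
-- congruence. Normal forms map properly to t, hence t is a closed embedding on each such part of S.
-- The parts with δ = 1 and δ = -1 are disjoint since every |u_j| is at least 1, and the part with δ
-- = -1 is compact because its t_j are bounded.
--
-- It remains to study the surface e₁ = 0. With c_j = cos a_j and σ_j = sin a_j, the affine
-- coordinates x_j = σ₀σ_j(2t_j - 1) - c₀c_j turn e₁, up to the factor σ₀², into the cubic `fr`. The
-- angle conditions, unless all a_j are π/2, force every x_j > 1 on the surface
-- (`one_lt_of_es_eq_zero`). For fixed x₂ > 1 the section of fr = 0 is a hyperbola in p = ½ ∂fr/∂x₁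
-- and an affine function w of x₃, namely w² = (x₂² - 1)p² + disc with disc > 0 (`mul_fr`). The
-- inequality `Balanced.sq_lt_disc` puts the line x₃ = 1 strictly between its branches, so the
-- surface is the graph of the branch w > 0 over the half-plane of all (p, x₂) with x₂ > 1. This
-- half-plane is a smooth plane.
--
-- By Vieta, t_j and t'_j are the two roots of e₁ as a quadratic in t_j, so ½ ∂fr/∂x_j = σ₀σ_j(t_j -
-- t'_j) (`dx_eq`). Thus A_j, H_j, H'_j are given by p = 0, p ≤ 0, p ≥ 0 in the parametrization
-- attached to j. Finally ∂₃ + x₂∂₁ = -w < 0 for the halved partial derivatives, so no two of them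
-- are nonnegative at the same point. This gives the disjointness of the A_j, the inclusions A_k ⊂
-- H_j, and the nonvanishing of de₁. If all a_j are π/2, the surface is a cone over which smoothness
-- fails at the apex (1,1,1).

local notation "conj" => starRingEnd ℂ

/-! ### Rotations, tances and the recovery of a centre -/

/-- The standard area form on `V`. -/
def area (v w : V) : ℂ := v 0 * w 1 - v 1 * w 0

/-- `⟨R_{c,k} p, p⟩ = umap k (ta c p)` for a unit vector `p`. -/
def umap (k : ℂ) (t : ℝ) : ℂ := (t : ℂ) * (conj k - k) + k

/-- The eigenvalues are k̄ on c and k on the orthogonal complement of c, so the determinant is 1.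
This is what limits the scalar in the relation to ±1. -/
theorem area_rot {c : V} (hc : IsPos c) {k : ℂ} (hk : k * conj k = 1) (v w : V) :
    area (rot c k v) (rot c k w) = area v w := by
  have h := hc.ne
  have key : herm v c * area c w + herm w c * area v c = herm c c * area v w := by
    simp only [herm, area]; ring
  have e : area (rot c k v) (rot c k w) = k * k * area v w +
      k * (conj k - k) * ((herm v c * area c w + herm w c * area v c) / herm c c) := by
    simp only [rot_apply, area, Pi.add_apply, Pi.smul_apply, smul_eq_mul]
    field_simp
    ring
  rw [e, key, mul_div_cancel_left₀ _ h]
  linear_combination (area v w) * hk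

/-- The Gram determinant of two vectors, with the sign that signature (1,1) produces; it reverses
Cauchy–Schwarz and so gives ta ≥ 1. -/
theorem herm_mul_herm (v w : V) :
    herm v w * herm w v = herm v v * herm w w + Complex.normSq (area v w) := by
  rw [Complex.normSq_eq_conj_mul_self]
  simp only [herm, area, map_sub, map_mul]
  ring

theorem herm_self_ofReal (v : V) : ((herm v v).re : ℂ) = herm v v :=
  Complex.conj_eq_iff_re.1 (herm_conj v v)

theorem ta_ofReal (p q : V) : (ta p q : ℂ) = herm p q * herm q p / (herm p p * herm q q) := by
  apply Complex.conj_eq_iff_re.1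
  simp only [map_div₀, map_mul, herm_conj]
  rw [mul_comm (herm q p)]

theorem one_le_ta {p q : V} (hp : IsPos p) (hq : IsPos q) : 1 ≤ ta p q := by
  have h : (ta p q : ℂ) = ((1 + Complex.normSq (area p q) / ((herm p p).re * (herm q q).re) : ℝ)) := by
    rw [ta_ofReal, herm_mul_herm]
    push_cast
    rw [herm_self_ofReal, herm_self_ofReal]
    field_simp [hp.ne, hq.ne]
  have h' : ta p q = 1 + Complex.normSq (area p q) / ((herm p p).re * (herm q q).re) := by
    exact_mod_cast h
  rw [h']
  have : 0 ≤ Complex.normSq (area p q) / ((herm p p).re * (herm q q).re) :=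
    div_nonneg (Complex.normSq_nonneg _) (mul_pos hp hq).le
  linarith

theorem herm_ne_zero {p q : V} (hp : IsPos p) (hq : IsPos q) : herm p q ≠ 0 := by
  intro h
  have := one_le_ta hp hq
  rw [ta, h] at this
  simp at this
  linarith

theorem isPos_of_herm_eq_one {p : V} (h : herm p p = 1) : IsPos p := by simp [IsPos, h]

theorem isPos_rot {c : V} (hc : IsPos c) {k : ℂ} (hk : k * conj k = 1) {p : V} (hp : IsPos p) :
    IsPos (rot c k p) := by
  unfold IsPos; rw [rot_unitary hc hk]; exact hp

theorem rot_self {c : V} (hc : IsPos c) (k : ℂ) : rot c k c = conj k • c := by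
  rw [rot_apply, div_self hc.ne, ← add_smul]; congr 1; ring

theorem conj_ne_zero_of_unit {k : ℂ} (hk : k * conj k = 1) : conj k ≠ 0 :=
  right_ne_zero_of_mul_eq_one hk

theorem ne_zero_of_unit {k : ℂ} (hk : k * conj k = 1) : k ≠ 0 := left_ne_zero_of_mul_eq_one hk

theorem ta_rot_rot {c : V} (hc : IsPos c) {k : ℂ} (hk : k * conj k = 1) (p q : V) :
    ta (rot c k p) (rot c k q) = ta p q := by
  simp only [ta, rot_unitary hc hk]

theorem ta_rot {c : V} (hc : IsPos c) {k : ℂ} (hk : k * conj k = 1) (p : V) :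
    ta c (rot c k p) = ta c p := by
  have h := ta_rot_rot hc hk c p
  rw [rot_self hc] at h
  rw [← h]
  simpa using (ta_smul (conj_ne_zero_of_unit hk) one_ne_zero c (rot c k p)).symm

theorem ta_smul_right {s : ℂ} (hs : s ≠ 0) (v w : V) : ta v (s • w) = ta v w := by
  simpa using ta_smul one_ne_zero hs v w

theorem herm_rot_self {c p : V} (hp : herm p p = 1) (k : ℂ) :
    herm (rot c k p) p = umap k (ta c p) := by
  rw [rot_apply, herm_add_left, herm_smul_left, herm_smul_left, umap, ta_ofReal, hp]
  ring

theorem umap_injective {k : ℂ} (hk : k.im ≠ 0) : Function.Injective (umap k) := by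
  intro s t h
  have := congrArg Complex.im h
  simp [umap] at this
  rcases this with h | h
  · exact h
  · exact absurd (by linarith) hk

theorem normSq_umap {k : ℂ} (hk : k * conj k = 1) (t : ℝ) :
    Complex.normSq (umap k t) = 1 + 4 * k.im ^ 2 * (t * (t - 1)) := by
  have h : k.re * k.re + k.im * k.im = 1 := by
    have := congrArg Complex.re hk
    simp at this; linarith
  simp [umap, Complex.normSq_apply]
  linear_combination h

theorem conj_umap (k : ℂ) (t : ℝ) : conj (umap k t) = umap (conj k) t := by
  simp [umap]

/-- Since R_{c,k}p - kp is a multiple of c, the only candidate for the centre of a rotation taking p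
to p' is p' - kp. This lemma and the next four show that it is positive, that it does the job, and
that it has the prescribed tance t to p. -/
theorem herm_center {k : ℂ} (hk : k * conj k = 1) {p p' : V}
    (hp : herm p p = 1) (hp' : herm p' p' = 1) {t : ℝ} (hu : herm p' p = umap k t) :
    herm (p' - k • p) (p' - k • p) = ((4 * t * k.im ^ 2 : ℝ) : ℂ) := by
  have hu' : herm p p' = conj (umap k t) := by rw [← hu, herm_conj]
  have e : herm (p' - k • p) (p' - k • p) =
      herm p' p' - conj k * herm p' p - k * herm p p' + k * conj k * herm p p := by
    simp only [herm, Pi.sub_apply, Pi.smul_apply, smul_eq_mul, map_sub, map_mul]; ring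
  rw [e, hu, hu', hp, hp', hk]
  have h : k.re * k.re + k.im * k.im = 1 := by
    have := congrArg Complex.re hk
    simp at this; linarith
  apply Complex.ext
  · rw [Complex.ofReal_re]; simp [umap]; linear_combination -2 * h
  · rw [Complex.ofReal_im]; simp [umap]; ring

theorem herm_center_right {k : ℂ} {p p' : V} (hp : herm p p = 1) {t : ℝ}
    (hu : herm p' p = umap k t) :
    herm p (p' - k • p) = (t : ℂ) * (k - conj k) := by
  have hu' : herm p p' = conj (umap k t) := by rw [← hu, herm_conj]
  have e : herm p (p' - k • p) = herm p p' - conj k * herm p p := by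
    simp only [herm, Pi.sub_apply, Pi.smul_apply, smul_eq_mul, map_sub, map_mul]; ring
  rw [e, hu', hp, conj_umap, umap]
  simp

theorem isPos_center {k : ℂ} (hk : k * conj k = 1) (hi : k.im ≠ 0) {p p' : V}
    (hp : herm p p = 1) (hp' : herm p' p' = 1) {t : ℝ} (hu : herm p' p = umap k t) (ht : 0 < t) :
    IsPos (p' - k • p) := by
  rw [IsPos, herm_center hk hp hp' hu, Complex.ofReal_re]
  positivity

theorem rot_center {k : ℂ} (hk : k * conj k = 1) (hi : k.im ≠ 0) {p p' : V}
    (hp : herm p p = 1) (hp' : herm p' p' = 1) {t : ℝ} (hu : herm p' p = umap k t) (ht : 0 < t) :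
    rot (p' - k • p) k p = p' := by
  have h1 : (conj k - k) * (herm p (p' - k • p) / herm (p' - k • p) (p' - k • p)) = 1 := by
    rw [herm_center_right hp hu, ← mul_div_assoc,
      div_eq_one_iff_eq (isPos_center hk hi hp hp' hu ht).ne, herm_center hk hp hp' hu]
    have : conj k - k = -(2 * k.im * Complex.I) := by
      apply Complex.ext <;> simp; ring
    rw [← neg_sub (conj k) k, this]
    push_cast
    linear_combination (- 4 * t * k.im ^ 2 : ℂ) * Complex.I_sq
  rw [rot_apply, h1, one_smul]
  simp

theorem ta_center {k : ℂ} (hk : k * conj k = 1) (hi : k.im ≠ 0) {p p' : V}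
    (hp : herm p p = 1) (hp' : herm p' p' = 1) {t : ℝ} (hu : herm p' p = umap k t) (ht : 0 < t) :
    ta (p' - k • p) p = t := by
  apply umap_injective hi
  rw [← herm_rot_self hp, rot_center hk hi hp hp' hu ht, hu]

theorem center_eq {c p : V} (hc : IsPos c) (hp : IsPos p) {k : ℂ} (hi : k.im ≠ 0) :
    ∃ r : ℂ, r ≠ 0 ∧ rot c k p - k • p = r • c := by
  refine ⟨_, ?_, by rw [rot_apply, add_sub_cancel_right]⟩
  refine mul_ne_zero ?_ (div_ne_zero (herm_ne_zero hp hc) hc.ne)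
  intro h
  apply hi
  have := congrArg Complex.im h
  simp at this
  linarith

/-- The unitary map that takes the positive vector `v` to a multiple of the first basis vector. -/
theorem exists_unitary {v : V} (hv : IsPos v) :
    ∃ g : V ≃ₗ[ℂ] V, IsUnitary g ∧ ∃ r : ℂ, r ≠ 0 ∧ g v = r • ![1, 0] := by
  set N : ℝ := Real.sqrt (herm v v).re with hN
  have hN0 : 0 < N := Real.sqrt_pos.2 hv
  have hN2 : (N : ℂ) * N = herm v v := by
    rw [← herm_self_ofReal]; exact_mod_cast Real.mul_self_sqrt hv.le
  have hNc : (N : ℂ) ≠ 0 := by exact_mod_cast hN0.ne'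
  -- The coordinates of w along v and along its orthogonal complement, divided by the length of v;
  -- the second one is measured by the area form.
  let f : V →ₗ[ℂ] V :=
    { toFun := fun w => ![herm w v / N, area v w / N]
      map_add' := fun x y => by
        ext i; fin_cases i <;> simp [herm, area] <;> ring
      map_smul' := fun r x => by
        ext i; fin_cases i <;> simp [herm, area] <;> ring }
  have hf : ∀ x y, herm (f x) (f y) = herm x y := by
    intro x y
    have : herm (f x) (f y) = (herm x v * conj (herm y v) - area v x * conj (area v y)) / (N * N) := by
      simp [f, herm]
      field_simp
    rw [this, hN2, div_eq_iff hv.ne]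
    simp only [herm, area, map_sub, map_mul, Complex.conj_conj]
    ring
  have hinj : Function.Injective f := by
    rw [← LinearMap.ker_eq_bot, LinearMap.ker_eq_bot']
    intro x hx
    have h0 : ∀ y, herm x y = 0 := fun y => by rw [← hf, hx]; simp [herm]
    ext i
    fin_cases i
    · simpa [herm] using h0 ![1, 0]
    · simpa [herm] using h0 ![0, 1]
  refine ⟨LinearEquiv.ofInjectiveEndo f hinj, fun x y => hf x y, N, hNc, ?_⟩
  change f v = _
  ext i
  fin_cases i
  · simp [f, ← hN2]
  · simp [f, area]; left; ring

/-! ### Hexagons in normal form -/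

/-- The parameter of the rotation `turn a c j τ`. -/
noncomputable def kt (a : Fin 4 → ℝ) (τ : HexType) (j : Fin 4) : ℂ :=
  match τ with
  | .first => kk a j
  | .second => conj (kk a j)

theorem turn_eq (a : Fin 4 → ℝ) (c : Fin 4 → V) (j : Fin 4) (τ : HexType) :
    turn a c j τ = rot (c j) (kt a τ j) := by cases τ <;> rfl

theorem kt_mul_conj (a : Fin 4 → ℝ) (τ : HexType) (j : Fin 4) :
    kt a τ j * conj (kt a τ j) = 1 := by
  cases τ
  · exact kk_mul_conj a j
  · simp only [kt, Complex.conj_conj]; rw [mul_comm]; exact kk_mul_conj a j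

theorem kk_re (a : Fin 4 → ℝ) (j : Fin 4) : (kk a j).re = Real.cos (a j) := by
  rw [kk, Complex.exp_ofReal_mul_I_re]

theorem kk_im (a : Fin 4 → ℝ) (j : Fin 4) : (kk a j).im = Real.sin (a j) := by
  rw [kk, Complex.exp_ofReal_mul_I_im]

theorem kt_im_sq (a : Fin 4 → ℝ) (τ : HexType) (j : Fin 4) :
    (kt a τ j).im ^ 2 = (kk a j).im ^ 2 := by cases τ <;> simp [kt]

theorem kt_im_ne_zero {a : Fin 4 → ℝ} (ha : ∀ j, a j ∈ Set.Ioo (0 : ℝ) Real.pi) (τ : HexType)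
    (j : Fin 4) : (kt a τ j).im ≠ 0 := by
  have : (kt a τ j).im ^ 2 ≠ 0 := by
    rw [kt_im_sq, kk_im]
    exact pow_ne_zero _ (Real.sin_pos_of_mem_Ioo (ha j)).ne'
  exact fun h => this (by simp [h])

theorem kt_swap (a : Fin 4 → ℝ) (τ : HexType) (j : Fin 4) :
    kt a τ.swap j = conj (kt a τ j) := by cases τ <;> simp [kt, HexType.swap]

/-- `ut a τ t j = ⟨p_{j+1}, p_j⟩` in a hexagon with unit vectors `p_j`. -/
noncomputable def ut (a : Fin 4 → ℝ) (τ : HexType) (t : Fin 3 → ℝ) (j : Fin 3) : ℂ :=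
  umap (kt a τ j.succ) (t j)

theorem ut_first (a : Fin 4 → ℝ) (t : Fin 3 → ℝ) (j : Fin 3) : ut a .first t j = u a t j := rfl

theorem ut_second (a : Fin 4 → ℝ) (t : Fin 3 → ℝ) (j : Fin 3) :
    ut a .second t j = conj (u a t j) := by
  simp [ut, kt, umap, u]

/-- The first basis vector of `V`, a unit vector. -/
noncomputable def e0 : V := ![1, 0]

/-- Hexagons with `p₃ = (1, 0)`, `p₁ = (u₁, y)`, `p₂ = (μ ū₃, z)` and
`R₃ R₂ R₁ R₀ = δ`, given by `(y, z, t)`. -/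
noncomputable def NF (a : Fin 4 → ℝ) (τ : HexType) (δ : ℝ) : Set (ℂ × ℂ × (Fin 3 → ℝ)) :=
  {n | (∀ j, 1 ≤ n.2.2 j) ∧
    Complex.normSq n.1 = Complex.normSq (ut a τ n.2.2 0) - 1 ∧
    Complex.normSq n.2.1 = Complex.normSq (ut a τ n.2.2 2) - 1 ∧
    n.2.1 * conj n.1 = δ * kt a τ 0 * conj (ut a τ n.2.2 2) * conj (ut a τ n.2.2 0)
      - ut a τ n.2.2 1}

noncomputable def nf1 (a : Fin 4 → ℝ) (τ : HexType) (n : ℂ × ℂ × (Fin 3 → ℝ)) : V := ![ut a τ n.2.2 0, n.1]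

noncomputable def nf2 (a : Fin 4 → ℝ) (τ : HexType) (δ : ℝ) (n : ℂ × ℂ × (Fin 3 → ℝ)) : V :=
  ![δ * kt a τ 0 * conj (ut a τ n.2.2 2), n.2.1]

/-- The centers of the rotations of a hexagon in normal form. -/
noncomputable def nfC (a : Fin 4 → ℝ) (τ : HexType) (δ : ℝ) (n : ℂ × ℂ × (Fin 3 → ℝ)) : Fin 4 → V :=
  ![e0, nf1 a τ n - kt a τ 1 • e0, nf2 a τ δ n - kt a τ 2 • nf1 a τ n,
    (δ * kt a τ 0) • e0 - kt a τ 3 • nf2 a τ δ n]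

/-- A map that preserves both forms is determined by its value on one unit vector: orthogonality
fixes the line of the image of the second basis vector, and the area fixes the factor. -/
theorem isScalar_of_apply_e0 {T : Module.End ℂ V} (hT : ∀ v w, herm (T v) (T w) = herm v w)
    (hT' : ∀ v w, area (T v) (T w) = area v w) {δ : ℝ} (hδ : δ ^ 2 = 1)
    (h : T e0 = (δ : ℂ) • e0) : T = (δ : ℂ) • (1 : Module.End ℂ V) := by
  have hδ' : (δ : ℂ) * δ = 1 := by rw [← pow_two]; exact_mod_cast hδ
  have hδ0 : (δ : ℂ) ≠ 0 := left_ne_zero_of_mul_eq_one hδ'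
  have h1 := hT ![0, 1] e0
  have h2 := hT' e0 ![0, 1]
  rw [h] at h1 h2
  have h3 : T ![0, 1] = (δ : ℂ) • ![0, 1] := by
    ext i
    fin_cases i
    · simpa [herm, e0, hδ0] using h1
    · simp [area, e0] at h2
      simp
      linear_combination (δ : ℂ) * h2 - T ![0, 1] 1 * hδ'
  refine LinearMap.ext fun v => ?_
  have hv : v = v 0 • e0 + v 1 • ![0, 1] := by ext i; fin_cases i <;> simp [e0]
  rw [hv, map_add, map_smul, map_smul, h, h3, LinearMap.smul_apply, Module.End.one_apply, smul_add,
    smul_comm (v 0), smul_comm (v 1)]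

theorem relation_iff_turn {a : Fin 4 → ℝ} {c : Fin 4 → V} (hc : ∀ j, IsPos (c j)) (τ : HexType) :
    Relation a c τ ↔ IsScalar (turn a c 3 τ * turn a c 2 τ * turn a c 1 τ * turn a c 0 τ) :=
  (relation_iff a c hc τ).trans Iff.rfl

theorem area_turn {a : Fin 4 → ℝ} {c : Fin 4 → V} (hc : ∀ j, IsPos (c j)) (j : Fin 4)
    (τ : HexType) (v w : V) : area (turn a c j τ v) (turn a c j τ w) = area v w := by
  rw [turn_eq]; exact area_rot (hc j) (kt_mul_conj a τ j) v w

theorem herm_e0 : herm e0 e0 = 1 := by simp [herm, e0]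

section NF
variable {a : Fin 4 → ℝ} {τ : HexType} {δ : ℝ} {n : ℂ × ℂ × (Fin 3 → ℝ)}

theorem mu_mul_conj (hδ : δ ^ 2 = 1) :
    (δ * kt a τ 0) * conj (δ * kt a τ 0) = 1 := by
  have h : (δ : ℂ) * δ = 1 := by rw [← pow_two]; exact_mod_cast hδ
  rw [map_mul, Complex.conj_ofReal]
  linear_combination (kt a τ 0 * conj (kt a τ 0)) * h + kt_mul_conj a τ 0

theorem herm_nf1 (hn : n ∈ NF a τ δ) : herm (nf1 a τ n) (nf1 a τ n) = 1 := by
  simp only [herm, nf1, Matrix.cons_val_zero, Matrix.cons_val_one, Complex.mul_conj, hn.2.1]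
  push_cast; ring

theorem herm_nf2 (hδ : δ ^ 2 = 1) (hn : n ∈ NF a τ δ) :
    herm (nf2 a τ δ n) (nf2 a τ δ n) = 1 := by
  have h := mu_mul_conj (a := a) (τ := τ) hδ
  have h3 := Complex.mul_conj (ut a τ n.2.2 2)
  simp only [herm, nf2, Matrix.cons_val_zero, Matrix.cons_val_one, Complex.mul_conj n.2.1,
    hn.2.2.1, map_mul, Complex.conj_conj] at h ⊢
  push_cast
  linear_combination (ut a τ n.2.2 2 * conj (ut a τ n.2.2 2)) * h + h3

theorem herm_nf1_e0 : herm (nf1 a τ n) e0 = ut a τ n.2.2 0 := by simp [herm, nf1, e0]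

theorem herm_nf2_nf1 (hn : n ∈ NF a τ δ) :
    herm (nf2 a τ δ n) (nf1 a τ n) = ut a τ n.2.2 1 := by
  simp only [herm, nf1, nf2, Matrix.cons_val_zero, Matrix.cons_val_one, hn.2.2.2]
  ring

theorem herm_e0_nf2 : herm e0 (nf2 a τ δ n) = conj (δ * kt a τ 0) * ut a τ n.2.2 2 := by
  simp [herm, nf2, e0]

theorem herm_mu_nf2 (hδ : δ ^ 2 = 1) :
    herm ((δ * kt a τ 0) • e0) (nf2 a τ δ n) = ut a τ n.2.2 2 := by
  rw [herm_smul_left, herm_e0_nf2, ← mul_assoc, mu_mul_conj hδ, one_mul]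

theorem herm_mu_e0 (hδ : δ ^ 2 = 1) :
    herm ((δ * kt a τ 0) • e0) ((δ * kt a τ 0) • e0) = 1 := by
  rw [herm_smul_smul, mu_mul_conj hδ, herm_e0, one_mul]

theorem turn_nfC_one (ha : ∀ j, a j ∈ Set.Ioo (0 : ℝ) Real.pi) (hn : n ∈ NF a τ δ) :
    turn a (nfC a τ δ n) 1 τ e0 = nf1 a τ n := by
  rw [turn_eq]
  exact rot_center (kt_mul_conj a τ 1) (kt_im_ne_zero ha τ 1) herm_e0 (herm_nf1 hn)
      herm_nf1_e0 (one_pos.trans_le (hn.1 0))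

theorem nfC_pos (ha : ∀ j, a j ∈ Set.Ioo (0 : ℝ) Real.pi) (hδ : δ ^ 2 = 1)
    (hn : n ∈ NF a τ δ) (j : Fin 4) : IsPos (nfC a τ δ n j) := by
  have ht : ∀ j, 0 < n.2.2 j := fun j => one_pos.trans_le (hn.1 j)
  fin_cases j
  · exact isPos_of_herm_eq_one herm_e0
  · exact isPos_center (kt_mul_conj a τ 1) (kt_im_ne_zero ha τ 1) herm_e0 (herm_nf1 hn)
      herm_nf1_e0 (ht 0)
  · exact isPos_center (kt_mul_conj a τ 2) (kt_im_ne_zero ha τ 2) (herm_nf1 hn)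
      (herm_nf2 hδ hn) (herm_nf2_nf1 hn) (ht 1)
  · exact isPos_center (kt_mul_conj a τ 3) (kt_im_ne_zero ha τ 3) (herm_nf2 hδ hn)
      (herm_mu_e0 hδ) (herm_mu_nf2 hδ) (ht 2)

theorem turn_nfC_two (ha : ∀ j, a j ∈ Set.Ioo (0 : ℝ) Real.pi) (hδ : δ ^ 2 = 1)
    (hn : n ∈ NF a τ δ) :
    turn a (nfC a τ δ n) 2 τ (nf1 a τ n) = nf2 a τ δ n := by
  rw [turn_eq]
  exact rot_center (kt_mul_conj a τ 2) (kt_im_ne_zero ha τ 2) (herm_nf1 hn)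
      (herm_nf2 hδ hn) (herm_nf2_nf1 hn) (one_pos.trans_le (hn.1 1))

theorem turn_nfC_three (ha : ∀ j, a j ∈ Set.Ioo (0 : ℝ) Real.pi) (hδ : δ ^ 2 = 1)
    (hn : n ∈ NF a τ δ) :
    turn a (nfC a τ δ n) 3 τ (nf2 a τ δ n) = (δ * kt a τ 0) • e0 := by
  rw [turn_eq]
  exact rot_center (kt_mul_conj a τ 3) (kt_im_ne_zero ha τ 3) (herm_nf2 hδ hn)
      (herm_mu_e0 hδ) (herm_mu_nf2 hδ) (one_pos.trans_le (hn.1 2))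

/-- R₀ multiplies `e0` by the conjugate of `kt a τ 0`, and the other three turns take `e0` through
the vertices to `δ * kt a τ 0` times itself. So the product takes `e0` to `δ • e0`, which suffices.
-/
theorem nfC_rel (ha : ∀ j, a j ∈ Set.Ioo (0 : ℝ) Real.pi) (hδ : δ ^ 2 = 1)
    (hn : n ∈ NF a τ δ) :
    Relation a (nfC a τ δ n) τ := by
  have hp := nfC_pos ha hδ hn
  rw [relation_iff_turn hp]
  refine ⟨δ, isScalar_of_apply_e0 (fun v w => ?_) (fun v w => ?_) hδ ?_⟩
  · simp only [Module.End.mul_apply, turn_unitary hp]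
  · simp only [Module.End.mul_apply, area_turn hp]
  · have h0 : turn a (nfC a τ δ n) 0 τ e0 = conj (kt a τ 0) • e0 := by
      rw [turn_eq]
      exact rot_self (hp 0) _
    simp only [Module.End.mul_apply]
    rw [h0, map_smul, map_smul, map_smul, turn_nfC_one ha hn, turn_nfC_two ha hδ hn,
      turn_nfC_three ha hδ hn, smul_smul]
    congr 1
    linear_combination (δ : ℂ) * kt_mul_conj a τ 0

/-- The hexagon with the given normal form. -/
noncomputable def nfHex (ha : ∀ j, a j ∈ Set.Ioo (0 : ℝ) Real.pi) (hδ : δ ^ 2 = 1)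
    (hn : n ∈ NF a τ δ) : Hexagon a := ⟨τ, nfC a τ δ n, nfC_pos ha hδ hn, nfC_rel ha hδ hn⟩

theorem pt_nfC (ha : ∀ j, a j ∈ Set.Ioo (0 : ℝ) Real.pi) (hδ : δ ^ 2 = 1)
    (hn : n ∈ NF a τ δ) :
    pt a τ (nfC a τ δ n) = ![nf1 a τ n, nf2 a τ δ n, e0] := by
  have h : nfC a τ δ n 0 = e0 := rfl
  simp only [pt, h]
  rw [turn_nfC_one ha hn, turn_nfC_two ha hδ hn]

theorem tVec_nfC (ha : ∀ j, a j ∈ Set.Ioo (0 : ℝ) Real.pi) (hδ : δ ^ 2 = 1)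
    (hn : n ∈ NF a τ δ) :
    tVec a τ (nfC a τ δ n) = n.2.2 := by
  have hp := nfC_pos ha hδ hn
  have ht : ∀ j, 0 < n.2.2 j := fun j => one_pos.trans_le (hn.1 j)
  funext j
  rw [tVec, pt_nfC ha hδ hn]
  fin_cases j
  · change ta (nfC a τ δ n 1) (nf1 a τ n) = _
    rw [← turn_nfC_one ha hn, turn_eq, ta_rot (hp 1) (kt_mul_conj a τ 1)]
    exact ta_center (kt_mul_conj a τ 1) (kt_im_ne_zero ha τ 1) herm_e0 (herm_nf1 hn)
      herm_nf1_e0 (ht 0)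
  · change ta (nfC a τ δ n 2) (nf2 a τ δ n) = _
    rw [← turn_nfC_two ha hδ hn, turn_eq, ta_rot (hp 2) (kt_mul_conj a τ 2)]
    exact ta_center (kt_mul_conj a τ 2) (kt_im_ne_zero ha τ 2) (herm_nf1 hn)
      (herm_nf2 hδ hn) (herm_nf2_nf1 hn) (ht 1)
  · change ta (nfC a τ δ n 3) e0 = _
    rw [← ta_smul_right (ne_zero_of_unit (mu_mul_conj (a := a) (τ := τ) hδ)),
      ← turn_nfC_three ha hδ hn, turn_eq, ta_rot (hp 3) (kt_mul_conj a τ 3)]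
    exact ta_center (kt_mul_conj a τ 3) (kt_im_ne_zero ha τ 3) (herm_nf2 hδ hn)
      (herm_mu_e0 hδ) (herm_mu_nf2 hδ) (ht 2)

end NF

/-! ### The tances t'_j and the Gram equation -/

/-- Expands ⟨q, p' - kp⟩ for the centre p' - kp, whose square norm is 4t(Im k)². It expresses t_j
t'_j by the inner products of the vertices. -/
theorem ta_center_mul {k : ℂ} (hk : k * conj k = 1) (hi : k.im ≠ 0) {p p' q : V}
    (hp : herm p p = 1) (hp' : herm p' p' = 1) {t : ℝ} (hu : herm p' p = umap k t) (ht : 0 < t)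
    (hq : herm q q = 1) :
    4 * k.im ^ 2 * (t * ta (p' - k • p) q) =
      Complex.normSq (herm q p' - conj k * herm q p) := by
  have hc := isPos_center hk hi hp hp' hu ht
  have e : herm q (p' - k • p) = herm q p' - conj k * herm q p := by
    simp only [herm, Pi.sub_apply, Pi.smul_apply, smul_eq_mul, map_sub, map_mul]; ring
  have : ((4 * k.im ^ 2 * (t * ta (p' - k • p) q) : ℝ) : ℂ) =
      (Complex.normSq (herm q p' - conj k * herm q p) : ℝ) := by
    rw [← e, Complex.normSq_eq_conj_mul_self, herm_conj]
    have h1 : ((4 * k.im ^ 2 * (t * ta (p' - k • p) q) : ℝ) : ℂ) =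
        ((4 * t * k.im ^ 2 : ℝ) : ℂ) * ta (p' - k • p) q := by push_cast; ring
    rw [h1, ta_ofReal, ← herm_center hk hp hp' hu, hq, mul_one, mul_div_cancel₀ _ hc.ne]
  exact_mod_cast this

theorem t'_nfC {a : Fin 4 → ℝ} {τ : HexType} {δ : ℝ} {n : ℂ × ℂ × (Fin 3 → ℝ)}
    (ha : ∀ j, a j ∈ Set.Ioo (0 : ℝ) Real.pi) (hδ : δ ^ 2 = 1) (hn : n ∈ NF a τ δ) (j : Fin 3) :
    4 * (kk a j.succ).im ^ 2 * (n.2.2 j * tVec' a τ (nfC a τ δ n) j) =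
      Complex.normSq (u a n.2.2 (j + 1) -
        δ * kk a 0 * conj (kk a j.succ) * conj (u a n.2.2 (j + 2))) := by
  have ht : ∀ j, 0 < n.2.2 j := fun j => one_pos.trans_le (hn.1 j)
  have key : 4 * (kk a j.succ).im ^ 2 * (n.2.2 j * tVec' a τ (nfC a τ δ n) j) =
      Complex.normSq (ut a τ n.2.2 (j + 1) -
        δ * kt a τ 0 * conj (kt a τ j.succ) * conj (ut a τ n.2.2 (j + 2))) := by
    have hμ := mu_mul_conj (a := a) (τ := τ) hδ
    -- Around the third side the vertex p₃ comes back multiplied by the unit `δ * kt a τ 0`; this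
    -- factor does not affect moduli.
    have hns : ∀ z w : ℂ, z = conj (δ * kt a τ 0) * w →
        Complex.normSq z = Complex.normSq w := by
      intro z w h
      have h1 : Complex.normSq (conj (δ * kt a τ 0)) = 1 := by
        rw [Complex.normSq_conj, ← Complex.ofReal_inj, ← Complex.mul_conj, hμ, Complex.ofReal_one]
      rw [h, map_mul, h1, one_mul]
    rw [tVec', pt_nfC ha hδ hn, ← kt_im_sq a τ]
    fin_cases j
    · refine (ta_center_mul (kt_mul_conj a τ 1) (kt_im_ne_zero ha τ 1) herm_e0 (herm_nf1 hn)
        herm_nf1_e0 (ht 0) (herm_nf2 hδ hn)).trans ?_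
      rw [herm_nf2_nf1 hn, ← herm_conj e0, herm_e0_nf2]
      congr 1
      simp
      ring
    · refine (ta_center_mul (kt_mul_conj a τ 2) (kt_im_ne_zero ha τ 2) (herm_nf1 hn)
        (herm_nf2 hδ hn) (herm_nf2_nf1 hn) (ht 1) herm_e0).trans ?_
      rw [herm_e0_nf2, ← herm_conj (nf1 a τ n) e0, herm_nf1_e0]
      apply hns
      change _ = _ * (ut a τ n.2.2 2 - δ * kt a τ 0 * conj (kt a τ 2) * conj (ut a τ n.2.2 0))
      linear_combination (conj (kt a τ 2) * conj (ut a τ n.2.2 0)) * hμ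
    · refine (ta_center_mul (kt_mul_conj a τ 3) (kt_im_ne_zero ha τ 3) (herm_nf2 hδ hn)
        (herm_mu_e0 hδ) (herm_mu_nf2 hδ) (ht 2) (herm_nf1 hn)).trans ?_
      rw [herm_smul_right, herm_nf1_e0, ← herm_conj (nf2 a τ δ n), herm_nf2_nf1 hn]
      apply hns
      change _ = _ * (ut a τ n.2.2 0 - δ * kt a τ 0 * conj (kt a τ 3) * conj (ut a τ n.2.2 1))
      linear_combination (conj (kt a τ 3) * conj (ut a τ n.2.2 1)) * hμ
  rw [key]
  cases τ
  · rfl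
  -- For the second type every quantity is the complex conjugate of that for the first type.
  · rw [← Complex.normSq_conj]
    simp [ut_second, kt]

theorem normSq_ut (a : Fin 4 → ℝ) (τ : HexType) (t : Fin 3 → ℝ) (j : Fin 3) :
    Complex.normSq (ut a τ t j) = 1 + 4 * (kk a j.succ).im ^ 2 * (t j * (t j - 1)) := by
  rw [ut, normSq_umap (kt_mul_conj a τ _), kt_im_sq]

/-- The equation of the hexagons with `R₃ R₂ R₁ R₀ = δ`; for `δ = 1` it is `e₁`. -/
noncomputable def eEq (a : Fin 4 → ℝ) (δ : ℝ) (t : Fin 3 → ℝ) : ℝ :=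
  Complex.normSq (u a t 0) + Complex.normSq (u a t 1) + Complex.normSq (u a t 2) - 1 -
    2 * δ * (conj (kk a 0) * u a t 0 * u a t 1 * u a t 2).re

theorem eEq_one (a : Fin 4 → ℝ) : eEq a 1 = e₁ a := by
  funext t
  simp only [eEq, e₁, Complex.normSq_eq_norm_sq, mul_one]

/-- Minus the determinant of the Gram matrix of p₃, p₁, p₂. The left side is that determinant after
elimination of p₃: it compares the second coordinates y, z through |z ȳ|² and |y|²|z|². -/
theorem normSq_gram {μ : ℂ} (hμ : μ * conj μ = 1) (u₀ u₁ u₂ : ℂ) :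
    Complex.normSq (μ * conj u₂ * conj u₀ - u₁) -
      (Complex.normSq u₀ - 1) * (Complex.normSq u₂ - 1) =
    Complex.normSq u₀ + Complex.normSq u₁ + Complex.normSq u₂ - 1 -
      2 * (conj μ * u₀ * u₁ * u₂).re := by
  have h : Complex.normSq μ = 1 := by
    rw [← Complex.ofReal_inj, ← Complex.mul_conj, hμ, Complex.ofReal_one]
  rw [Complex.normSq_sub, map_mul, map_mul, Complex.normSq_conj, Complex.normSq_conj, h]
  have : (μ * conj u₂ * conj u₀ * conj u₁).re = (conj μ * u₀ * u₁ * u₂).re := by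
    rw [← Complex.conj_re (conj μ * u₀ * u₁ * u₂)]
    congr 1
    simp; ring
  rw [this]; ring

theorem eEq_eq_gram (a : Fin 4 → ℝ) (τ : HexType) {δ : ℝ} (hδ : δ ^ 2 = 1) (t : Fin 3 → ℝ) :
    Complex.normSq (δ * kt a τ 0 * conj (ut a τ t 2) * conj (ut a τ t 0) - ut a τ t 1) -
      (Complex.normSq (ut a τ t 0) - 1) * (Complex.normSq (ut a τ t 2) - 1) = eEq a δ t := by
  rw [normSq_gram (mu_mul_conj hδ), eEq]
  cases τ
  · have : conj (δ * kt a .first 0) * u a t 0 * u a t 1 * u a t 2 =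
      δ * (conj (kk a 0) * u a t 0 * u a t 1 * u a t 2) := by
      simp [kt]; ring
    simp only [ut_first, this, Complex.re_ofReal_mul]
    ring
  · have : conj (δ * kt a .second 0) * conj (u a t 0) * conj (u a t 1) * conj (u a t 2) =
      δ * conj (conj (kk a 0) * u a t 0 * u a t 1 * u a t 2) := by
      simp [kt]; ring
    simp only [ut_second, this, Complex.re_ofReal_mul, Complex.normSq_conj, Complex.conj_re]
    ring

theorem eEq_of_mem_NF {a : Fin 4 → ℝ} {τ : HexType} {δ : ℝ} {n : ℂ × ℂ × (Fin 3 → ℝ)}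
    (hδ : δ ^ 2 = 1) (hn : n ∈ NF a τ δ) : eEq a δ n.2.2 = 0 := by
  rw [← eEq_eq_gram a τ hδ, ← hn.2.2.2, ← hn.2.1, ← hn.2.2.1, map_mul, Complex.normSq_conj]
  ring

theorem exists_mem_NF {a : Fin 4 → ℝ} (τ : HexType) {δ : ℝ} (hδ : δ ^ 2 = 1) {t : Fin 3 → ℝ}
    (ht : ∀ j, 1 ≤ t j) (h : eEq a δ t = 0) : ∃ n ∈ NF a τ δ, n.2.2 = t := by
  rw [← eEq_eq_gram a τ hδ] at h
  set w := δ * kt a τ 0 * conj (ut a τ t 2) * conj (ut a τ t 0) - ut a τ t 1 with hw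
  have hnn : ∀ j, 0 ≤ Complex.normSq (ut a τ t j) - 1 := fun j => by
    rw [normSq_ut]
    have := mul_nonneg (one_pos.le.trans (ht j)) (sub_nonneg.2 (ht j))
    have := mul_nonneg (sq_nonneg (kk a j.succ).im) this
    linarith
  -- If y = 0, the equation forces the prescribed value of z ȳ to vanish as well, and only |z|
  -- matters. Otherwise the common phase of y and z is used to make y positive, and z is then
  -- forced.
  by_cases h0 : Complex.normSq (ut a τ t 0) - 1 = 0
  · refine ⟨(0, Real.sqrt (Complex.normSq (ut a τ t 2) - 1), t), ⟨ht, ?_, ?_, ?_⟩, rfl⟩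
    · rw [h0]; simp
    · rw [Complex.normSq_ofReal, Real.mul_self_sqrt (hnn 2)]
    · rw [h0, zero_mul, sub_zero, Complex.normSq_eq_zero] at h
      rw [← hw, h]; simp
  · have h1 : 0 < Complex.normSq (ut a τ t 0) - 1 := lt_of_le_of_ne (hnn 0) (Ne.symm h0)
    set r := Real.sqrt (Complex.normSq (ut a τ t 0) - 1) with hr
    have hr0 : 0 < r := Real.sqrt_pos.2 h1
    have hr2 : r * r = Complex.normSq (ut a τ t 0) - 1 := Real.mul_self_sqrt h1.le
    refine ⟨(r, w / r, t), ⟨ht, ?_, ?_, ?_⟩, rfl⟩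
    · rw [Complex.normSq_ofReal, hr2]
    · rw [map_div₀, Complex.normSq_ofReal, hr2, div_eq_iff h0]
      linarith
    · have : (r : ℂ) ≠ 0 := by exact_mod_cast hr0.ne'
      change w / r * conj (r : ℂ) = w
      rw [Complex.conj_ofReal, div_mul_cancel₀ _ this]

/-! ### Uniqueness and existence of the normal form -/

/-- The triple t fixes |y|, |z| and z ȳ, so (y, z) is determined up to a common phase l. The
rotation diag(1, l) about p₃ absorbs it. -/
theorem congr_nfC_of_t_eq {a : Fin 4 → ℝ} {τ : HexType} {δ : ℝ} {n n' : ℂ × ℂ × (Fin 3 → ℝ)}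
    (hn : n ∈ NF a τ δ) (hn' : n' ∈ NF a τ δ) (h : n.2.2 = n'.2.2) :
    Congr (nfC a τ δ n) (nfC a τ δ n') := by
  obtain ⟨y, z, t⟩ := n
  obtain ⟨y', z', t'⟩ := n'
  obtain rfl : t = t' := h
  obtain ⟨-, hy, hz, hyz⟩ := hn
  obtain ⟨-, hy', hz', hyz'⟩ := hn'
  simp only at hy hz hyz hy' hz' hyz'
  obtain ⟨l, hl, hly, hlz⟩ : ∃ l : ℂ, l * conj l = 1 ∧ y' = l * y ∧ z' = l * z := by
    have hyy : Complex.normSq y' = Complex.normSq y := hy'.trans hy.symm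
    have hzz : Complex.normSq z' = Complex.normSq z := hz'.trans hz.symm
    have unit : ∀ w w' : ℂ, w ≠ 0 → Complex.normSq w' = Complex.normSq w →
        (w' / w) * conj (w' / w) = 1 := by
      intro w w' hw h
      rw [Complex.mul_conj, map_div₀, h, div_self (by simpa using hw), Complex.ofReal_one]
    by_cases h0 : y = 0
    · have h0' : y' = 0 := by simpa [h0] using hyy
      by_cases h1 : z = 0
      · have h1' : z' = 0 := by simpa [h1] using hzz
        exact ⟨1, by simp, by simp [h0, h0'], by simp [h1, h1']⟩
      · exact ⟨z' / z, unit z z' h1 hzz, by simp [h0, h0'], by field_simp⟩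
    · have h0' : conj y' ≠ 0 := by
        simp only [ne_eq, map_eq_zero]
        intro h; rw [h] at hyy; simp at hyy; exact h0 (by simpa using hyy.symm)
      refine ⟨y' / y, unit y y' h0 hyy, by field_simp, ?_⟩
      apply mul_right_cancel₀ h0'
      rw [hyz', ← hyz]
      have := unit y y' h0 hyy
      rw [map_div₀] at this
      have h2 : conj y ≠ 0 := by simpa using h0
      field_simp at this
      field_simp
      linear_combination (-z) * this
  have hl0 : l ≠ 0 := ne_zero_of_unit hl
  let g : V ≃ₗ[ℂ] V :=
    { toFun := fun v => ![v 0, l * v 1]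
      invFun := fun v => ![v 0, l⁻¹ * v 1]
      map_add' := fun v w => by ext i; fin_cases i <;> simp; ring
      map_smul' := fun r v => by ext i; fin_cases i <;> simp; ring
      left_inv := fun v => by ext i; fin_cases i <;> simp [hl0]
      right_inv := fun v => by ext i; fin_cases i <;> simp [hl0] }
  have hg : ∀ v, g v = ![v 0, l * v 1] := fun _ => rfl
  refine ⟨g, fun v w => ?_, fun _ => 1, fun _ => one_ne_zero, fun j => ?_⟩
  · rw [hg, hg]
    simp only [herm, Matrix.cons_val_zero, Matrix.cons_val_one, map_mul]
    linear_combination (- v 1 * conj (w 1)) * hl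
  · have h0 : g e0 = e0 := by rw [hg]; ext i; fin_cases i <;> simp [e0]
    have h1 : g (nf1 a τ (y, z, t)) = nf1 a τ (y', z', t) := by rw [hg, nf1, nf1]; simp [hly]
    have h2 : g (nf2 a τ δ (y, z, t)) = nf2 a τ δ (y', z', t) := by rw [hg, nf2, nf2]; simp [hlz]
    rw [one_smul]
    fin_cases j
    · exact h0.symm
    · change _ - _ = g (_ - _)
      rw [map_sub, map_smul, h0, h1]
    · change _ - _ = g (_ - _)
      rw [map_sub, map_smul, h2, h1]
    · change _ - _ = g (_ - _)
      rw [map_sub, map_smul, map_smul, h2, h0]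

theorem exists_normalized {c : Fin 4 → V} (hc : IsPos (c 0)) :
    ∃ d : Fin 4 → V, Congr c d ∧ d 0 = e0 := by
  obtain ⟨g, hg, r, hr, h⟩ := exists_unitary hc
  refine ⟨fun j => (if j = 0 then r⁻¹ else 1) • g (c j), ⟨g, hg, fun j => if j = 0 then r⁻¹ else 1,
    fun j => ?_, fun j => rfl⟩, ?_⟩
  · dsimp only
    split_ifs
    · exact inv_ne_zero hr
    · exact one_ne_zero
  · simp only [if_true, h, smul_smul, inv_mul_cancel₀ hr, one_smul]
    rfl

theorem IsPos.of_congr {c d : Fin 4 → V} (h : Congr c d) (hc : ∀ j, IsPos (c j)) (j : Fin 4) :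
    IsPos (d j) := by
  obtain ⟨g, hg, r, hr, h⟩ := h
  rw [IsPos, h j, herm_smul_smul, hg, Complex.mul_conj, Complex.re_ofReal_mul]
  exact mul_pos (Complex.normSq_pos.2 (hr j)) (hc j)

theorem relation_of_congr {a : Fin 4 → ℝ} {τ : HexType} {c d : Fin 4 → V} (h : Congr c d)
    (hc : ∀ j, IsPos (c j)) (hr : Relation a c τ) : Relation a d τ := by
  have hd := IsPos.of_congr h hc
  rw [relation_iff_turn hc] at hr
  rw [relation_iff_turn hd]
  obtain ⟨g, hg, r, hr0, h⟩ := h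
  obtain ⟨s, hs⟩ := hr
  have ht := fun j p => turn_congr hg hr0 h a j τ p
  refine ⟨s, LinearMap.ext fun v => ?_⟩
  obtain ⟨w, rfl⟩ := g.surjective v
  simp only [Module.End.mul_apply, ht]
  have := congrArg (fun T : Module.End ℂ V => g (T w)) hs
  simpa only [Module.End.mul_apply, LinearMap.smul_apply, Module.End.one_apply, map_smul] using this

theorem vec_eq {v : V} {x y : ℂ} (h0 : v 0 = x) (h1 : v 1 = y) : v = ![x, y] := by
  ext i; fin_cases i <;> simp [h0, h1]

theorem herm_e0_right (v : V) : herm v e0 = v 0 := by simp [herm, e0]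

/-- Every hexagon has a normal form. -/
theorem exists_normal_form {a : Fin 4 → ℝ} (ha : ∀ j, a j ∈ Set.Ioo (0 : ℝ) Real.pi)
    {τ : HexType} {c : Fin 4 → V} (hc : ∀ j, IsPos (c j)) (hr : Relation a c τ) :
    ∃ δ : ℝ, (δ = 1 ∨ δ = -1) ∧ ∃ n ∈ NF a τ δ, Congr (nfC a τ δ n) c := by
  obtain ⟨d, hcd, hd0⟩ := exists_normalized (hc 0)
  have hd := IsPos.of_congr hcd hc
  have hrel := relation_of_congr hcd hc hr
  rw [relation_iff_turn hd] at hrel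
  obtain ⟨s, hs⟩ := hrel
  -- The product of the four turns has determinant 1.
  have hs2 : s ^ 2 = 1 := by
    have h1 : area (turn a d 3 τ (turn a d 2 τ (turn a d 1 τ (turn a d 0 τ ![1, 0]))))
      (turn a d 3 τ (turn a d 2 τ (turn a d 1 τ (turn a d 0 τ ![0, 1])))) = 1 := by
      simp only [area_turn hd]
      simp [area]
    simp only [← Module.End.mul_apply, ← mul_assoc] at h1
    rw [hs] at h1
    simp [area] at h1
    rw [pow_two, h1]
  obtain ⟨δ, hδ, rfl⟩ : ∃ δ : ℝ, (δ = 1 ∨ δ = -1) ∧ s = δ := by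
    have h2 : (s - 1) * (s + 1) = 0 := by linear_combination hs2
    rcases mul_eq_zero.1 h2 with h | h
    · exact ⟨1, Or.inl rfl, by push_cast; linear_combination h⟩
    · exact ⟨-1, Or.inr rfl, by push_cast; linear_combination h⟩
  have hδ2 : δ ^ 2 = 1 := by rcases hδ with rfl | rfl <;> norm_num
  have hμ := mu_mul_conj (a := a) (τ := τ) hδ2
  set μ : ℂ := δ * kt a τ 0 with hμd
  set p1 := rot (d 1) (kt a τ 1) e0 with hp1
  set p2 := rot (d 2) (kt a τ 2) p1 with hp2
  have hp3 : rot (d 3) (kt a τ 3) p2 = μ • e0 := by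
    have h := congrArg (fun T : Module.End ℂ V => T e0) hs
    simp only [Module.End.mul_apply, LinearMap.smul_apply, Module.End.one_apply, turn_eq] at h
    have h0 : rot (d 0) (kt a τ 0) e0 = conj (kt a τ 0) • e0 := by
      have := rot_self (hd 0) (kt a τ 0)
      rwa [hd0] at this ⊢
    rw [h0, map_smul, map_smul, map_smul, ← hp1, ← hp2] at h
    rw [hμd, mul_comm, mul_smul, ← h, smul_smul, kt_mul_conj, one_smul]
  have hh1 : herm p1 p1 = 1 := by rw [hp1, rot_unitary (hd 1) (kt_mul_conj a τ 1), herm_e0]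
  have hh2 : herm p2 p2 = 1 := by rw [hp2, rot_unitary (hd 2) (kt_mul_conj a τ 2), hh1]
  have hpos0 : IsPos e0 := isPos_of_herm_eq_one herm_e0
  have hpos1 := isPos_of_herm_eq_one hh1
  have hpos2 := isPos_of_herm_eq_one hh2
  let t : Fin 3 → ℝ := ![ta (d 1) e0, ta (d 2) p1, ta (d 3) p2]
  have hu0 : herm p1 e0 = ut a τ t 0 := herm_rot_self herm_e0 _
  have hu1 : herm p2 p1 = ut a τ t 1 := herm_rot_self hh1 _
  have hu2 : herm (μ • e0) p2 = ut a τ t 2 := by rw [← hp3]; exact herm_rot_self hh2 _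
  have hp10 : p1 0 = ut a τ t 0 := by rw [← herm_e0_right p1, hu0]
  have hp20 : p2 0 = μ * conj (ut a τ t 2) := by
    rw [← hu2, herm_conj, herm_smul_right, ← mul_assoc, hμ, one_mul, herm_e0_right p2]
  let n : ℂ × ℂ × (Fin 3 → ℝ) := (p1 1, p2 1, t)
  have hn1 : nf1 a τ n = p1 := (vec_eq hp10 rfl).symm
  have hn2 : nf2 a τ δ n = p2 := (vec_eq hp20 rfl).symm
  have hnsq : ∀ v : V, herm v v = 1 → Complex.normSq (v 1) = Complex.normSq (v 0) - 1 := by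
    intro v h
    rw [herm, Complex.mul_conj, Complex.mul_conj] at h
    have : Complex.normSq (v 0) - Complex.normSq (v 1) = 1 := by exact_mod_cast h
    linarith
  have hn : n ∈ NF a τ δ := by
    refine ⟨fun j => ?_, ?_, ?_, ?_⟩
    · fin_cases j
      · exact one_le_ta (hd 1) hpos0
      · exact one_le_ta (hd 2) hpos1
      · exact one_le_ta (hd 3) hpos2
    · rw [← hp10]; exact hnsq _ hh1
    · have : Complex.normSq (ut a τ t 2) = Complex.normSq (p2 0) := by
        rw [hp20, map_mul, Complex.normSq_conj]
        have : Complex.normSq μ = 1 := by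
          rw [← Complex.ofReal_inj, ← Complex.mul_conj, hμ, Complex.ofReal_one]
        rw [this, one_mul]
      change _ = Complex.normSq (ut a τ t 2) - 1
      rw [this]; exact hnsq _ hh2
    · change p2 1 * conj (p1 1) = μ * conj (ut a τ t 2) * conj (ut a τ t 0) - ut a τ t 1
      rw [← hp20, ← hp10, ← hu1, herm]; ring
  refine ⟨δ, hδ, n, hn, Congr.trans (Congr.symm ?_) (Congr.symm hcd)⟩
  -- The centres of the given hexagon and of the normal form are both proportional to the
  -- differences p' - kp of consecutive vertices.
  obtain ⟨r1, hr1, e1⟩ := center_eq (hd 1) hpos0 (kt_im_ne_zero ha τ 1)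
  obtain ⟨r2, hr2, e2⟩ := center_eq (hd 2) hpos1 (kt_im_ne_zero ha τ 2)
  obtain ⟨r3, hr3, e3⟩ := center_eq (hd 3) hpos2 (kt_im_ne_zero ha τ 3)
  refine ⟨LinearEquiv.refl ℂ V, fun _ _ => rfl, ![1, r1, r2, r3], fun j => ?_, fun j => ?_⟩
  · fin_cases j <;> simp [hr1, hr2, hr3]
  · rw [LinearEquiv.refl_apply, nfC, hn1, hn2]
    fin_cases j
    · change e0 = (1 : ℂ) • d 0
      rw [hd0, one_smul]
    · exact e1
    · exact e2
    · change μ • e0 - _ = r3 • d 3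
      rw [← e3, hp3]

/-! ### Properness over t and the quotient topology -/

theorem isClosed_NF (a : Fin 4 → ℝ) (τ : HexType) (δ : ℝ) : IsClosed (NF a τ δ) := by
  have hu : ∀ j, Continuous fun n : ℂ × ℂ × (Fin 3 → ℝ) => ut a τ n.2.2 j := fun j => by
    unfold ut umap; fun_prop
  have hns := Complex.continuous_normSq
  have h0 := hu 0
  have h1 := hu 1
  have h2 := hu 2
  have hc := Complex.continuous_conj
  simp only [NF, Set.ofPred_and]
  refine IsClosed.inter ?_ (IsClosed.inter ?_ (IsClosed.inter ?_ ?_))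
  · simp only [Set.ofPred_forall]
    exact isClosed_iInter fun j => isClosed_le continuous_const (by fun_prop)
  · exact isClosed_eq (hns.comp continuous_fst) ((hns.comp h0).sub continuous_const)
  · exact isClosed_eq (hns.comp (by fun_prop)) ((hns.comp h2).sub continuous_const)
  · refine isClosed_eq (Continuous.mul (by fun_prop) (hc.comp continuous_fst)) ?_
    exact ((continuous_const.mul (hc.comp h2)).mul (hc.comp h0)).sub h1

/-- The moduli of y and z are continuous functions of t, so bounded t means bounded normal forms. -/
theorem isCompact_NF_inter (a : Fin 4 → ℝ) (τ : HexType) (δ : ℝ) {K : Set (Fin 3 → ℝ)}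
    (hK : IsCompact K) : IsCompact (NF a τ δ ∩ {n | n.2.2 ∈ K}) := by
  have hc : ∀ j, Continuous fun t : Fin 3 → ℝ => Complex.normSq (ut a τ t j) := fun j => by
    have : Continuous fun t : Fin 3 → ℝ => ut a τ t j := by unfold ut umap; fun_prop
    exact Complex.continuous_normSq.comp this
  obtain ⟨B, hB⟩ := (hK.bddAbove_image (hc 0).continuousOn)
  obtain ⟨B', hB'⟩ := (hK.bddAbove_image (hc 2).continuousOn)
  have hcomp : IsCompact ((Metric.closedBall (0 : ℂ) (Real.sqrt B)) ×ˢ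
      ((Metric.closedBall (0 : ℂ) (Real.sqrt B')) ×ˢ K)) :=
    (isCompact_closedBall _ _).prod ((isCompact_closedBall _ _).prod hK)
  have hsub : ∀ (z : ℂ) (C D : ℝ), Complex.normSq z = D - 1 → D ≤ C →
      z ∈ Metric.closedBall (0 : ℂ) (Real.sqrt C) := by
    intro z C D h h'
    rw [mem_closedBall_zero_iff]
    apply Real.le_sqrt_of_sq_le
    rw [← Complex.normSq_eq_norm_sq]
    linarith
  have hcl : IsClosed (NF a τ δ ∩ {n | n.2.2 ∈ K}) :=
    (isClosed_NF a τ δ).inter (hK.isClosed.preimage (by fun_prop))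
  refine hcomp.of_isClosed_subset hcl ?_
  rintro n ⟨hn, hnK⟩
  exact ⟨hsub _ _ _ hn.2.1 (hB ⟨_, hnK, rfl⟩), hsub _ _ _ hn.2.2.1 (hB' ⟨_, hnK, rfl⟩), hnK⟩

section quotient
variable {a : Fin 4 → ℝ} (ha : ∀ j, a j ∈ Set.Ioo (0 : ℝ) Real.pi)

/-- The point of `S a` with the given normal form. -/
noncomputable def nfS {a : Fin 4 → ℝ} (ha : ∀ j, a j ∈ Set.Ioo (0 : ℝ) Real.pi) (τ : HexType) {δ : ℝ}
    (hδ : δ ^ 2 = 1) (n : NF a τ δ) : S a := Quotient.mk _ (nfHex ha hδ n.2)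

theorem nfS_t (τ : HexType) {δ : ℝ} (hδ : δ ^ 2 = 1) (n : NF a τ δ) :
    (nfS ha τ hδ n).t = n.1.2.2 := tVec_nfC ha hδ n.2

theorem nfS_t' (τ : HexType) {δ : ℝ} (hδ : δ ^ 2 = 1) (n : NF a τ δ) (j : Fin 3) :
    4 * (kk a j.succ).im ^ 2 * ((nfS ha τ hδ n).t j * (nfS ha τ hδ n).t' j) =
      Complex.normSq (u a (nfS ha τ hδ n).t (j + 1) -
        δ * kk a 0 * conj (kk a j.succ) * conj (u a (nfS ha τ hδ n).t (j + 2))) := by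
  rw [nfS_t]
  exact t'_nfC ha hδ n.2 j

theorem continuous_nfS (τ : HexType) {δ : ℝ} (hδ : δ ^ 2 = 1) : Continuous (nfS ha τ hδ) := by
  have hu : ∀ j, Continuous fun n : NF a τ δ => ut a τ n.1.2.2 j := fun j => by
    unfold ut umap; fun_prop
  have hc := Complex.continuous_conj
  have h1 : Continuous fun n : NF a τ δ => nf1 a τ n.1 := by
    refine continuous_pi fun i => ?_
    fin_cases i
    · exact hu 0
    · exact continuous_subtype_val.fst
  have h2 : Continuous fun n : NF a τ δ => nf2 a τ δ n.1 := by
    refine continuous_pi fun i => ?_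
    fin_cases i
    · exact continuous_const.mul (hc.comp (hu 2))
    · exact continuous_subtype_val.snd.fst
  refine continuous_quotient_mk'.comp (continuous_induced_rng.2 ?_)
  refine continuous_const.prodMk (continuous_pi fun j => ?_)
  fin_cases j
  · exact continuous_const
  · exact h1.sub continuous_const
  · exact h2.sub (h1.fun_const_smul _)
  · exact continuous_const.sub (h2.fun_const_smul _)

theorem nfS_eq_of_t_eq (τ : HexType) {δ : ℝ} (hδ : δ ^ 2 = 1) {n n' : NF a τ δ}
    (h : n.1.2.2 = n'.1.2.2) : nfS ha τ hδ n = nfS ha τ hδ n' :=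
  Quotient.sound ⟨rfl, congr_nfC_of_t_eq n.2 n'.2 h⟩

theorem exists_nfS (P : S a) : ∃ δ : ℝ, ∃ hδ : δ ^ 2 = 1, (δ = 1 ∨ δ = -1) ∧
    ∃ n : NF a P.type δ, nfS ha P.type hδ n = P := by
  induction P using Quotient.inductionOn with
  | h x =>
    obtain ⟨δ, hδ, n, hn, h⟩ := exists_normal_form ha x.pos x.rel
    have hδ2 : δ ^ 2 = 1 := by rcases hδ with rfl | rfl <;> norm_num
    exact ⟨δ, hδ2, hδ, ⟨n, hn⟩, Quotient.sound ⟨rfl, h⟩⟩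

end quotient

instance : DiscreteTopology HexType := ⟨rfl⟩

theorem continuous_hexagon (a : Fin 4 → ℝ) :
    Continuous fun x : Hexagon a => (x.type, x.c) := continuous_induced_dom

theorem continuous_S_type (a : Fin 4 → ℝ) : Continuous (S.type : S a → HexType) := by
  refine Continuous.quotient_lift ?_ _
  exact (continuous_hexagon a).fst

theorem continuous_S_t (a : Fin 4 → ℝ) : Continuous (S.t : S a → Fin 3 → ℝ) := by
  refine Continuous.quotient_lift ?_ _
  have hcj : ∀ j, Continuous fun x : Hexagon a => x.c j := fun j =>
    (continuous_apply j).comp (continuous_hexagon a).snd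
  have hτ : Continuous fun x : Hexagon a => x.type := (continuous_hexagon a).fst
  have hherm : ∀ {v w : Hexagon a → V}, Continuous v → Continuous w →
      Continuous fun x => herm (v x) (w x) := by
    intro v w hv hw
    unfold herm
    have hc := Complex.continuous_conj
    have h0 := hc.comp ((continuous_apply 0).comp hw)
    have h1 := hc.comp ((continuous_apply 1).comp hw)
    exact (((continuous_apply 0).comp hv).mul h0).sub (((continuous_apply 1).comp hv).mul h1)
  have hkt : ∀ j, Continuous fun x : Hexagon a => kt a x.type j := fun j =>
    (continuous_of_discreteTopology (f := fun τ : HexType => kt a τ j)).comp hτ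
  have hturn : ∀ (j : Fin 4) {v : Hexagon a → V}, Continuous v →
      Continuous fun x => turn a x.c j x.type (v x) := by
    intro j v hv
    simp only [turn_eq, rot_apply]
    have hk := hkt j
    have hk' := Complex.continuous_conj.comp hk
    refine Continuous.add (Continuous.fun_smul ?_ (hcj j)) (hk.fun_smul hv)
    exact (hk'.sub hk).mul ((hherm hv (hcj j)).div (hherm (hcj j) (hcj j)) fun x => (x.pos j).ne)
  have hpt : ∀ j, Continuous fun x : Hexagon a => pt a x.type x.c j := by
    intro j
    fin_cases j
    · exact hturn 1 (hcj 0)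
    · exact hturn 2 (hturn 1 (hcj 0))
    · exact hcj 0
  have hptpos : ∀ (x : Hexagon a) j, IsPos (pt a x.type x.c j) := by
    intro x j
    have h1 : ∀ (l : Fin 4) {v : V}, IsPos v → IsPos (turn a x.c l x.type v) := fun l v hv => by
      rw [turn_eq]; exact isPos_rot (x.pos l) (kt_mul_conj _ _ _) hv
    fin_cases j
    · exact h1 1 (x.pos 0)
    · exact h1 2 (h1 1 (x.pos 0))
    · exact x.pos 0
  refine continuous_pi fun j => ?_
  unfold tVec ta
  refine Complex.continuous_re.comp (Continuous.div ?_ ?_ ?_)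
  · exact (hherm (hcj _) (hpt j)).mul (hherm (hpt j) (hcj _))
  · exact (hherm (hcj _) (hcj _)).mul (hherm (hpt j) (hpt j))
  · exact fun x => mul_ne_zero (x.pos _).ne (hptpos x j).ne

/-! ### The modifications in the coordinates t_j -/

theorem rot_conj_rot {c : V} (hc : IsPos c) {k : ℂ} (hk : k * conj k = 1) (p : V) :
    rot c (conj k) (rot c k p) = p := by
  have hk' : conj k * conj (conj k) = 1 := by rw [Complex.conj_conj, mul_comm]; exact hk
  have := congrArg (fun T : Module.End ℂ V => T p) (rot_mul_conj hc hk')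
  simpa using this

theorem rot_rot_conj {c : V} (hc : IsPos c) {k : ℂ} (hk : k * conj k = 1) (p : V) :
    rot c k (rot c (conj k) p) = p := by
  have := congrArg (fun T : Module.End ℂ V => T p) (rot_mul_conj hc hk)
  simpa using this

theorem rot_rot {d : V} (hd : IsPos d) {l : ℂ} (hl : l * conj l = 1) (c : V) (k : ℂ) (p : V) :
    rot (rot d l c) k (rot d l p) = rot d l (rot c k p) := by
  let g : V ≃ₗ[ℂ] V := LinearEquiv.ofLinearMap (rot d l) (rot d (conj l))
    (LinearMap.ext fun p => rot_rot_conj hd hl p) (LinearMap.ext fun p => rot_conj_rot hd hl p)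
  have := rot_congr (g := g) (fun v w => rot_unitary hd hl v w) one_ne_zero c k p
  rw [one_smul] at this
  exact this

/-- R₀ fixes the point c₀ = p₃, so the other three turns close the path p₃, p₁, p₂ up. -/
theorem exists_turn_turn_turn {a : Fin 4 → ℝ} {τ : HexType} {c : Fin 4 → V}
    (hc : ∀ j, IsPos (c j)) (h : Relation a c τ) : ∃ r : ℂ, r ≠ 0 ∧
      rot (c 3) (kt a τ 3) (rot (c 2) (kt a τ 2) (rot (c 1) (kt a τ 1) (c 0))) = r • c 0 := by
  obtain ⟨s, hs⟩ := (relation_iff_turn hc τ).1 h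
  have h := congrArg (fun T : Module.End ℂ V => T (kt a τ 0 • c 0)) hs
  simp only [Module.End.mul_apply, LinearMap.smul_apply, Module.End.one_apply, turn_eq] at h
  rw [map_smul _ (kt a τ 0) (c 0), rot_self (hc 0), smul_smul, kt_mul_conj, one_smul,
    smul_smul] at h
  refine ⟨_, ?_, h⟩
  intro h0
  rw [h0, zero_smul] at h
  have := isPos_rot (hc 3) (kt_mul_conj a τ 3) (isPos_rot (hc 2) (kt_mul_conj a τ 2)
    (isPos_rot (hc 1) (kt_mul_conj a τ 1) (hc 0)))
  rw [h] at this
  simp [IsPos, herm] at this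

/-- The modification `n_i` replaces `t_i` by `t'_i` and keeps the other two coordinates. -/
theorem tVec_modif {a : Fin 4 → ℝ} {τ : HexType} {c : Fin 4 → V}
    (hc : ∀ j, IsPos (c j)) (h : Relation a c τ) (i : Fin 3) :
    tVec a τ.swap (modif a τ c i) = Function.update (tVec a τ c) i (tVec' a τ c i) := by
  obtain ⟨r, hr, hrel⟩ := exists_turn_turn_turn hc h
  have hk := kt_mul_conj a τ
  have hk' : ∀ j, conj (kt a τ j) * conj (conj (kt a τ j)) = 1 := fun j => by
    rw [Complex.conj_conj, mul_comm]; exact hk j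
  set p1 := rot (c 1) (kt a τ 1) (c 0) with hp1
  set p2 := rot (c 2) (kt a τ 2) p1 with hp2
  have hr' := inv_ne_zero hr
  have b1 : rot (c 1) (conj (kt a τ 1)) p1 = c 0 := rot_conj_rot (hc 1) (hk 1) _
  have b2 : rot (c 2) (conj (kt a τ 2)) p2 = p1 := rot_conj_rot (hc 2) (hk 2) _
  have e3 : r⁻¹ • rot (c 3) (kt a τ 3) p2 = c 0 := by rw [hrel, smul_smul, inv_mul_cancel₀ hr, one_smul]
  have b3 : rot (c 3) (conj (kt a τ 3)) (c 0) = r⁻¹ • p2 := by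
    rw [← e3, map_smul, rot_conj_rot (hc 3) (hk 3)]
  have t0 : tVec a τ c 0 = ta (c 1) (c 0) := by
    change ta (c 1) (turn a c 1 τ (c 0)) = _
    rw [turn_eq, ta_rot (hc 1) (hk 1)]
  have t1 : tVec a τ c 1 = ta (c 2) p1 := by
    change ta (c 2) (turn a c 2 τ (turn a c 1 τ (c 0))) = _
    rw [turn_eq, turn_eq, ta_rot (hc 2) (hk 2)]
  have t2 : tVec a τ c 2 = ta (c 3) p2 := by
    change ta (c 3) (c 0) = _
    rw [← e3, ta_smul_right hr', ta_rot (hc 3) (hk 3)]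
  have t0' : tVec' a τ c 0 = ta (c 1) p2 := by
    change ta (c 1) (turn a c 2 τ (turn a c 1 τ (c 0))) = _
    rw [turn_eq, turn_eq]
  have t1' : tVec' a τ c 1 = ta (c 2) (c 0) := rfl
  have t2' : tVec' a τ c 2 = ta (c 3) p1 := by
    change ta (c 3) (turn a c 1 τ (c 0)) = _
    rw [turn_eq]
  -- The modified hexagon has the opposite type, so its vertices are traced with the inverse turns.
  have tP : ∀ d : Fin 4 → V, tVec a τ.swap d = ![ta (d 1) (rot (d 1) (conj (kt a τ 1)) (d 0)),
      ta (d 2) (rot (d 2) (conj (kt a τ 2)) (rot (d 1) (conj (kt a τ 1)) (d 0))),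
      ta (d 3) (d 0)] := by
    intro d
    funext j
    simp only [← kt_swap, ← turn_eq]
    fin_cases j <;> rfl
  rw [tP]
  fin_cases i
  -- The new p₃ is the old p₂, and the second side is moved by the inverse turn about c₁. Tances are
  -- unchanged by that turn, which leaves only ta(c₁, p₂) = t'₁ as a new value. In the other two
  -- cases the conjugated side is moved back in the same way.
  · have hm : modif a τ c 0 = ![r⁻¹ • p2, c 1, rot (c 1) (conj (kt a τ 1)) (c 2), c 3] := by
      simp only [modif, turn_eq, kt_swap, b3]; rfl
    change ![_, _, _] = Function.update (tVec a τ c) 0 (tVec' a τ c 0)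
    simp only [Fin.zero_eta, hm]
    simp only [Matrix.cons_val]
    rw [map_smul, map_smul, ta_smul_right hr', ta_smul_right hr', ta_smul_right hr',
      ta_rot (hc 1) (hk' 1), rot_rot (hc 1) (hk' 1), ta_rot_rot (hc 1) (hk' 1), b2]
    ext j
    fin_cases j
    · simp [t0']
    · simp [t1]
    · simp [t2]
  · have hm : modif a τ c 1 = ![r⁻¹ • p2, rot (c 2) (kt a τ 2) (c 1), c 2, c 3] := by
      simp only [modif, turn_eq, kt_swap, b3]; rfl
    change ![_, _, _] = Function.update (tVec a τ c) 1 (tVec' a τ c 1)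
    simp only [Fin.mk_one, hm]
    simp only [Matrix.cons_val]
    rw [map_smul, map_smul, ta_smul_right hr', ta_smul_right hr', ta_smul_right hr',
      hp2, rot_rot (hc 2) (hk 2), ta_rot_rot (hc 2) (hk 2), ta_rot (hc 2) (hk' 2), b1,
      ta_rot (hc 2) (hk 2), ← hp2]
    ext j
    fin_cases j
    · simp [t0]
    · simp [t1']
    · simp [t2]
  · have hm : modif a τ c 2 = ![p1, c 1, rot (c 3) (kt a τ 3) (c 2), c 3] := by
      simp only [modif, turn_eq]; rfl
    change ![_, _, _] = Function.update (tVec a τ c) 2 (tVec' a τ c 2)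
    simp only [Fin.reduceFinMk, hm]
    simp only [Matrix.cons_val]
    have : rot (rot (c 3) (kt a τ 3) (c 2)) (conj (kt a τ 2)) (c 0) =
        r⁻¹ • rot (c 3) (kt a τ 3) p1 := by
      rw [← b2, ← rot_rot (hc 3) (hk 3), ← map_smul, e3]
    rw [b1, this, ta_smul_right hr', ta_rot_rot (hc 3) (hk 3)]
    ext j
    fin_cases j
    · simp [t0, hp1]
    · simp [t1]
    · simp [t2']

theorem S.t_n {a : Fin 4 → ℝ} (P : S a) (j : Fin 3) :
    (P.n j).t = Function.update P.t j (P.t' j) := by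
  induction P using Quotient.inductionOn with
  | h x => exact tVec_modif x.pos x.rel j

theorem mem_A_iff {a : Fin 4 → ℝ} (P : S a) (j : Fin 3) : P ∈ A a j ↔ P.t' j = P.t j := by
  rw [A, Set.mem_ofPred_eq, S.t_n, Function.update_eq_self_iff]

/-! ### The equation in real coordinates and the bounds on the surface -/

/-- The equation `eEq` in the coordinates `s_j = σ_j (2 t_j - 1)`. -/
noncomputable def es (δ c0 σ0 c1 s1 c2 s2 c3 s3 : ℝ) : ℝ :=
  (c1 ^ 2 + s1 ^ 2) + (c2 ^ 2 + s2 ^ 2) + (c3 ^ 2 + s3 ^ 2) - 1 -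
    2 * δ * (c0 * (c1 * c2 * c3 - c1 * s2 * s3 - c2 * s1 * s3 - c3 * s1 * s2) +
      σ0 * (s1 * s2 * s3 - s1 * c2 * c3 - s2 * c1 * c3 - s3 * c1 * c2))

/-- The equation of the character variety of the sphere with four holes. -/
noncomputable def fr (c0 c1 c2 c3 x1 x2 x3 : ℝ) : ℝ :=
  x1 ^ 2 + x2 ^ 2 + x3 ^ 2 - 2 * x1 * x2 * x3 + 2 * (c0 * c1 + c2 * c3) * x1 +
    2 * (c0 * c2 + c1 * c3) * x2 + 2 * (c0 * c3 + c1 * c2) * x3 +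
    c0 ^ 2 + c1 ^ 2 + c2 ^ 2 + c3 ^ 2 + 4 * c0 * c1 * c2 * c3 - 1

section

variable {δ c0 σ0 c1 σ1 c2 s1 s2 c3 σ3 s3 t : ℝ}

/-- The Gram equation |w|² = (|u₁|² - 1)(|u₃|² - 1), with real and imaginary parts written out. -/
theorem es_eq_sq_add_sq (hδ : δ ^ 2 = 1) (h0 : c0 ^ 2 + σ0 ^ 2 = 1) (h1 : c1 ^ 2 + σ1 ^ 2 = 1)
    (h3 : c3 ^ 2 + σ3 ^ 2 = 1) :
    es δ c0 σ0 c1 s1 c2 s2 c3 s3 =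
      ((c0 * s2 + σ0 * c2) + δ * (c3 * s1 + c1 * s3)) ^ 2 +
      (δ * (σ0 * s2 - c0 * c2) + c1 * c3 - s1 * s3) ^ 2 -
      (s1 ^ 2 - σ1 ^ 2) * (s3 ^ 2 - σ3 ^ 2) := by
  unfold es; grind

/-- An arrangement whose five terms are all nonnegative if |X| ≤ 1, Y ≥ 0 and c₁ + c₃X ≥ 0; it
serves to exclude X ≤ 1. -/
theorem es_one_eq  (h0 : c0 ^ 2 + σ0 ^ 2 = 1) (h3 : c3 ^ 2 + σ3 ^ 2 = 1) {X Y : ℝ} (hX : X = σ0 * s2 - c0 * c2)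
     (hY : Y = c0 * s2 + σ0 * c2) :
    es 1 c0 σ0 c1 s1 c2 s2 c3 s3 = (s1 - X * s3 + Y * c3) ^ 2 + (1 - X ^ 2) * (s3 ^ 2 - σ3 ^ 2) +
      Y ^ 2 * σ3 ^ 2 + 2 * s3 * Y * (c1 + c3 * X) + (c1 + c3 * X) ^ 2 := by
  unfold es; grind

theorem fr_eq_es (h0 : c0 ^ 2 + σ0 ^ 2 = 1) : fr c0 c1 c2 c3 (σ0 * s1 - c0 * c1) (σ0 * s2 - c0 * c2) (σ0 * s3 - c0 * c3)
  = σ0 ^ 2 * es 1 c0 σ0 c1 s1 c2 s2 c3 s3 := by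
  unfold es fr; grind

/-- On the surface the last square sum is 4σ₁²tt', with t' the other tance; the identity then reads
½ ∂fr/∂x₁ = σ₀σ₁(t - t'). -/
theorem vieta_es (h0 : c0 ^ 2 + σ0 ^ 2 = 1) (h1 : c1 ^ 2 + σ1 ^ 2 = 1) (hs : s1 = σ1 * (2 * t - 1)) :
  4 * σ1 * t * ((σ0 * s1 - c0 * c1) - (σ0 * s2 - c0 * c2) * (σ0 * s3 - c0 * c3) + (c0 * c1 + c2 * c3)) =
   σ0 * (es 1 c0 σ0 c1 s1 c2 s2 c3 s3 + 4 * σ1 ^ 2 * t ^ 2 -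
    ((c2-((c0*c1+σ0*σ1)*c3-(σ0*c1-c0*σ1)*s3)) ^ 2 + (-s2-((c0*c1+σ0*σ1)*s3+(σ0*c1-c0*σ1)*c3)) ^ 2)) := by
  unfold es; grind

end

/-- Dropping one square leaves (δX + c₁c₃ - s₁s₃)² ≤ (s₁² - σ₁²)(s₃² - σ₃²) ≤ (s₁s₃ - σ₁σ₃)². For δ
= 1 this bounds X from below by -cos(a₁ + a₃); for δ = -1 it bounds X from above, whence
compactness. -/
theorem le_of_es_eq_zero {δ c0 σ0 c1 σ1 c2 s1 s2 c3 σ3 s3 : ℝ} (hδ : δ ^ 2 = 1)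
    (h0 : c0 ^ 2 + σ0 ^ 2 = 1) (h1 : c1 ^ 2 + σ1 ^ 2 = 1) (h3 : c3 ^ 2 + σ3 ^ 2 = 1)
    (hσ1 : 0 < σ1) (hσ3 : 0 < σ3) (hs1 : σ1 ≤ s1) (hs3 : σ3 ≤ s3)
    (h : es δ c0 σ0 c1 s1 c2 s2 c3 s3 = 0) :
    σ1 * σ3 - c1 * c3 ≤ δ * (σ0 * s2 - c0 * c2) := by
  rw [es_eq_sq_add_sq hδ h0 h1 h3] at h
  have h13 : σ1 * σ3 ≤ s1 * s3 := mul_le_mul hs1 hs3 hσ3.le (hσ1.le.trans hs1)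
  have h4 : (s1 * s3 - (δ * (σ0 * s2 - c0 * c2) + c1 * c3)) ^ 2 ≤ (s1 * s3 - σ1 * σ3) ^ 2 := by
    have e1 := sq_nonneg ((c0 * s2 + σ0 * c2) + δ * (c3 * s1 + c1 * s3))
    have e2 := sq_nonneg (s1 * σ3 - s3 * σ1)
    linarith
  have := abs_le_of_sq_le_sq' h4 (sub_nonneg.2 h13)
  linarith [this.2]

/-- The expression is affine in X. At the endpoint X = 1 it is c₁ + c₃, and at the other it is σ₃
sin(a₁ + a₃). -/
theorem nonneg_of_mem_Icc {c1 σ1 c3 σ3 X : ℝ} (h1 : c1 ^ 2 + σ1 ^ 2 = 1)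
    (h3 : c3 ^ 2 + σ3 ^ 2 = 1) (hσ1 : 0 < σ1) (hσ3 : 0 < σ3) (h13 : 0 ≤ c1 + c3)
    (hX : σ1 * σ3 - c1 * c3 ≤ X) (hX1 : X ≤ 1) : 0 ≤ c1 + c3 * X := by
  rcases le_total 0 c3 with h | h
  · have e : 0 ≤ c1 * σ3 + c3 * σ1 := by
      rcases le_total 0 c1 with h' | h'
      · positivity
      · have : σ3 ≤ σ1 := by
          apply le_of_sq_le_sq _ hσ1.le
          nlinarith
        nlinarith
    have := mul_le_mul_of_nonneg_left hX h
    have := mul_nonneg hσ3.le e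
    nlinarith
  · nlinarith

/-- The conditions on `c_j = cos a_j`. -/
structure Balanced (c0 c1 c2 c3 : ℝ) : Prop where
  pairs : (0 ≤ c0 + c1 ∧ 0 ≤ c0 + c2 ∧ 0 ≤ c0 + c3 ∧ 0 ≤ c1 + c2 ∧ 0 ≤ c1 + c3 ∧ 0 ≤ c2 + c3) ∨
    (c0 + c1 ≤ 0 ∧ c0 + c2 ≤ 0 ∧ c0 + c3 ≤ 0 ∧ c1 + c2 ≤ 0 ∧ c1 + c3 ≤ 0 ∧ c2 + c3 ≤ 0)
  ne : ¬ (c0 = 0 ∧ c1 = 0 ∧ c2 = 0 ∧ c3 = 0)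
  lt0 : |c0| < 1
  lt1 : |c1| < 1
  lt2 : |c2| < 1
  lt3 : |c3| < 1

theorem Balanced.rotate {c0 c1 c2 c3 : ℝ} (h : Balanced c0 c1 c2 c3) : Balanced c0 c2 c3 c1 := by
  obtain ⟨h1, h2, h3, h4, h5, h6⟩ := h
  refine ⟨?_, by tauto, h3, h5, h6, h4⟩
  rcases h1 with ⟨h1, h2, h3, h4, h5, h6⟩ | ⟨h1, h2, h3, h4, h5, h6⟩
  · left; exact ⟨h2, h3, h1, h6, by linarith, by linarith⟩
  · right; exact ⟨h2, h3, h1, h6, by linarith, by linarith⟩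

theorem Balanced.swap {c0 c1 c2 c3 : ℝ} (h : Balanced c0 c1 c2 c3) : Balanced c0 c3 c2 c1 := by
  obtain ⟨h1, h2, h3, h4, h5, h6⟩ := h
  refine ⟨?_, by tauto, h3, h6, h5, h4⟩
  rcases h1 with ⟨h1, h2, h3, h4, h5, h6⟩ | ⟨h1, h2, h3, h4, h5, h6⟩
  · left; exact ⟨h3, h2, h1, by linarith, by linarith, by linarith⟩
  · right; exact ⟨h3, h2, h1, by linarith, by linarith, by linarith⟩

theorem one_lt_of_es_eq_zero_aux {c0 σ0 c1 σ1 c2 σ2 s1 s2 c3 σ3 s3 : ℝ}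
    (h0 : c0 ^ 2 + σ0 ^ 2 = 1) (h1 : c1 ^ 2 + σ1 ^ 2 = 1) (h2 : c2 ^ 2 + σ2 ^ 2 = 1)
    (h3 : c3 ^ 2 + σ3 ^ 2 = 1) (hσ0 : 0 < σ0) (hσ1 : 0 < σ1) (hσ2 : 0 < σ2) (hσ3 : 0 < σ3)
    (hs1 : σ1 ≤ s1) (hs2 : σ2 ≤ s2) (hs3 : σ3 ≤ s3)
    (h : es 1 c0 σ0 c1 s1 c2 s2 c3 s3 = 0) (h01 : 0 ≤ c0 + c1) (h02 : 0 ≤ c0 + c2)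
    (h03 : 0 ≤ c0 + c3) (h12 : 0 ≤ c1 + c2) (h13 : 0 ≤ c1 + c3) (h23 : 0 ≤ c2 + c3)
    (hne : ¬ (c0 = 0 ∧ c1 = 0 ∧ c2 = 0 ∧ c3 = 0)) : 1 < σ0 * s2 - c0 * c2 := by
  by_contra! hX1
  have hX := le_of_es_eq_zero (by norm_num) h0 h1 h3 hσ1 hσ3 hs1 hs3 h
  rw [one_mul] at hX
  have hw := nonneg_of_mem_Icc h1 h3 hσ1 hσ3 h13 hX hX1
  have hX' : σ0 * σ2 - c0 * c2 ≤ σ0 * s2 - c0 * c2 := by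
    have := mul_le_mul_of_nonneg_left hs2 hσ0.le
    linarith
  -- The same lemma for the pair (c₂, c₀) gives c₂ + c₀X ≥ 0, and this is σ₀Y.
  have hY := nonneg_of_mem_Icc h2 h0 hσ2 hσ0 (by linarith) (by linarith) hX1
  rw [es_one_eq h0 h3 rfl rfl] at h
  set X := σ0 * s2 - c0 * c2 with hXd
  set Y := c0 * s2 + σ0 * c2 with hYd
  have hXY : X ^ 2 + Y ^ 2 = s2 ^ 2 + c2 ^ 2 := by
    rw [hXd, hYd]; linear_combination (s2 ^ 2 + c2 ^ 2) * h0
  have hσY : c2 + c0 * X = σ0 * Y := by rw [hXd, hYd]; linear_combination (-c2) * h0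
  have hY0 : 0 ≤ Y := by
    rw [hσY] at hY
    exact nonneg_of_mul_nonneg_right hY hσ0
  have hXm : -1 < X := by
    have k1 : 0 < σ1 * σ3 := mul_pos hσ1 hσ3
    have k2 := sq_nonneg (c1 - c3)
    have k3 := sq_pos_of_pos hσ1
    have k4 := sq_pos_of_pos hσ3
    have k5 : (c1 - c3) ^ 2 = c1 ^ 2 + c3 ^ 2 - 2 * (c1 * c3) := by ring
    linarith
  have hXsq : 0 ≤ 1 - X ^ 2 := by
    have := mul_nonneg (sub_nonneg.2 hX1) (sub_nonneg.2 hXm.le)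
    linear_combination this
  have hs3sq : 0 ≤ s3 ^ 2 - σ3 ^ 2 := sub_nonneg.2 (pow_le_pow_left₀ hσ3.le hs3 2)
  have k1 := mul_nonneg hXsq hs3sq
  have k2 : 0 ≤ Y ^ 2 * σ3 ^ 2 := by positivity
  have k3 : 0 ≤ 2 * s3 * Y * (c1 + c3 * X) := by
    have : 0 ≤ s3 := hσ3.le.trans hs3
    positivity
  have k4 := sq_nonneg (c1 + c3 * X)
  have k5 := sq_nonneg (s1 - X * s3 + Y * c3)
  -- Nonnegative terms with sum zero all vanish. Then Y = 0 gives X² = s₂² + c₂² ≥ 1, so X = 1, and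
  -- c₁ + c₃ = c₂ + c₀ = 0. As all pair sums are nonnegative, every c_j is zero.
  have hY00 : Y = 0 := by
    have : Y ^ 2 * σ3 ^ 2 = 0 := by linarith
    have h' : (σ3 ^ 2 : ℝ) ≠ 0 := by positivity
    simpa [h', hσ3.ne'] using this
  have hw0 : c1 + c3 * X = 0 := by
    have : (c1 + c3 * X) ^ 2 = 0 := by linarith
    simpa using this
  have hX11 : X = 1 := by
    have k6 : σ2 ^ 2 ≤ s2 ^ 2 := pow_le_pow_left₀ hσ2.le hs2 2
    have k7 : 1 - X ^ 2 = (1 - X) * (1 + X) := by ring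
    have k8 : (1 - X) * (1 + X) ≤ 0 := by
      rw [hY00] at hXY
      linarith
    have k9 : 1 - X ≤ 0 := by
      by_contra! hlt
      exact absurd (mul_pos hlt (by linarith : 0 < 1 + X)) (not_lt.2 k8)
    linarith
  rw [hX11] at hw0 hσY
  rw [hY00] at hσY
  apply hne
  refine ⟨?_, ?_, ?_, ?_⟩ <;> linarith

/-- The replacement of every a_j by π - a_j exchanges the two alternative angle conditions. -/
theorem es_neg (δ c0 σ0 c1 s1 c2 s2 c3 s3 : ℝ) :
    es δ (-c0) σ0 (-c1) s1 (-c2) s2 (-c3) s3 = es δ c0 σ0 c1 s1 c2 s2 c3 s3 := by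
  unfold es; ring

theorem one_lt_of_es_eq_zero {c0 σ0 c1 σ1 c2 σ2 s1 s2 c3 σ3 s3 : ℝ}
    (h0 : c0 ^ 2 + σ0 ^ 2 = 1) (h1 : c1 ^ 2 + σ1 ^ 2 = 1) (h2 : c2 ^ 2 + σ2 ^ 2 = 1)
    (h3 : c3 ^ 2 + σ3 ^ 2 = 1) (hσ0 : 0 < σ0) (hσ1 : 0 < σ1) (hσ2 : 0 < σ2) (hσ3 : 0 < σ3)
    (hs1 : σ1 ≤ s1) (hs2 : σ2 ≤ s2) (hs3 : σ3 ≤ s3)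
    (h : es 1 c0 σ0 c1 s1 c2 s2 c3 s3 = 0) (hb : Balanced c0 c1 c2 c3) :
    1 < σ0 * s2 - c0 * c2 := by
  rcases hb.pairs with ⟨k1, k2, k3, k4, k5, k6⟩ | ⟨k1, k2, k3, k4, k5, k6⟩
  · exact one_lt_of_es_eq_zero_aux h0 h1 h2 h3 hσ0 hσ1 hσ2 hσ3 hs1 hs2 hs3 h k1 k2 k3 k4 k5 k6 hb.ne
  · rw [← es_neg] at h
    have := one_lt_of_es_eq_zero_aux (c0 := -c0) (c1 := -c1) (c2 := -c2) (c3 := -c3)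
      (by linarith [neg_sq c0]) (by linarith [neg_sq c1]) (by linarith [neg_sq c2])
      (by linarith [neg_sq c3]) hσ0 hσ1 hσ2 hσ3 hs1 hs2 hs3 h (by linarith) (by linarith)
      (by linarith) (by linarith) (by linarith) (by linarith) (by simpa using hb.ne)
    simpa using this

/-! ### Hyperbolic sections of the cubic surface -/

/-- The discriminant of `fr` with respect to two variables, up to a factor. -/
noncomputable def disc (c0 c1 c2 c3 x : ℝ) : ℝ :=
  (x ^ 2 + 2 * c0 * c2 * x + c0 ^ 2 + c2 ^ 2 - 1) * (x ^ 2 + 2 * c1 * c3 * x + c1 ^ 2 + c3 ^ 2 - 1)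

/-- Completing the square in x₁ and then in x₃: for fixed x > 1 the section is a hyperbola w² = (x²
- 1)p² + disc, with w affine in x₃. -/
theorem mul_fr (c0 c1 c2 c3 x1 x x3 : ℝ) :
    (x ^ 2 - 1) * fr c0 c1 c2 c3 x1 x x3 =
      (x ^ 2 - 1) * (x1 - x * x3 + (c0 * c1 + c2 * c3)) ^ 2 -
      ((x ^ 2 - 1) * x3 - ((c0 * c1 + c2 * c3) * x + (c0 * c3 + c1 * c2))) ^ 2 +
      disc c0 c1 c2 c3 x := by
  unfold fr disc; ring

theorem fr_swap (c0 c1 c2 c3 x1 x2 x3 : ℝ) :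
    fr c0 c3 c2 c1 x3 x2 x1 = fr c0 c1 c2 c3 x1 x2 x3 := by unfold fr; ring

/-- It equals (x - 1)(x + 1 + 2cd) + (c + d)². -/
theorem quad_pos {c d x : ℝ} (hc : |c| < 1) (hd : |d| < 1) (hx : 1 < x) :
    0 < x ^ 2 + 2 * c * d * x + c ^ 2 + d ^ 2 - 1 := by
  have h : -1 < c * d := by
    have : |c * d| < 1 := by
      rw [abs_mul]; exact mul_lt_one_of_nonneg_of_lt_one_left (abs_nonneg _) hc hd.le
    exact (abs_lt.1 this).1
  nlinarith [sq_nonneg (c + d)]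

theorem Balanced.disc_pos {c0 c1 c2 c3 x : ℝ} (h : Balanced c0 c1 c2 c3) (hx : 1 < x) :
    0 < disc c0 c1 c2 c3 x := mul_pos (quad_pos h.lt0 h.lt2 hx) (quad_pos h.lt1 h.lt3 hx)

theorem sq_lt_disc_aux {c0 c1 c2 c3 x : ℝ} (hx : 1 < x) (h01 : 0 ≤ c0 + c1) (h02 : 0 ≤ c0 + c2)
    (h03 : 0 ≤ c0 + c3) (h12 : 0 ≤ c1 + c2) (h13 : 0 ≤ c1 + c3) (h23 : 0 ≤ c2 + c3)
    (hne : ¬ (c0 = 0 ∧ c1 = 0 ∧ c2 = 0 ∧ c3 = 0)) (h0 : |c0| < 1) (h2 : |c2| < 1) :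
    0 < (c0 + c3) ^ 2 + (c1 + c2) ^ 2 + 2 * x * (c0 + c3) * (c1 + c2) - (c0 * c1 - c2 * c3) ^ 2 := by
  rw [abs_lt] at h0 h2
  have hS : 0 < c0 + c1 + c2 + c3 := by
    by_contra! hS
    apply hne
    refine ⟨?_, ?_, ?_, ?_⟩ <;> linarith
  -- It suffices to have |c₀c₁ - c₂c₃| below the sum of all c_j, since for x > 1 and (c₀ + c₃)(c₁ +
  -- c₂) ≥ 0 the remaining terms are at least the square of that sum.
  have hδ1 : c0 * c1 - c2 * c3 < c0 + c1 + c2 + c3 := by nlinarith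
  have hδ2 : -(c0 + c1 + c2 + c3) < c0 * c1 - c2 * c3 := by nlinarith
  have hsq : (c0 * c1 - c2 * c3) ^ 2 < (c0 + c1 + c2 + c3) ^ 2 := sq_lt_sq' hδ2 hδ1
  have hP := mul_nonneg (mul_nonneg (sub_nonneg.2 hx.le) h03) h12
  nlinarith

/-- The left side is w² at x₃ = 1. So the line x₃ = 1 lies strictly between the two branches of the
hyperbola, and x₃ > 1 selects the branch w > 0. -/
theorem Balanced.sq_lt_disc {c0 c1 c2 c3 x : ℝ} (h : Balanced c0 c1 c2 c3) (hx : 1 < x) :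
    (((c0 * c1 + c2 * c3) * x + (c0 * c3 + c1 * c2)) - (x ^ 2 - 1)) ^ 2 <
      disc c0 c1 c2 c3 x := by
  have key : 0 < (c0 + c3) ^ 2 + (c1 + c2) ^ 2 + 2 * x * (c0 + c3) * (c1 + c2) -
      (c0 * c1 - c2 * c3) ^ 2 := by
    rcases h.pairs with ⟨k1, k2, k3, k4, k5, k6⟩ | ⟨k1, k2, k3, k4, k5, k6⟩
    · exact sq_lt_disc_aux hx k1 k2 k3 k4 k5 k6 h.ne h.lt0 h.lt2
    · have := sq_lt_disc_aux (c0 := -c0) (c1 := -c1) (c2 := -c2) (c3 := -c3) hx (by linarith)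
        (by linarith) (by linarith) (by linarith) (by linarith) (by linarith)
        (by simpa using h.ne) (by simpa using h.lt0) (by simpa using h.lt2)
      nlinarith
  have hx2 : 0 < x ^ 2 - 1 := by nlinarith
  have := mul_pos hx2 key
  have e : disc c0 c1 c2 c3 x - (((c0 * c1 + c2 * c3) * x + (c0 * c3 + c1 * c2)) - (x ^ 2 - 1)) ^ 2
      = (x ^ 2 - 1) * ((c0 + c3) ^ 2 + (c1 + c2) ^ 2 + 2 * x * (c0 + c3) * (c1 + c2) -
      (c0 * c1 - c2 * c3) ^ 2) := by unfold disc; ring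
  linarith

/-- `½ ∂fr/∂x₁`. -/
noncomputable def dfr (c0 c1 c2 c3 x1 x2 x3 : ℝ) : ℝ := x1 - x2 * x3 + (c0 * c1 + c2 * c3)

/-- The third coordinate of a point of the surface `fr = 0`, as a function of the second one and
of `½ ∂fr/∂x₁`. -/
noncomputable def third (c0 c1 c2 c3 x p : ℝ) : ℝ :=
  ((c0 * c1 + c2 * c3) * x + (c0 * c3 + c1 * c2) +
    Real.sqrt ((x ^ 2 - 1) * p ^ 2 + disc c0 c1 c2 c3 x)) / (x ^ 2 - 1)

/-- The first coordinate of a point of the surface `fr = 0`. -/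
noncomputable def first (c0 c1 c2 c3 x p : ℝ) : ℝ :=
  x * third c0 c1 c2 c3 x p - (c0 * c1 + c2 * c3) + p

theorem dfr_first (c0 c1 c2 c3 x p : ℝ) :
    dfr c0 c1 c2 c3 (first c0 c1 c2 c3 x p) x (third c0 c1 c2 c3 x p) = p := by
  unfold dfr first; ring

section
variable {c0 c1 c2 c3 x p : ℝ}

theorem mul_third (hx : 1 < x) : (x ^ 2 - 1) * third c0 c1 c2 c3 x p =
    (c0 * c1 + c2 * c3) * x + (c0 * c3 + c1 * c2) +
    Real.sqrt ((x ^ 2 - 1) * p ^ 2 + disc c0 c1 c2 c3 x) := by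
  have hx2 : 0 < x ^ 2 - 1 := by nlinarith
  rw [third, mul_div_cancel₀ _ hx2.ne']

theorem Balanced.rad_pos (hb : Balanced c0 c1 c2 c3) (hx : 1 < x) (p : ℝ) :
    0 < (x ^ 2 - 1) * p ^ 2 + disc c0 c1 c2 c3 x := by
  have hx2 : 0 < x ^ 2 - 1 := by nlinarith
  have := hb.disc_pos hx
  positivity

theorem Balanced.fr_third (hb : Balanced c0 c1 c2 c3) (hx : 1 < x) (p : ℝ) :
    fr c0 c1 c2 c3 (first c0 c1 c2 c3 x p) x (third c0 c1 c2 c3 x p) = 0 := by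
  have hx2 : 0 < x ^ 2 - 1 := by nlinarith
  have h := mul_fr c0 c1 c2 c3 (first c0 c1 c2 c3 x p) x (third c0 c1 c2 c3 x p)
  have hp := dfr_first c0 c1 c2 c3 x p
  rw [dfr] at hp
  rw [hp, mul_third hx, add_sub_cancel_left, Real.sq_sqrt (hb.rad_pos hx p).le] at h
  have h' : (x ^ 2 - 1) * fr c0 c1 c2 c3 (first c0 c1 c2 c3 x p) x (third c0 c1 c2 c3 x p) = 0 := by
    rw [h]; ring
  exact (mul_eq_zero.1 h').resolve_left hx2.ne'

theorem Balanced.one_lt_third (hb : Balanced c0 c1 c2 c3) (hx : 1 < x) (p : ℝ) :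
    1 < third c0 c1 c2 c3 x p := by
  have hx2 : 0 < x ^ 2 - 1 := by nlinarith
  have h := mul_third (c0 := c0) (c1 := c1) (c2 := c2) (c3 := c3) (p := p) hx
  have h1 := (abs_lt_of_sq_lt_sq' ((hb.sq_lt_disc hx).trans_le
    (le_of_le_of_eq (b := (x ^ 2 - 1) * p ^ 2 + disc c0 c1 c2 c3 x)
      (le_add_of_nonneg_left (by positivity)) (Real.sq_sqrt (hb.rad_pos hx p).le).symm))
    (Real.sqrt_nonneg _)).1
  nlinarith

/-- By the symmetry of the cubic that exchanges the indices 1 and 3, the same criterion applies to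
x₁. Its affine function is xr + (x² - 1)p, where r is the square root in `third`, and this is
positive because xr dominates |(x² - 1)p|. -/
theorem Balanced.one_lt_first (hb : Balanced c0 c1 c2 c3) (hx : 1 < x) (p : ℝ) :
    1 < first c0 c1 c2 c3 x p := by
  have hx2 : 0 < x ^ 2 - 1 := by nlinarith
  set x1 := first c0 c1 c2 c3 x p with hx1
  set x3 := third c0 c1 c2 c3 x p with hx3
  set r := Real.sqrt ((x ^ 2 - 1) * p ^ 2 + disc c0 c1 c2 c3 x) with hr
  have hr0 : 0 ≤ r := Real.sqrt_nonneg _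
  have hr2 : r ^ 2 = (x ^ 2 - 1) * p ^ 2 + disc c0 c1 c2 c3 x := Real.sq_sqrt (hb.rad_pos hx p).le
  have h3 : (x ^ 2 - 1) * x3 = (c0 * c1 + c2 * c3) * x + (c0 * c3 + c1 * c2) + r := mul_third hx
  have e : (x ^ 2 - 1) * x1 - ((c0 * c3 + c2 * c1) * x + (c0 * c1 + c3 * c2)) =
      x * r + (x ^ 2 - 1) * p := by
    have : x1 = x * x3 - (c0 * c1 + c2 * c3) + p := rfl
    rw [this]
    linear_combination x * h3
  have hd := hb.disc_pos hx
  have hpos : 0 < x * r + (x ^ 2 - 1) * p := by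
    have h1 : ((x ^ 2 - 1) * p) ^ 2 < (x * r) ^ 2 := by
      rw [mul_pow, mul_pow, hr2]
      have := mul_nonneg hx2.le (sq_nonneg p)
      have h2 : 0 < x ^ 2 * disc c0 c1 c2 c3 x := by positivity
      nlinarith
    have := (abs_lt_of_sq_lt_sq' h1 (by positivity)).1
    linarith
  have hf := hb.fr_third hx p
  rw [← hx1, ← hx3, ← fr_swap] at hf
  have h := mul_fr c0 c3 c2 c1 x3 x x1
  rw [hf, mul_zero] at h
  have h2 := hb.swap.sq_lt_disc hx
  have h4 : ((c0 * c3 + c2 * c1) * x + (c0 * c1 + c3 * c2) - (x ^ 2 - 1)) ^ 2 <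
      (x * r + (x ^ 2 - 1) * p) ^ 2 := by
    rw [← e]
    have := mul_nonneg hx2.le (sq_nonneg (x3 - x * x1 + (c0 * c3 + c2 * c1)))
    linarith
  have := (abs_lt_of_sq_lt_sq' h4 hpos.le).1
  nlinarith

theorem Balanced.third_dfr (hb : Balanced c0 c1 c2 c3) {x1 x3 : ℝ} (hx : 1 < x)
    (hx3 : 1 < x3) (h : fr c0 c1 c2 c3 x1 x x3 = 0) :
    third c0 c1 c2 c3 x (dfr c0 c1 c2 c3 x1 x x3) = x3 := by
  have hx2 : 0 < x ^ 2 - 1 := by nlinarith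
  have hm := mul_fr c0 c1 c2 c3 x1 x x3
  rw [h, mul_zero] at hm
  set w := (x ^ 2 - 1) * x3 - ((c0 * c1 + c2 * c3) * x + (c0 * c3 + c1 * c2)) with hw
  have hw2 : (x ^ 2 - 1) * (dfr c0 c1 c2 c3 x1 x x3) ^ 2 + disc c0 c1 c2 c3 x = w ^ 2 := by
    unfold dfr; linarith
  have hw0 : 0 ≤ w := by
    by_contra! hneg
    have h2 := hb.sq_lt_disc hx
    have h3 : ((c0 * c1 + c2 * c3) * x + (c0 * c3 + c1 * c2) - (x ^ 2 - 1)) ^ 2 < (-w) ^ 2 := by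
      have := mul_nonneg hx2.le (sq_nonneg (dfr c0 c1 c2 c3 x1 x x3))
      rw [neg_sq, ← hw2]; linarith
    have := (abs_lt_of_sq_lt_sq' h3 (by linarith)).2
    nlinarith
  rw [third, hw2, Real.sqrt_sq hw0, hw, div_eq_iff hx2.ne']
  ring

theorem Balanced.first_dfr (hb : Balanced c0 c1 c2 c3) {x1 x3 : ℝ} (hx : 1 < x)
    (hx3 : 1 < x3) (h : fr c0 c1 c2 c3 x1 x x3 = 0) :
    first c0 c1 c2 c3 x (dfr c0 c1 c2 c3 x1 x x3) = x1 := by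
  rw [first, hb.third_dfr hx hx3 h, dfr]; ring

/-- At most one of the partial derivatives of `fr` is nonnegative at a point of the surface. -/
theorem Balanced.dfr_neg (hb : Balanced c0 c1 c2 c3) {x1 x3 : ℝ} (hx : 1 < x)
    (hx3 : 1 < x3) (h : fr c0 c1 c2 c3 x1 x x3 = 0) (h0 : 0 ≤ dfr c0 c1 c2 c3 x1 x x3) :
    dfr c0 c3 c2 c1 x3 x x1 < 0 := by
  have h1 := hb.third_dfr hx hx3 h
  have h2 := mul_third (c0 := c0) (c1 := c1) (c2 := c2) (c3 := c3)
    (p := dfr c0 c1 c2 c3 x1 x x3) hx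
  have h3 := Real.sqrt_pos.2 (hb.rad_pos hx (dfr c0 c1 c2 c3 x1 x x3))
  rw [h1] at h2
  -- ∂₃ + x∂₁ = -w for the halved derivatives, and w is the positive square root.
  have e : dfr c0 c3 c2 c1 x3 x x1 + x * dfr c0 c1 c2 c3 x1 x x3 =
    -((x ^ 2 - 1) * x3 - ((c0 * c1 + c2 * c3) * x + (c0 * c3 + c1 * c2))) := by unfold dfr; ring
  have := mul_nonneg (one_pos.trans hx).le h0
  linarith

end

/-! ### From the coordinates t_j to the cubic and back -/

theorem u_re (a : Fin 4 → ℝ) (t : Fin 3 → ℝ) (j : Fin 3) : (u a t j).re = Real.cos (a j.succ) := by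
  simp [u, kk_re]

theorem u_im (a : Fin 4 → ℝ) (t : Fin 3 → ℝ) (j : Fin 3) :
    (u a t j).im = -(Real.sin (a j.succ) * (2 * t j - 1)) := by
  simp [u, kk_im]; ring

/-- The coordinates `s_j = σ_j (2 t_j - 1)`. -/
noncomputable def sc (a : Fin 4 → ℝ) (t : Fin 3 → ℝ) (j : Fin 3) : ℝ :=
  Real.sin (a j.succ) * (2 * t j - 1)

/-- The trace coordinates on the character variety. -/
noncomputable def xc (a : Fin 4 → ℝ) (t : Fin 3 → ℝ) (j : Fin 3) : ℝ :=
  Real.sin (a 0) * sc a t j - Real.cos (a 0) * Real.cos (a j.succ)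

/-- The inverse of `xc`. -/
noncomputable def tc (a : Fin 4 → ℝ) (x : Fin 3 → ℝ) (j : Fin 3) : ℝ :=
  ((x j + Real.cos (a 0) * Real.cos (a j.succ)) / (Real.sin (a 0) * Real.sin (a j.succ)) + 1) / 2

theorem eEq_eq_es (a : Fin 4 → ℝ) (δ : ℝ) (t : Fin 3 → ℝ) :
    eEq a δ t = es δ (Real.cos (a 0)) (Real.sin (a 0)) (Real.cos (a 1)) (sc a t 0)
      (Real.cos (a 2)) (sc a t 1) (Real.cos (a 3)) (sc a t 2) := by
  simp only [eEq, es, Complex.normSq_apply, Complex.mul_re, Complex.mul_im, Complex.conj_re,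
    Complex.conj_im, kk_re, kk_im, u_re, u_im, sc, Fin.succ_zero_eq_one, Fin.succ_one_eq_two,
    show (2 : Fin 3).succ = 3 from rfl]
  ring

theorem es_rotate (δ c0 σ0 c1 s1 c2 s2 c3 s3 : ℝ) :
    es δ c0 σ0 c2 s2 c3 s3 c1 s1 = es δ c0 σ0 c1 s1 c2 s2 c3 s3 := by unfold es; ring

theorem eEq_eq_es' (a : Fin 4 → ℝ) (δ : ℝ) (t : Fin 3 → ℝ) (j : Fin 3) :
    eEq a δ t = es δ (Real.cos (a 0)) (Real.sin (a 0)) (Real.cos (a j.succ)) (sc a t j)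
      (Real.cos (a (j + 1).succ)) (sc a t (j + 1)) (Real.cos (a (j + 2).succ))
      (sc a t (j + 2)) := by
  rw [eEq_eq_es]
  fin_cases j
  · rfl
  · rw [← es_rotate]; rfl
  · rw [← es_rotate, ← es_rotate]; rfl

theorem cos_sq_add (a : Fin 4 → ℝ) (j : Fin 4) :
    Real.cos (a j) ^ 2 + Real.sin (a j) ^ 2 = 1 := by rw [add_comm]; exact Real.sin_sq_add_cos_sq _

theorem fr_xc (a : Fin 4 → ℝ) (t : Fin 3 → ℝ) (j : Fin 3) :
    fr (Real.cos (a 0)) (Real.cos (a j.succ)) (Real.cos (a (j + 1).succ))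
      (Real.cos (a (j + 2).succ)) (xc a t j) (xc a t (j + 1)) (xc a t (j + 2)) =
      Real.sin (a 0) ^ 2 * e₁ a t := by
  rw [← eEq_one, eEq_eq_es' a 1 t j, ← fr_eq_es (cos_sq_add a 0)]
  rfl

section
variable {a : Fin 4 → ℝ}

theorem sin_a_pos (ha : ∀ j, a j ∈ Set.Ioo (0 : ℝ) Real.pi) (j : Fin 4) : 0 < Real.sin (a j) :=
  Real.sin_pos_of_mem_Ioo (ha j)

theorem le_sc (ha : ∀ j, a j ∈ Set.Ioo (0 : ℝ) Real.pi) {t : Fin 3 → ℝ} {j : Fin 3}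
    (ht : 1 ≤ t j) : Real.sin (a j.succ) ≤ sc a t j :=
  le_mul_of_one_le_right (sin_a_pos ha _).le (by linarith)

theorem balanced (ha : ∀ j, a j ∈ Set.Ioo (0 : ℝ) Real.pi)
    (h : (∀ j k, j ≠ k → a j + a k ≤ Real.pi) ∨ (∀ j k, j ≠ k → Real.pi ≤ a j + a k))
    (hne : ¬ ∀ j, a j = Real.pi / 2) (j : Fin 3) :
    Balanced (Real.cos (a 0)) (Real.cos (a j.succ)) (Real.cos (a (j + 1).succ))
      (Real.cos (a (j + 2).succ)) := by
  have hlt : ∀ j, |Real.cos (a j)| < 1 := fun j => by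
    rw [← sq_lt_one_iff_abs_lt_one]
    have := cos_sq_add a j
    have := sq_pos_of_pos (sin_a_pos ha j)
    linarith
  have hb : Balanced (Real.cos (a 0)) (Real.cos (a 1)) (Real.cos (a 2)) (Real.cos (a 3)) := by
    refine ⟨?_, ?_, hlt 0, hlt 1, hlt 2, hlt 3⟩
    · rcases h with h | h
      · left
        have key : ∀ j k, j ≠ k → 0 ≤ Real.cos (a j) + Real.cos (a k) := fun j k hjk => by
          have := Real.cos_le_cos_of_nonneg_of_le_pi (ha j).1.le
            (by linarith [(ha k).1] : Real.pi - a k ≤ Real.pi) (by linarith [h j k hjk])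
          rw [Real.cos_pi_sub] at this
          linarith
        refine ⟨key _ _ ?_, key _ _ ?_, key _ _ ?_, key _ _ ?_, key _ _ ?_, key _ _ ?_⟩ <;> decide
      · right
        have key : ∀ j k, j ≠ k → Real.cos (a j) + Real.cos (a k) ≤ 0 := fun j k hjk => by
          have := Real.cos_le_cos_of_nonneg_of_le_pi
            (by linarith [(ha k).2] : 0 ≤ Real.pi - a k) (ha j).2.le (by linarith [h j k hjk])
          rw [Real.cos_pi_sub] at this
          linarith
        refine ⟨key _ _ ?_, key _ _ ?_, key _ _ ?_, key _ _ ?_, key _ _ ?_, key _ _ ?_⟩ <;> decide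
    · rintro ⟨h0, h1, h2, h3⟩
      apply hne
      have key : ∀ j, Real.cos (a j) = 0 → a j = Real.pi / 2 := fun j hj => by
        refine Real.injOn_cos ⟨(ha j).1.le, (ha j).2.le⟩ ?_ (by rw [hj, Real.cos_pi_div_two])
        constructor <;> linarith [Real.pi_pos]
      intro j
      fin_cases j
      exacts [key _ h0, key _ h1, key _ h2, key _ h3]
  fin_cases j
  · exact hb
  · exact hb.rotate
  · exact hb.rotate.rotate

/-- The image of `C₁` in `ℝ³`. -/
def surf (a : Fin 4 → ℝ) : Set (Fin 3 → ℝ) := {x | (∀ j, 1 ≤ x j) ∧ e₁ a x = 0}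

theorem one_lt_xc (ha : ∀ j, a j ∈ Set.Ioo (0 : ℝ) Real.pi)
    (hb : ∀ j : Fin 3, Balanced (Real.cos (a 0)) (Real.cos (a j.succ)) (Real.cos (a (j + 1).succ))
      (Real.cos (a (j + 2).succ))) {t : Fin 3 → ℝ} (ht : t ∈ surf a) (j : Fin 3) :
    1 < xc a t j := by
  have h := ht.2
  -- The bound concerns the middle one of the three coordinates; starting the cyclic order at j + 2
  -- puts j there.
  rw [← eEq_one, eEq_eq_es' a 1 t (j + 2)] at h
  have := one_lt_of_es_eq_zero (cos_sq_add a 0) (cos_sq_add a _) (cos_sq_add a _) (cos_sq_add a _)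
    (sin_a_pos ha 0) (sin_a_pos ha _) (sin_a_pos ha _) (sin_a_pos ha _) (le_sc ha (ht.1 _))
    (le_sc ha (ht.1 _)) (le_sc ha (ht.1 _)) h (hb (j + 2))
  have hj : j + 2 + 1 = j := by rw [add_assoc]; simp
  rw [hj] at this
  exact this

/-- For t_j ≤ 1 the coordinate is at most -cos(a₀ + a_j), hence at most 1. So on the surface the
constraints t_j ≥ 1 are never active. -/
theorem one_lt_of_one_lt_xc (ha : ∀ j, a j ∈ Set.Ioo (0 : ℝ) Real.pi) {t : Fin 3 → ℝ} {j : Fin 3}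
    (h : 1 < xc a t j) : 1 < t j := by
  have h0 := mul_pos (sin_a_pos ha 0) (sin_a_pos ha j.succ)
  have h1 := Real.neg_one_le_cos (a 0 + a j.succ)
  rw [Real.cos_add] at h1
  unfold xc sc at h
  by_contra! hle
  nlinarith

theorem xc_tc (ha : ∀ j, a j ∈ Set.Ioo (0 : ℝ) Real.pi) (x : Fin 3 → ℝ) (j : Fin 3) :
    xc a (tc a x) j = x j := by
  have h0 := (sin_a_pos ha 0).ne'
  have h1 := (sin_a_pos ha j.succ).ne'
  unfold xc sc tc
  field_simp
  ring

theorem tc_xc (ha : ∀ j, a j ∈ Set.Ioo (0 : ℝ) Real.pi) (t : Fin 3 → ℝ) : tc a (xc a t) = t := by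
  funext j
  have h0 := (sin_a_pos ha 0).ne'
  have h1 := (sin_a_pos ha j.succ).ne'
  unfold xc sc tc
  field_simp
  ring

theorem mem_surf_iff (ha : ∀ j, a j ∈ Set.Ioo (0 : ℝ) Real.pi)
    (hb : ∀ j : Fin 3, Balanced (Real.cos (a 0)) (Real.cos (a j.succ)) (Real.cos (a (j + 1).succ))
      (Real.cos (a (j + 2).succ))) {t : Fin 3 → ℝ} (j : Fin 3) :
    t ∈ surf a ↔ (∀ i, 1 < xc a t i) ∧
      fr (Real.cos (a 0)) (Real.cos (a j.succ)) (Real.cos (a (j + 1).succ))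
      (Real.cos (a (j + 2).succ)) (xc a t j) (xc a t (j + 1)) (xc a t (j + 2)) = 0 := by
  have hs : Real.sin (a 0) ^ 2 ≠ 0 := pow_ne_zero _ (sin_a_pos ha 0).ne'
  rw [fr_xc, mul_eq_zero, or_iff_right hs]
  exact ⟨fun h => ⟨one_lt_xc ha hb h, h.2⟩, fun h => ⟨fun i => (one_lt_of_one_lt_xc ha (h.1 i)).le,
    h.2⟩⟩

/-- A multiple of the partial derivative of `e₁` with respect to `t_j`. -/
noncomputable def dx (a : Fin 4 → ℝ) (j : Fin 3) (t : Fin 3 → ℝ) : ℝ :=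
  dfr (Real.cos (a 0)) (Real.cos (a j.succ)) (Real.cos (a (j + 1).succ))
      (Real.cos (a (j + 2).succ)) (xc a t j) (xc a t (j + 1)) (xc a t (j + 2))

theorem dx_eq (ha : ∀ j, a j ∈ Set.Ioo (0 : ℝ) Real.pi) {t : Fin 3 → ℝ} (he : e₁ a t = 0)
    {j : Fin 3} (htj : 0 < t j) {t' : ℝ} (ht' : 4 * (kk a j.succ).im ^ 2 * (t j * t') =
      Complex.normSq (u a t (j + 1) - kk a 0 * conj (kk a j.succ) * conj (u a t (j + 2)))) :
    dx a j t = Real.sin (a 0) * Real.sin (a j.succ) * (t j - t') := by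
  have hv := vieta_es (c2 := Real.cos (a (j + 1).succ)) (c3 := Real.cos (a (j + 2).succ))
    (s2 := sc a t (j + 1)) (s3 := sc a t (j + 2))
    (cos_sq_add a 0) (cos_sq_add a j.succ) (show sc a t j = _ from rfl)
  rw [← eEq_eq_es' a 1 t j, eEq_one, he] at hv
  simp only [Complex.normSq_apply, Complex.sub_re, Complex.sub_im, Complex.mul_re, Complex.mul_im,
    Complex.conj_re, Complex.conj_im, kk_re, kk_im, u_re, u_im] at ht'
  have h1 : 4 * Real.sin (a j.succ) * t j ≠ 0 := by
    have := sin_a_pos ha j.succ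
    positivity
  apply mul_left_cancel₀ h1
  refine hv.trans ?_
  unfold sc
  linear_combination (Real.sin (a 0)) * ht'

/-- At a point of the surface at most one of the partial derivatives is nonnegative. -/
theorem dx_neg (ha : ∀ j, a j ∈ Set.Ioo (0 : ℝ) Real.pi)
    (hb : ∀ j : Fin 3, Balanced (Real.cos (a 0)) (Real.cos (a j.succ)) (Real.cos (a (j + 1).succ))
      (Real.cos (a (j + 2).succ))) {t : Fin 3 → ℝ} (ht : t ∈ surf a) {j k : Fin 3} (hjk : j ≠ k)
    (h : 0 ≤ dx a j t) : dx a k t < 0 := by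
  -- Two distinct indices modulo 3 differ by 2 in one order or the other, so this case suffices; the
  -- other order follows by contraposition.
  have h2 : ∀ j, 0 ≤ dx a j t → dx a (j + 2) t < 0 := by
    intro j h
    have hm := (mem_surf_iff ha hb j).1 ht
    have := (hb j).dfr_neg (hm.1 _) (hm.1 _) hm.2 h
    have e1 : j + 2 + 1 = j := by rw [add_assoc]; simp
    have e2 : j + 2 + 2 = j + 1 := by rw [add_assoc]; rfl
    unfold dx
    rw [e1, e2]
    unfold dfr at this ⊢
    linarith
  by_cases hk : k = j + 2
  · rw [hk]; exact h2 j h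
  · have hkj : k + 2 = j := by clear h h2; revert j k; decide
    by_contra! hk0
    have := h2 k hk0
    rw [hkj] at this
    linarith

end

/-! ### The global smooth parametrizations -/

/-- The conditions under which the surface is smooth, for all cyclic relabelings. -/
def BalancedAll (a : Fin 4 → ℝ) : Prop :=
  ∀ j : Fin 3, Balanced (Real.cos (a 0)) (Real.cos (a j.succ)) (Real.cos (a (j + 1).succ))
    (Real.cos (a (j + 2).succ))

/-- The trace coordinates of the parametrization `par`. -/
noncomputable def parX (a : Fin 4 → ℝ) (j : Fin 3) (q : ℝ × ℝ) (i : Fin 3) : ℝ :=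
  if i = j then first (Real.cos (a 0)) (Real.cos (a j.succ)) (Real.cos (a (j + 1).succ))
    (Real.cos (a (j + 2).succ)) (1 + Real.exp q.2) q.1
  else if i = j + 1 then 1 + Real.exp q.2
  else third (Real.cos (a 0)) (Real.cos (a j.succ)) (Real.cos (a (j + 1).succ))
    (Real.cos (a (j + 2).succ)) (1 + Real.exp q.2) q.1

/-- A parametrization of the surface such that the first coordinate is the partial derivative
`dx a j`. -/
noncomputable def par (a : Fin 4 → ℝ) (j : Fin 3) (q : ℝ × ℝ) : Fin 3 → ℝ := tc a (parX a j q)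

theorem fin_three_cases (i j : Fin 3) : i = j ∨ i = j + 1 ∨ i = j + 2 := by
  revert i j; decide

theorem parX_self (a : Fin 4 → ℝ) (j : Fin 3) (q : ℝ × ℝ) : parX a j q j =
    first (Real.cos (a 0)) (Real.cos (a j.succ)) (Real.cos (a (j + 1).succ))
    (Real.cos (a (j + 2).succ)) (1 + Real.exp q.2) q.1 := if_pos rfl

theorem parX_add_one (a : Fin 4 → ℝ) (j : Fin 3) (q : ℝ × ℝ) :
    parX a j q (j + 1) = 1 + Real.exp q.2 := by
  rw [parX, if_neg (by revert j; decide), if_pos rfl]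

theorem parX_add_two (a : Fin 4 → ℝ) (j : Fin 3) (q : ℝ × ℝ) : parX a j q (j + 2) =
    third (Real.cos (a 0)) (Real.cos (a j.succ)) (Real.cos (a (j + 1).succ))
    (Real.cos (a (j + 2).succ)) (1 + Real.exp q.2) q.1 := by
  rw [parX, if_neg (by revert j; decide), if_neg (by revert j; decide)]

theorem one_lt_one_add_exp (y : ℝ) : 1 < 1 + Real.exp y := by linarith [Real.exp_pos y]

section
variable {a : Fin 4 → ℝ}

theorem par_mem (ha : ∀ j, a j ∈ Set.Ioo (0 : ℝ) Real.pi) (hb : BalancedAll a) (j : Fin 3)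
    (q : ℝ × ℝ) : par a j q ∈ surf a := by
  have hx := one_lt_one_add_exp q.2
  rw [mem_surf_iff ha hb j]
  simp only [par, xc_tc ha]
  constructor
  · intro i
    rcases fin_three_cases i j with rfl | rfl | rfl
    · rw [parX_self]; exact (hb _).one_lt_first hx _
    · rw [parX_add_one]; exact hx
    · rw [parX_add_two]; exact (hb _).one_lt_third hx _
  · rw [parX_self, parX_add_one, parX_add_two]
    exact (hb j).fr_third hx _

theorem dx_par (ha : ∀ j, a j ∈ Set.Ioo (0 : ℝ) Real.pi) (j : Fin 3)
    (q : ℝ × ℝ) : dx a j (par a j q) = q.1 := by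
  simp only [dx, par, xc_tc ha]
  rw [parX_self, parX_add_one, parX_add_two, dfr_first]

theorem par_dx (ha : ∀ j, a j ∈ Set.Ioo (0 : ℝ) Real.pi) (hb : BalancedAll a) (j : Fin 3)
    {t : Fin 3 → ℝ} (ht : t ∈ surf a) : par a j (dx a j t, Real.log (xc a t (j + 1) - 1)) = t := by
  obtain ⟨h1, h2⟩ := (mem_surf_iff ha hb j).1 ht
  conv_rhs => rw [← tc_xc ha t]
  rw [par]
  congr 1
  funext i
  have he : 1 + Real.exp (Real.log (xc a t (j + 1) - 1)) = xc a t (j + 1) := by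
    rw [Real.exp_log (by linarith [h1 (j + 1)])]; ring
  rcases fin_three_cases i j with rfl | rfl | rfl
  · rw [parX_self]
    simp only [he]
    exact (hb _).first_dfr (h1 _) (h1 _) h2
  · rw [parX_add_one]; exact he
  · rw [parX_add_two]
    simp only [he]
    exact (hb _).third_dfr (h1 _) (h1 _) h2

theorem par_image (ha : ∀ j, a j ∈ Set.Ioo (0 : ℝ) Real.pi) (hb : BalancedAll a) (j : Fin 3)
    (s : Set ℝ) : par a j '' {q | q.1 ∈ s} = {t | t ∈ surf a ∧ dx a j t ∈ s} := by
  ext t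
  constructor
  · rintro ⟨q, hq, rfl⟩
    exact ⟨par_mem ha hb j q, by rw [dx_par ha]; exact hq⟩
  · rintro ⟨ht, hs⟩
    exact ⟨_, hs, par_dx ha hb j ht⟩

theorem range_par (ha : ∀ j, a j ∈ Set.Ioo (0 : ℝ) Real.pi) (hb : BalancedAll a) (j : Fin 3) :
    Set.range (par a j) = surf a := by
  have := par_image ha hb j Set.univ
  simpa using this

theorem contDiff_par (hb : BalancedAll a) (j : Fin 3) : ContDiff ℝ ∞ (par a j) := by
  have hx : ContDiff ℝ ∞ fun q : ℝ × ℝ => 1 + Real.exp q.2 :=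
    contDiff_const.add (Real.contDiff_exp.comp contDiff_snd)
  have hx2 : ∀ q : ℝ × ℝ, (1 + Real.exp q.2) ^ 2 - 1 ≠ 0 := fun q => by
    have := one_lt_one_add_exp q.2
    nlinarith
  have h3 : ContDiff ℝ ∞ fun q : ℝ × ℝ => third (Real.cos (a 0)) (Real.cos (a j.succ))
      (Real.cos (a (j + 1).succ)) (Real.cos (a (j + 2).succ)) (1 + Real.exp q.2) q.1 := by
    unfold third
    refine ContDiff.div (ContDiff.add ?_ (ContDiff.sqrt ?_ fun q =>
      ((hb j).rad_pos (one_lt_one_add_exp q.2) q.1).ne')) ((hx.pow 2).sub contDiff_const) hx2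
    · fun_prop
    · unfold disc; fun_prop
  refine contDiff_pi.2 fun i => ?_
  have hX : ContDiff ℝ ∞ fun q => parX a j q i := by
    rcases fin_three_cases i j with rfl | rfl | rfl
    · simp only [parX_self, first]
      exact ((hx.mul h3).sub contDiff_const).add contDiff_fst
    · simp only [parX_add_one]
      exact hx
    · simp only [parX_add_two]
      exact h3
  exact ((((hX.add contDiff_const).div_const _).add contDiff_const).div_const _)

theorem contDiff_xc (j : Fin 3) : ContDiff ℝ ∞ fun t => xc a t j := by
  unfold xc sc
  fun_prop

theorem contDiff_dx (j : Fin 3) : ContDiff ℝ ∞ (dx a j) := by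
  have := contDiff_xc (a := a)
  unfold dx dfr
  exact (((this _).sub ((this _).mul (this _))).add contDiff_const)

/-- A smooth map is an embedding as soon as some smooth map recovers its parameters up to an
embedding. Here the recovering map is t ↦ (p, x_{j+1}), defined on all of ℝ³. -/
theorem IsSmoothEmb.of_comp {E F G : Type*} [NormedAddCommGroup E] [NormedSpace ℝ E]
    [NormedAddCommGroup F] [NormedSpace ℝ F] [NormedAddCommGroup G] [NormedSpace ℝ G]
    {g : F → G} {f : E → F} (hg : ContDiff ℝ ∞ g) (hf : ContDiff ℝ ∞ f)
    (h : IsSmoothEmb (g ∘ f)) : IsSmoothEmb f := by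
  refine ⟨hf, IsEmbedding.of_comp hf.continuous hg.continuous h.2.1, fun x => ?_⟩
  have h1 := h.2.2 x
  rw [fderiv_comp x (hg.differentiable (by simp) _) (hf.differentiable (by simp) _)] at h1
  exact Function.Injective.of_comp (f := fderiv ℝ g (f x)) h1

theorem isEmbedding_one_add_exp : IsEmbedding fun y : ℝ => 1 + Real.exp y :=
  (Homeomorph.addLeft (1 : ℝ)).isEmbedding.comp
    (IsEmbedding.subtypeVal.comp Real.expOrderIso.toHomeomorph.isEmbedding)

theorem isSmoothEmb_one_add_exp : IsSmoothEmb fun y : ℝ => 1 + Real.exp y := by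
  refine ⟨contDiff_const.add Real.contDiff_exp, isEmbedding_one_add_exp, fun y => ?_⟩
  have h : HasFDerivAt (fun y : ℝ => 1 + Real.exp y) _ y :=
    ((Real.hasDerivAt_exp y).const_add 1).hasFDerivAt
  rw [h.fderiv]
  intro v w hvw
  simpa [(Real.exp_pos y).ne'] using hvw

theorem isSmoothEmb_prod : IsSmoothEmb fun q : ℝ × ℝ => (q.1, 1 + Real.exp q.2) := by
  refine ⟨contDiff_fst.prodMk (contDiff_const.add (Real.contDiff_exp.comp contDiff_snd)),
    IsEmbedding.id.prodMap isEmbedding_one_add_exp, fun q => ?_⟩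
  have h : HasFDerivAt (fun q : ℝ × ℝ => (q.1, 1 + Real.exp q.2)) _ q :=
    (hasFDerivAt_fst (𝕜 := ℝ)).prodMk (((Real.hasDerivAt_exp q.2).comp_hasFDerivAt q
      (hasFDerivAt_snd (𝕜 := ℝ))).const_add 1)
  rw [h.fderiv]
  intro v w hvw
  have h1 := congrArg Prod.fst hvw
  have h2 := congrArg Prod.snd hvw
  simp [(Real.exp_pos q.2).ne'] at h1 h2
  exact Prod.ext h1 h2

theorem isSmoothEmb_par (ha : ∀ j, a j ∈ Set.Ioo (0 : ℝ) Real.pi) (hb : BalancedAll a)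
    (j : Fin 3) : IsSmoothEmb (par a j) := by
  refine IsSmoothEmb.of_comp (g := fun t => (dx a j t, xc a t (j + 1)))
    ((contDiff_dx j).prodMk (contDiff_xc _)) (contDiff_par hb j) ?_
  convert isSmoothEmb_prod using 1
  funext q
  simp only [Function.comp, dx_par ha]
  simp only [par, xc_tc ha, parX_add_one]

theorem isSmoothEmb_par_zero (ha : ∀ j, a j ∈ Set.Ioo (0 : ℝ) Real.pi) (hb : BalancedAll a)
    (j : Fin 3) : IsSmoothEmb fun y : ℝ => par a j (0, y) := by
  refine IsSmoothEmb.of_comp (g := fun t => xc a t (j + 1))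
    (contDiff_xc _) ((contDiff_par hb j).comp (contDiff_const.prodMk contDiff_id)) ?_
  convert isSmoothEmb_one_add_exp using 1
  funext y
  simp only [Function.comp, par, xc_tc ha, parX_add_one]

theorem isSmoothLine_dx (ha : ∀ j, a j ∈ Set.Ioo (0 : ℝ) Real.pi) (hb : BalancedAll a)
    (j : Fin 3) : IsSmoothLine {t | t ∈ surf a ∧ dx a j t = 0} := by
  refine ⟨_, isSmoothEmb_par_zero ha hb j, ?_⟩
  have h := par_image ha hb j {0}
  simp only [Set.mem_singleton_iff] at h
  rw [← h]
  ext t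
  constructor
  · rintro ⟨y, rfl⟩
    exact ⟨(0, y), rfl, rfl⟩
  · rintro ⟨⟨p, y⟩, hp, rfl⟩
    obtain rfl : p = 0 := hp
    exact ⟨y, rfl⟩

theorem dividesSmoothPlane_dx (ha : ∀ j, a j ∈ Set.Ioo (0 : ℝ) Real.pi) (hb : BalancedAll a)
    (j : Fin 3) : DividesSmoothPlane (surf a) {t | t ∈ surf a ∧ dx a j t = 0}
      {t | t ∈ surf a ∧ dx a j t ≤ 0} {t | t ∈ surf a ∧ 0 ≤ dx a j t} :=
  ⟨par a j, isSmoothEmb_par ha hb j, range_par ha hb j, par_image ha hb j {0},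
    par_image ha hb j (Set.Iic 0), par_image ha hb j (Set.Ici 0)⟩

/-! ### The differential of e₁ -/

theorem contDiff_e₁ (a : Fin 4 → ℝ) : ContDiff ℝ ∞ (e₁ a) := by
  have h : e₁ a = fun t => es 1 (Real.cos (a 0)) (Real.sin (a 0)) (Real.cos (a 1)) (sc a t 0)
      (Real.cos (a 2)) (sc a t 1) (Real.cos (a 3)) (sc a t 2) := by
    rw [← eEq_one]; funext t; exact eEq_eq_es a 1 t
  rw [h]
  unfold es sc
  fun_prop

/-- The cubic is a monic quadratic polynomial in each single variable, so its Taylor expansion along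
a coordinate axis stops at the second order. -/
theorem e₁_add_single (t : Fin 3 → ℝ) (j : Fin 3) (r : ℝ) :
    Real.sin (a 0) ^ 2 * e₁ a (t + r • Pi.single j 1) = Real.sin (a 0) ^ 2 * e₁ a t +
      4 * Real.sin (a 0) * Real.sin (a j.succ) * dx a j t * r +
      (2 * Real.sin (a 0) * Real.sin (a j.succ)) ^ 2 * r ^ 2 := by
  rw [← fr_xc a _ j, ← fr_xc a _ j]
  have h1 : j + 1 ≠ j := by revert j; decide
  have h2 : j + 2 ≠ j := by revert j; decide
  have e0 : xc a (t + r • Pi.single j 1) j =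
      xc a t j + 2 * Real.sin (a 0) * Real.sin (a j.succ) * r := by
    simp [xc, sc]; ring
  have e1 : xc a (t + r • Pi.single j 1) (j + 1) = xc a t (j + 1) := by
    simp [xc, sc, h1]
  have e2 : xc a (t + r • Pi.single j 1) (j + 2) = xc a t (j + 2) := by
    simp [xc, sc, h2]
  rw [e0, e1, e2, dx, dfr, fr, fr]
  ring

theorem dx_eq_zero_of_fderiv (ha : ∀ j, a j ∈ Set.Ioo (0 : ℝ) Real.pi) {t : Fin 3 → ℝ}
    (h : fderiv ℝ (e₁ a) t = 0) (j : Fin 3) : dx a j t = 0 := by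
  have hf : HasFDerivAt (e₁ a) (0 : (Fin 3 → ℝ) →L[ℝ] ℝ) (t + (0 : ℝ) • Pi.single j (1 : ℝ)) := by
    rw [zero_smul, add_zero, ← h]
    exact ((contDiff_e₁ a).differentiable (by simp) t).hasFDerivAt
  have hl : HasDerivAt (fun r : ℝ => t + r • (Pi.single j (1 : ℝ) : Fin 3 → ℝ))
      ((1 : ℝ) • Pi.single j (1 : ℝ)) 0 :=
    ((hasDerivAt_id (0 : ℝ)).smul_const _).const_add t
  have h1 : HasDerivAt (fun r : ℝ => Real.sin (a 0) ^ 2 * e₁ a (t + r • Pi.single j 1)) _ 0 :=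
    (hf.comp_hasDerivAt (0 : ℝ) hl).const_mul (Real.sin (a 0) ^ 2)
  simp only [e₁_add_single] at h1
  have h2 : HasDerivAt (fun r : ℝ => Real.sin (a 0) ^ 2 * e₁ a t +
      4 * Real.sin (a 0) * Real.sin (a j.succ) * dx a j t * r +
      (2 * Real.sin (a 0) * Real.sin (a j.succ)) ^ 2 * r ^ 2) _ 0 :=
    (((hasDerivAt_id (0 : ℝ)).const_mul (4 * Real.sin (a 0) * Real.sin (a j.succ) * dx a j t)).const_add
      (Real.sin (a 0) ^ 2 * e₁ a t)).add
      (((hasDerivAt_id (0 : ℝ)).pow 2).const_mul ((2 * Real.sin (a 0) * Real.sin (a j.succ)) ^ 2))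
  have h3 := h1.unique h2
  simpa [(sin_a_pos ha 0).ne', (sin_a_pos ha j.succ).ne'] using h3.symm

theorem fderiv_e₁_ne_zero (ha : ∀ j, a j ∈ Set.Ioo (0 : ℝ) Real.pi) (hb : BalancedAll a)
    {t : Fin 3 → ℝ} (ht : t ∈ surf a) : fderiv ℝ (e₁ a) t ≠ 0 := by
  intro h
  have h0 := dx_eq_zero_of_fderiv ha h 0
  have h1 := dx_eq_zero_of_fderiv ha h 1
  have := dx_neg ha hb ht (j := 0) (k := 1) (by decide) h0.ge
  linarith

theorem isSmoothSurface_surf (ha : ∀ j, a j ∈ Set.Ioo (0 : ℝ) Real.pi) (hb : BalancedAll a) :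
    IsSmoothSurface (surf a) := by
  intro t ht
  refine ⟨{x | ∀ j, 1 < x j}, ?_, ?_, e₁ a, (contDiff_e₁ a).contDiffOn,
    fderiv_e₁_ne_zero ha hb ht, ?_⟩
  · simp only [Set.ofPred_forall]
    exact isOpen_iInter_of_finite fun j => isOpen_lt continuous_const (continuous_apply j)
  · exact fun j => one_lt_of_one_lt_xc ha (one_lt_xc ha hb ht j)
  · ext x
    exact ⟨fun h => ⟨h.2, h.1.2⟩, fun h => ⟨⟨fun j => (h.1 j).le, h.2⟩, h.1⟩⟩

end

/-! ### The cone in the case of four right angles a_j = π/2 -/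

section singular
variable {a : Fin 4 → ℝ}

theorem e₁_of_pi_div_two (h : ∀ j, a j = Real.pi / 2) (t : Fin 3 → ℝ) :
    e₁ a t = (2 * t 0 - 1) ^ 2 + (2 * t 1 - 1) ^ 2 + (2 * t 2 - 1) ^ 2 - 1 -
      2 * (2 * t 0 - 1) * (2 * t 1 - 1) * (2 * t 2 - 1) := by
  rw [← eEq_one, eEq_eq_es]
  simp only [es, sc, h, Real.cos_pi_div_two, Real.sin_pi_div_two]
  ring

/-- A parametrization of the cone `e₁ = 0` for `a₀ = a₁ = a₂ = a₃ = π / 2`. -/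
noncomputable def conePar (q : ℝ × ℝ) : Fin 3 → ℝ :=
  ![(Real.sqrt (1 + q.1 ^ 2) + 1) / 2, (Real.sqrt (1 + q.2 ^ 2) + 1) / 2,
    (Real.sqrt (1 + q.1 ^ 2) * Real.sqrt (1 + q.2 ^ 2) + q.1 * q.2 + 1) / 2]

theorem continuous_conePar : Continuous conePar := by
  refine continuous_pi fun i => ?_
  fin_cases i <;> simp [conePar] <;> fun_prop

theorem range_conePar (h : ∀ j, a j = Real.pi / 2) : Set.range conePar = surf a := by
  ext t
  rw [surf, Set.mem_ofPred_eq, e₁_of_pi_div_two h]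
  constructor
  · rintro ⟨⟨x, y⟩, rfl⟩
    have hx0 : 0 ≤ 1 + x ^ 2 := by positivity
    have hy0 : 0 ≤ 1 + y ^ 2 := by positivity
    have hx := Real.sq_sqrt hx0
    have hy := Real.sq_sqrt hy0
    have hx1 : 1 ≤ Real.sqrt (1 + x ^ 2) := Real.one_le_sqrt.2 (by linarith [sq_nonneg x])
    have hy1 : 1 ≤ Real.sqrt (1 + y ^ 2) := Real.one_le_sqrt.2 (by linarith [sq_nonneg y])
    simp only [conePar, Matrix.cons_val]
    set s := Real.sqrt (1 + x ^ 2)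
    set s' := Real.sqrt (1 + y ^ 2)
    -- With x = sinh α and y = sinh β the third coordinate comes from cosh(α + β) ≥ 1; this is that
    -- inequality.
    have h3 : 1 - x * y ≤ s * s' := by
      have hle : (1 - x * y) ^ 2 ≤ (s * s') ^ 2 := by
        rw [mul_pow, hx, hy]
        linarith [sq_nonneg (x + y)]
      exact (abs_le_of_sq_le_sq' hle (by positivity)).2
    constructor
    · intro j
      fin_cases j
      · change 1 ≤ (s + 1) / 2; linarith
      · change 1 ≤ (s' + 1) / 2; linarith
      · change 1 ≤ (s * s' + x * y + 1) / 2; linarith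
    · linear_combination (1 - s' ^ 2) * hx - x ^ 2 * hy
  · rintro ⟨h1, he⟩
    have k0 : 1 ≤ 2 * t 0 - 1 := by linarith [h1 0]
    have k1 : 1 ≤ 2 * t 1 - 1 := by linarith [h1 1]
    set s := 2 * t 0 - 1 with hs
    set s' := 2 * t 1 - 1 with hs'
    set s'' := 2 * t 2 - 1 with hs''
    obtain ⟨x, y, hx, hy, hxy⟩ : ∃ x y, 1 + x ^ 2 = s ^ 2 ∧ 1 + y ^ 2 = s' ^ 2 ∧
        x * y = s'' - s * s' := by
      have hss : 0 ≤ s' ^ 2 - 1 := by nlinarith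
      -- If s = 1, the equation degenerates to s'' = s' and x must be 0; otherwise y is obtained by
      -- division by x.
      rcases k0.eq_or_lt with h0 | h0
      · refine ⟨0, Real.sqrt (s' ^ 2 - 1), by rw [← h0]; norm_num, ?_, ?_⟩
        · rw [Real.sq_sqrt hss]; ring
        · have : (s'' - s') ^ 2 = 0 := by rw [← h0] at he; linear_combination he
          have := pow_eq_zero_iff (two_ne_zero) |>.1 this
          rw [← h0]; linarith
      · have hs0 : 0 < s ^ 2 - 1 := by nlinarith
        have hr := Real.sqrt_pos.2 hs0
        have hr2 := Real.sq_sqrt hs0.le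
        refine ⟨Real.sqrt (s ^ 2 - 1), (s'' - s * s') / Real.sqrt (s ^ 2 - 1), ?_, ?_, ?_⟩
        · rw [hr2]; ring
        · rw [div_pow, hr2]
          field_simp
          linear_combination he
        · field_simp
    refine ⟨(x, y), ?_⟩
    simp only [conePar, hx, hy, hxy, Real.sqrt_sq (zero_le_one.trans k0),
      Real.sqrt_sq (zero_le_one.trans k1)]
    funext j
    fin_cases j
    · change (s + 1) / 2 = t 0; rw [hs]; ring
    · change (s' + 1) / 2 = t 1; rw [hs']; ring
    · change (s * s' + (s'' - s * s') + 1) / 2 = t 2; rw [hs'']; ring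

/-- A one-sided derivative along a half-line on which f vanishes suffices, as f is differentiable.
-/
theorem fderiv_apply_eq_zero_of_ray {E : Type*} [NormedAddCommGroup E] [NormedSpace ℝ E]
    {f : E → ℝ} {x v : E} {U : Set E} (hU : IsOpen U) (hx : x ∈ U) (hf : DifferentiableAt ℝ f x)
    (h : ∀ r : ℝ, 0 ≤ r → x + r • v ∈ U → f (x + r • v) = 0) : fderiv ℝ f x v = 0 := by
  have hf' : HasFDerivAt f (fderiv ℝ f x) (x + (0 : ℝ) • v) := by
    rw [zero_smul, add_zero]; exact hf.hasFDerivAt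
  have hl : HasDerivAt (fun r : ℝ => x + r • v) ((1 : ℝ) • v) 0 :=
    ((hasDerivAt_id (0 : ℝ)).smul_const v).const_add x
  have h1 := (hf'.comp_hasDerivAt (0 : ℝ) hl).hasDerivWithinAt (s := Set.Ici 0)
  have hev : (f ∘ fun r : ℝ => x + r • v) =ᶠ[𝓝[Set.Ici 0] 0] fun _ => 0 := by
    have hU' : ∀ᶠ r : ℝ in 𝓝 0, x + r • v ∈ U :=
      hl.continuousAt.eventually (hU.mem_nhds (by simpa using hx))
    filter_upwards [self_mem_nhdsWithin, nhdsWithin_le_nhds hU'] with r hr hrU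
    exact h r hr hrU
  have h2 : HasDerivWithinAt (f ∘ fun r : ℝ => x + r • v) 0 (Set.Ici 0) 0 :=
    (hasDerivWithinAt_const (0 : ℝ) (Set.Ici 0) (0 : ℝ)).congr_of_eventuallyEq hev
      (h 0 le_rfl (by simpa using hx))
  have := (uniqueDiffOn_Ici (0 : ℝ) 0 Set.self_mem_Ici).eq_deriv _ h1 h2
  simpa using this

/-- Three rays from the apex (1,1,1) lie in the surface and their directions span ℝ³, so the
differential of any local equation vanishes at the apex. -/
theorem not_isSmoothSurface_surf (h : ∀ j, a j = Real.pi / 2) : ¬ IsSmoothSurface (surf a) := by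
  intro hs
  have hray : ∀ (v : Fin 3 → ℝ), (v = ![0, 1, 1] ∨ v = ![1, 0, 1] ∨ v = ![1, 1, 0]) → ∀ r : ℝ, 0 ≤ r →
      (fun _ => 1) + r • v ∈ surf a := by
    intro v hv r hr
    rw [surf, Set.mem_ofPred_eq, e₁_of_pi_div_two h]
    rcases hv with rfl | rfl | rfl
    · refine ⟨fun j => by fin_cases j <;> simp [hr], ?_⟩
      simp; ring
    · refine ⟨fun j => by fin_cases j <;> simp [hr], ?_⟩
      simp; ring
    · refine ⟨fun j => by fin_cases j <;> simp [hr], ?_⟩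
      simp; ring
  have h1 : (fun _ => 1 : Fin 3 → ℝ) ∈ surf a := by simpa using hray _ (Or.inl rfl) 0 le_rfl
  obtain ⟨U, hU, hxU, f, hf, hne, hfU⟩ := hs _ h1
  apply hne
  have hd : DifferentiableAt ℝ f (fun _ => 1) :=
    (hf.contDiffAt (hU.mem_nhds hxU)).differentiableAt (by simp)
  have key : ∀ (v : Fin 3 → ℝ), (v = ![0, 1, 1] ∨ v = ![1, 0, 1] ∨ v = ![1, 1, 0]) →
      fderiv ℝ f (fun _ => 1) v = 0 := by
    intro v hv
    refine fderiv_apply_eq_zero_of_ray hU hxU hd fun r hr hrU => ?_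
    have : (fun _ => 1) + r • v ∈ surf a ∩ U := ⟨hray v hv r hr, hrU⟩
    rw [hfU] at this
    exact this.2
  refine ContinuousLinearMap.ext fun v => ?_
  have hv : v = ((v 1 + v 2 - v 0) / 2) • ![0, 1, 1] + ((v 0 + v 2 - v 1) / 2) • ![1, 0, 1] +
      ((v 0 + v 1 - v 2) / 2) • ![1, 1, 0] := by
    funext j
    fin_cases j <;> simp <;> ring
  rw [hv, map_add, map_add, map_smul, map_smul, map_smul, key _ (Or.inl rfl),
    key _ (Or.inr (Or.inl rfl)), key _ (Or.inr (Or.inr rfl))]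
  simp

end singular

/-! ### The connected components of S and the curves in them -/

section
variable {a : Fin 4 → ℝ}

theorem exists_range_eq_surf (ha : ∀ j, a j ∈ Set.Ioo (0 : ℝ) Real.pi)
    (h : (∀ j, a j = Real.pi / 2) ∨ BalancedAll a) :
    ∃ f : ℝ × ℝ → Fin 3 → ℝ, Continuous f ∧ Set.range f = surf a := by
  rcases h with h | h
  · exact ⟨conePar, continuous_conePar, range_conePar h⟩
  · exact ⟨par a 0, (contDiff_par h 0).continuous, range_par ha h 0⟩

theorem not_isCompact_surf (ha : ∀ j, a j ∈ Set.Ioo (0 : ℝ) Real.pi)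
    (h : (∀ j, a j = Real.pi / 2) ∨ BalancedAll a) : ¬ IsCompact (surf a) := by
  intro hc
  rcases h with h | h
  · obtain ⟨B, hB⟩ := hc.bddAbove_image (continuous_apply (A := fun _ => ℝ) (1 : Fin 3)).continuousOn
    have := hB ⟨conePar (0, 2 * |B|), by rw [← range_conePar h]; exact ⟨_, rfl⟩, rfl⟩
    simp only [conePar, Matrix.cons_val] at this
    have h1 : 2 * |B| ≤ Real.sqrt (1 + (2 * |B|) ^ 2) := Real.le_sqrt_of_sq_le (by linarith)
    linarith [le_abs_self B]
  · obtain ⟨B, hB⟩ := hc.bddAbove_image (contDiff_xc (a := a) (0 + 1)).continuous.continuousOn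
    have := hB ⟨par a 0 (0, |B|), par_mem ha h 0 _, rfl⟩
    simp only [par, xc_tc ha, parX_add_one] at this
    have h1 := Real.add_one_le_exp |B|
    linarith [le_abs_self B]

/-- Adding the two equations gives |u₁|² + |u₂|² + |u₃|² = 1, while each summand is at least 1. -/
theorem eEq_exclusive {t : Fin 3 → ℝ}
    (ht : ∀ j, 1 ≤ t j) (h1 : eEq a 1 t = 0) (h2 : eEq a (-1) t = 0) : False := by
  have h : ∀ j, 1 ≤ Complex.normSq (u a t j) := fun j => by
    rw [← ut_first, normSq_ut]
    have := mul_nonneg (one_pos.le.trans (ht j)) (sub_nonneg.2 (ht j))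
    have := mul_nonneg (sq_nonneg (kk a j.succ).im) this
    linarith
  unfold eEq at h1 h2
  linarith [h 0, h 1, h 2]

theorem S_one_le_t (ha : ∀ j, a j ∈ Set.Ioo (0 : ℝ) Real.pi) (P : S a) (j : Fin 3) : 1 ≤ P.t j := by
  obtain ⟨δ, hδ, -, n, hn⟩ := exists_nfS ha P
  rw [← hn, nfS_t]
  exact n.2.1 j

theorem S_eEq (ha : ∀ j, a j ∈ Set.Ioo (0 : ℝ) Real.pi) (P : S a) :
    eEq a 1 P.t = 0 ∨ eEq a (-1) P.t = 0 := by
  obtain ⟨δ, hδ, h, n, hn⟩ := exists_nfS ha P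
  have := eEq_of_mem_NF hδ n.2
  rw [← nfS_t ha _ hδ, hn] at this
  rcases h with rfl | rfl
  · exact Or.inl this
  · exact Or.inr this

theorem exists_nfS_of_eEq (ha : ∀ j, a j ∈ Set.Ioo (0 : ℝ) Real.pi) {τ : HexType} {P : S a}
    (hτ : P.type = τ) {δ : ℝ} (hδ : δ ^ 2 = 1) (h : eEq a δ P.t = 0) :
    ∃ n : NF a τ δ, nfS ha τ hδ n = P := by
  obtain ⟨δ', hδ', hor', n, hn⟩ := exists_nfS ha P
  subst hτ
  have h' := eEq_of_mem_NF hδ' n.2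
  rw [← nfS_t ha _ hδ', hn] at h'
  have heq : δ' = δ := by
    have hor : δ = 1 ∨ δ = -1 := by
      have h0 : (δ - 1) * (δ + 1) = 0 := by linear_combination hδ
      exact (mul_eq_zero.1 h0).imp sub_eq_zero.1 eq_neg_of_add_eq_zero_left
    rcases hor with rfl | rfl <;> rcases hor' with rfl | rfl
    · rfl
    · exact (eEq_exclusive (S_one_le_t ha P) h h').elim
    · exact (eEq_exclusive (S_one_le_t ha P) h' h).elim
    · rfl
  subst heq
  exact ⟨n, hn⟩

theorem mem_C₁_iff {τ : HexType} {P : S a} : P ∈ C₁ a τ ↔ P.type = τ ∧ eEq a 1 P.t = 0 := by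
  rw [eEq_one]; rfl

theorem image_C₁ (ha : ∀ j, a j ∈ Set.Ioo (0 : ℝ) Real.pi) (τ : HexType) :
    S.t '' C₁ a τ = surf a := by
  ext t
  constructor
  · rintro ⟨P, hP, rfl⟩
    exact ⟨S_one_le_t ha P, hP.2⟩
  · rintro ⟨h1, h2⟩
    rw [← eEq_one] at h2
    obtain ⟨n, hn, rfl⟩ := exists_mem_NF τ (one_pow 2) h1 h2
    refine ⟨nfS ha τ (one_pow 2) ⟨n, hn⟩, ⟨rfl, ?_⟩, nfS_t ha τ _ _⟩
    rw [nfS_t, ← eEq_one]; exact h2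

theorem injOn_C₁ (ha : ∀ j, a j ∈ Set.Ioo (0 : ℝ) Real.pi) (τ : HexType) :
    Set.InjOn S.t (C₁ a τ) := by
  intro P hP Q hQ h
  rw [mem_C₁_iff] at hP hQ
  obtain ⟨n, rfl⟩ := exists_nfS_of_eEq ha hP.1 (one_pow 2) hP.2
  obtain ⟨m, rfl⟩ := exists_nfS_of_eEq ha hQ.1 (one_pow 2) hQ.2
  rw [nfS_t, nfS_t] at h
  exact nfS_eq_of_t_eq ha τ _ h

theorem isProperMap_NF_t (a : Fin 4 → ℝ) (τ : HexType) (δ : ℝ) :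
    IsProperMap fun n : NF a τ δ => n.1.2.2 := by
  rw [isProperMap_iff_isCompact_preimage]
  refine ⟨by fun_prop, fun K hK => ?_⟩
  rw [Subtype.isCompact_iff]
  convert isCompact_NF_inter a τ δ hK using 1
  ext n
  constructor
  · rintro ⟨m, hm, rfl⟩; exact ⟨m.2, hm⟩
  · rintro ⟨hn, hK⟩; exact ⟨⟨n, hn⟩, hK, rfl⟩

/-- Normal forms surject onto the component and map properly to t, so the image of a closed set is
the proper image of its closed preimage. -/
theorem isClosedEmbedding_C₁ (ha : ∀ j, a j ∈ Set.Ioo (0 : ℝ) Real.pi) (τ : HexType) :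
    IsClosedEmbedding fun P : C₁ a τ => (P : S a).t := by
  refine IsClosedEmbedding.of_continuous_injective_isClosedMap
    ((continuous_S_t a).comp continuous_subtype_val)
    (fun P Q h => Subtype.ext (injOn_C₁ ha τ P.2 Q.2 h)) ?_
  intro F hF
  obtain ⟨F', hF', rfl⟩ := isClosed_induced_iff.1 hF
  have h := (isProperMap_NF_t a τ 1).isClosedMap _ (hF'.preimage (continuous_nfS ha τ (one_pow 2)))
  convert h using 1
  ext t
  constructor
  · rintro ⟨⟨P, hP⟩, hPF, rfl⟩
    rw [mem_C₁_iff] at hP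
    obtain ⟨n, rfl⟩ := exists_nfS_of_eEq ha hP.1 (one_pow 2) hP.2
    exact ⟨n, hPF, (nfS_t ha τ _ n).symm⟩
  · rintro ⟨n, hn, rfl⟩
    refine ⟨⟨nfS ha τ (one_pow 2) n, ?_⟩, hn, nfS_t ha τ _ n⟩
    rw [mem_C₁_iff, nfS_t]
    exact ⟨rfl, eEq_of_mem_NF (one_pow 2) n.2⟩

theorem continuous_eEq (a : Fin 4 → ℝ) (δ : ℝ) : Continuous (eEq a δ) := by
  have : eEq a δ = _ := funext (eEq_eq_es a δ)
  rw [this]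
  unfold es sc
  fun_prop

/-- The hexagons of the given type with `R₃ R₂ R₁ R₀ = δ`. -/
def part (a : Fin 4 → ℝ) (τ : HexType) (δ : ℝ) : Set (S a) := {P | P.type = τ ∧ eEq a δ P.t = 0}

theorem isClosed_part (a : Fin 4 → ℝ) (τ : HexType) (δ : ℝ) : IsClosed (part a τ δ) :=
  (isClosed_eq (continuous_S_type a) continuous_const).inter
    (isClosed_eq ((continuous_eEq a δ).comp (continuous_S_t a)) continuous_const)

theorem isClopen_part_one (ha : ∀ j, a j ∈ Set.Ioo (0 : ℝ) Real.pi) (τ : HexType) :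
    IsClopen (part a τ 1) := by
  refine ⟨isClosed_part a τ 1, ?_⟩
  rw [← isClosed_compl_iff]
  have : (part a τ 1)ᶜ = part a τ (-1) ∪ (S.type ⁻¹' {τ}ᶜ) := by
    ext P
    simp only [part, Set.mem_compl_iff, Set.mem_ofPred_eq, Set.mem_union, Set.mem_preimage,
      Set.mem_singleton_iff]
    by_cases hτ : P.type = τ
    · simp only [hτ, true_and, not_true, or_false]
      exact ⟨fun h => (S_eEq ha P).resolve_left h,
        fun h h' => eEq_exclusive (S_one_le_t ha P) h' h⟩
    · simp [hτ]
  rw [this]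
  exact (isClosed_part a τ (-1)).union ((isClosed_discrete _).preimage (continuous_S_type a))

theorem isClopen_part_neg_one (ha : ∀ j, a j ∈ Set.Ioo (0 : ℝ) Real.pi) (τ : HexType) :
    IsClopen (part a τ (-1)) := by
  refine ⟨isClosed_part a τ (-1), ?_⟩
  have : part a τ (-1) = S.type ⁻¹' {τ} ∩ (part a τ 1)ᶜ := by
    ext P
    simp only [part, Set.mem_compl_iff, Set.mem_ofPred_eq, Set.mem_inter_iff, Set.mem_preimage,
      Set.mem_singleton_iff]
    by_cases hτ : P.type = τ
    · simp only [hτ, true_and]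
      exact ⟨fun h h' => eEq_exclusive (S_one_le_t ha P) h' h,
        fun h => (S_eEq ha P).resolve_left h⟩
    · simp [hτ]
  rw [this]
  exact ((isOpen_discrete _).preimage (continuous_S_type a)).inter
    (isClopen_part_one ha τ).compl.isOpen

theorem isCompact_part_neg_one (ha : ∀ j, a j ∈ Set.Ioo (0 : ℝ) Real.pi) (τ : HexType) :
    IsCompact (part a τ (-1)) := by
  have hδ : (-1 : ℝ) ^ 2 = 1 := by norm_num
  have hbound : ∀ j : Fin 3, ∃ B, ∀ t : Fin 3 → ℝ, (∀ j, 1 ≤ t j) → eEq a (-1) t = 0 → t j ≤ B := by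
    intro j
    have hp := mul_pos (sin_a_pos ha 0) (sin_a_pos ha j.succ)
    -- For δ = -1 the bound of `le_of_es_eq_zero` reads σ₀s_j ≤ c₀c_j + cc' - σσ', where the
    -- unindexed letters belong to the other two angles. The right side is less than 3.
    refine ⟨(3 / (Real.sin (a 0) * Real.sin (a j.succ)) + 1) / 2, fun t ht h => ?_⟩
    rw [eEq_eq_es' a (-1) t (j + 2)] at h
    have h1 := le_of_es_eq_zero hδ (cos_sq_add a 0) (cos_sq_add a _) (cos_sq_add a _)
      (sin_a_pos ha _) (sin_a_pos ha _) (le_sc ha (ht _)) (le_sc ha (ht _)) h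
    have hj : j + 2 + 1 = j := by rw [add_assoc]; simp
    rw [hj] at h1
    set c1 := Real.cos (a (j + 2).succ)
    set c3 := Real.cos (a (j + 2 + 2).succ)
    have h2 : c1 * c3 ≤ 1 := by
      have e1 := Real.cos_sq_le_one (a (j + 2).succ)
      have e2 := Real.cos_sq_le_one (a (j + 2 + 2).succ)
      nlinarith [sq_nonneg (c1 - c3)]
    have h3 : Real.cos (a 0) * Real.cos (a j.succ) ≤ 1 := by
      have e1 := Real.cos_sq_le_one (a 0)
      have e2 := Real.cos_sq_le_one (a j.succ)
      nlinarith [sq_nonneg (Real.cos (a 0) - Real.cos (a j.succ))]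
    have h4 := mul_pos (sin_a_pos ha (j + 2).succ) (sin_a_pos ha (j + 2 + 2).succ)
    have h5 : 2 * t j - 1 ≤ 3 / (Real.sin (a 0) * Real.sin (a j.succ)) := by
      rw [le_div_iff₀ hp]
      unfold sc at h1
      linarith
    linarith
  choose B hB using hbound
  have hcomp : CompactSpace (NF a τ (-1)) := by
    rw [← isCompact_iff_compactSpace]
    convert isCompact_NF_inter a τ (-1) (isCompact_Icc (a := fun _ => (1 : ℝ)) (b := B)) using 1
    refine (Set.inter_eq_left.2 fun n hn => ?_).symm
    exact ⟨hn.1, fun j => hB j _ hn.1 (eEq_of_mem_NF hδ hn)⟩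
  convert isCompact_range (continuous_nfS ha τ hδ) using 1
  ext P
  constructor
  · rintro ⟨h1, h2⟩
    exact exists_nfS_of_eEq ha h1 hδ h2
  · rintro ⟨n, rfl⟩
    refine ⟨rfl, ?_⟩
    rw [nfS_t]
    exact eEq_of_mem_NF hδ n.2

theorem C₁_eq_part (τ : HexType) : C₁ a τ = part a τ 1 := by
  ext P; exact mem_C₁_iff

theorem isPreconnected_C₁ (ha : ∀ j, a j ∈ Set.Ioo (0 : ℝ) Real.pi)
    (h : (∀ j, a j = Real.pi / 2) ∨ BalancedAll a) (τ : HexType) : IsPreconnected (C₁ a τ) := by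
  obtain ⟨f, hf, hr⟩ := exists_range_eq_surf ha h
  have h1 : IsPreconnected (Set.univ : Set (C₁ a τ)) := by
    rw [← (isClosedEmbedding_C₁ ha τ).isInducing.isPreconnected_image]
    have : (fun P : C₁ a τ => (P : S a).t) '' Set.univ = surf a := by
      rw [← image_C₁ ha τ, Set.image_univ, Set.image_eq_range]
    rw [this, ← hr]
    exact isPreconnected_range hf
  simpa using h1.image _ continuous_subtype_val.continuousOn

theorem not_isCompact_C₁ (ha : ∀ j, a j ∈ Set.Ioo (0 : ℝ) Real.pi)
    (h : (∀ j, a j = Real.pi / 2) ∨ BalancedAll a) (τ : HexType) : ¬ IsCompact (C₁ a τ) := by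
  intro hc
  apply not_isCompact_surf ha h
  rw [← image_C₁ ha τ]
  exact hc.image (continuous_S_t a)

theorem surf_nonempty (ha : ∀ j, a j ∈ Set.Ioo (0 : ℝ) Real.pi)
    (h : (∀ j, a j = Real.pi / 2) ∨ BalancedAll a) : (surf a).Nonempty := by
  obtain ⟨f, hf, hr⟩ := exists_range_eq_surf ha h
  rw [← hr]
  exact Set.range_nonempty f

/-- The set is clopen because δ is locally constant, and connected because its image in ℝ³ is a
continuous image of ℝ². -/
theorem connectedComponent_eq_C₁ (ha : ∀ j, a j ∈ Set.Ioo (0 : ℝ) Real.pi)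
    (h : (∀ j, a j = Real.pi / 2) ∨ BalancedAll a) {τ : HexType} {P : S a} (hP : P ∈ C₁ a τ) :
    connectedComponent P = C₁ a τ := by
  refine subset_antisymm ?_ ((isPreconnected_C₁ ha h τ).subset_connectedComponent hP)
  rw [C₁_eq_part] at hP ⊢
  exact (isClopen_part_one ha τ).connectedComponent_subset hP

theorem isNoncompactComponent_iff (ha : ∀ j, a j ∈ Set.Ioo (0 : ℝ) Real.pi)
    (h : (∀ j, a j = Real.pi / 2) ∨ BalancedAll a) (C : Set (S a)) :
    IsNoncompactComponent C ↔ ∃ τ, C = C₁ a τ := by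
  constructor
  · rintro ⟨⟨P, rfl⟩, hC⟩
    refine ⟨P.type, ?_⟩
    rcases S_eEq ha P with h1 | h1
    · exact connectedComponent_eq_C₁ ha h (mem_C₁_iff.2 ⟨rfl, h1⟩)
    · refine (hC ?_).elim
      exact (isCompact_part_neg_one ha P.type).of_isClosed_subset isClosed_connectedComponent
        ((isClopen_part_neg_one ha P.type).connectedComponent_subset ⟨rfl, h1⟩)
  · rintro ⟨τ, rfl⟩
    obtain ⟨t, ht⟩ := surf_nonempty ha h
    rw [← image_C₁ ha τ] at ht
    obtain ⟨P, hP, -⟩ := ht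
    exact ⟨⟨P, (connectedComponent_eq_C₁ ha h hP).symm⟩, not_isCompact_C₁ ha h τ⟩

/-- The link between geometry and the cubic: the sign of the partial derivative decides between t_j
≤ t'_j and t_j ≥ t'_j. -/
theorem dx_t (ha : ∀ j, a j ∈ Set.Ioo (0 : ℝ) Real.pi) {τ : HexType} {P : S a} (hP : P ∈ C₁ a τ)
    (j : Fin 3) : dx a j P.t = Real.sin (a 0) * Real.sin (a j.succ) * (P.t j - P.t' j) := by
  have hP' := mem_C₁_iff.1 hP
  obtain ⟨n, hn⟩ := exists_nfS_of_eEq ha hP'.1 (one_pow 2) hP'.2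
  refine dx_eq ha hP.2 (one_pos.trans_le (S_one_le_t ha P j)) ?_
  rw [← hn, nfS_t' ha τ (one_pow 2) n j, Complex.ofReal_one, one_mul]

theorem image_inter_C₁ (ha : ∀ j, a j ∈ Set.Ioo (0 : ℝ) Real.pi) (τ : HexType) {p : (Fin 3 → ℝ) → Prop}
    {B : Set (S a)} (hB : ∀ P ∈ C₁ a τ, (P ∈ B ↔ p P.t)) :
    S.t '' (B ∩ C₁ a τ) = {t | t ∈ surf a ∧ p t} := by
  rw [← image_C₁ ha τ]
  ext t
  constructor
  · rintro ⟨P, ⟨h1, h2⟩, rfl⟩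
    exact ⟨⟨P, h2, rfl⟩, (hB P h2).1 h1⟩
  · rintro ⟨⟨P, h2, rfl⟩, hp⟩
    exact ⟨P, ⟨(hB P h2).2 hp, h2⟩, rfl⟩

theorem mem_A_iff_dx (ha : ∀ j, a j ∈ Set.Ioo (0 : ℝ) Real.pi) {τ : HexType} {P : S a}
    (hP : P ∈ C₁ a τ) (j : Fin 3) : P ∈ A a j ↔ dx a j P.t = 0 := by
  have hp := mul_pos (sin_a_pos ha 0) (sin_a_pos ha j.succ)
  rw [mem_A_iff, dx_t ha hP, mul_eq_zero, or_iff_right hp.ne', sub_eq_zero, eq_comm]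

theorem mem_H_iff_dx (ha : ∀ j, a j ∈ Set.Ioo (0 : ℝ) Real.pi) {τ : HexType} {P : S a}
    (hP : P ∈ C₁ a τ) (j : Fin 3) : P ∈ H a j ↔ dx a j P.t ≤ 0 := by
  have hp := mul_pos (sin_a_pos ha 0) (sin_a_pos ha j.succ)
  rw [dx_t ha hP, mul_nonpos_iff_pos_imp_nonpos]
  constructor
  · intro h
    exact ⟨fun _ => sub_nonpos.2 h, fun _ => hp.le⟩
  · intro h
    exact sub_nonpos.1 (h.1 hp)

theorem mem_H'_iff_dx (ha : ∀ j, a j ∈ Set.Ioo (0 : ℝ) Real.pi) {τ : HexType} {P : S a}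
    (hP : P ∈ C₁ a τ) (j : Fin 3) : P ∈ H' a j ↔ 0 ≤ dx a j P.t := by
  have hp := mul_pos (sin_a_pos ha 0) (sin_a_pos ha j.succ)
  rw [dx_t ha hP, mul_nonneg_iff_of_pos_left hp, sub_nonneg]
  rfl

end

end HexSpace

theorem lemma4p6p2 (a : Fin 4 → ℝ) (ha : ∀ j, a j ∈ Set.Ioo (0 : ℝ) Real.pi)
    (h : (∀ j k, j ≠ k → a j + a k ≤ Real.pi) ∨ (∀ j k, j ≠ k → Real.pi ≤ a j + a k)) :
    -- the noncompact components of `S a`, one of each type, are given by the equation `e₁ = 0`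
    (∀ C : Set (S a), IsNoncompactComponent C ↔ ∃ τ, C = C₁ a τ) ∧
    ∀ τ : HexType,
      -- `(t₁, t₂, t₃)` identifies the component with a surface in `ℝ³`
      IsEmbedding (fun P : C₁ a τ => (P : S a).t) ∧
      S.t '' C₁ a τ = {x | (∀ j, 1 ≤ x j) ∧ e₁ a x = 0} ∧
      -- the surface is smooth unless all `a j` equal `π / 2`
      (IsSmoothSurface (S.t '' C₁ a τ) ↔ ¬ ∀ j, a j = Real.pi / 2) ∧
      ((¬ ∀ j, a j = Real.pi / 2) → ∀ x ∈ S.t '' C₁ a τ, fderiv ℝ (e₁ a) x ≠ 0) ∧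
      -- the curves `A₁, A₂, A₃` in a smooth component
      (IsSmoothSurface (S.t '' C₁ a τ) →
        (∀ j, IsSmoothLine (S.t '' (A a j ∩ C₁ a τ))) ∧
        (∀ j k, j ≠ k → Disjoint (A a j ∩ C₁ a τ) (A a k ∩ C₁ a τ)) ∧
        (∀ j, DividesSmoothPlane (S.t '' C₁ a τ) (S.t '' (A a j ∩ C₁ a τ))
          (S.t '' (H a j ∩ C₁ a τ)) (S.t '' (H' a j ∩ C₁ a τ))) ∧
        ∀ j k, A a k ∩ C₁ a τ ⊆ H a j ∩ C₁ a τ) := by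
  have hcase : (∀ j, a j = Real.pi / 2) ∨ BalancedAll a := by
    by_cases hs : ∀ j, a j = Real.pi / 2
    · exact Or.inl hs
    · exact Or.inr (balanced ha h hs)
  refine ⟨isNoncompactComponent_iff ha hcase, fun τ => ?_⟩
  have hsmooth : IsSmoothSurface (surf a) ↔ ¬ ∀ j, a j = Real.pi / 2 :=
    ⟨fun hs hall => not_isSmoothSurface_surf hall hs,
      fun hs => isSmoothSurface_surf ha (balanced ha h hs)⟩
  rw [image_C₁ ha τ]
  refine ⟨(isClosedEmbedding_C₁ ha τ).isEmbedding, rfl, hsmooth,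
    fun hs x hx => fderiv_e₁_ne_zero ha (balanced ha h hs) hx, fun hs => ?_⟩
  have hb : BalancedAll a := balanced ha h (hsmooth.1 hs)
  have hA : ∀ j, S.t '' (A a j ∩ C₁ a τ) = {t | t ∈ surf a ∧ dx a j t = 0} := fun j =>
    image_inter_C₁ ha τ fun P hP => mem_A_iff_dx ha hP j
  have hH : ∀ j, S.t '' (H a j ∩ C₁ a τ) = {t | t ∈ surf a ∧ dx a j t ≤ 0} := fun j =>
    image_inter_C₁ ha τ fun P hP => mem_H_iff_dx ha hP j
  have hH' : ∀ j, S.t '' (H' a j ∩ C₁ a τ) = {t | t ∈ surf a ∧ 0 ≤ dx a j t} := fun j =>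
    image_inter_C₁ ha τ fun P hP => mem_H'_iff_dx ha hP j
  have hmem : ∀ P ∈ C₁ a τ, P.t ∈ surf a := fun P hP => ⟨S_one_le_t ha P, hP.2⟩
  refine ⟨fun j => ?_, fun j k hjk => ?_, fun j => ?_, fun j k => ?_⟩
  · rw [hA]
    exact isSmoothLine_dx ha hb j
  · rw [Set.disjoint_left]
    rintro P ⟨h1, hP⟩ ⟨h2, -⟩
    rw [mem_A_iff_dx ha hP] at h1 h2
    exact (dx_neg ha hb (hmem P hP) hjk h1.ge).ne h2
  · rw [hA, hH, hH']
    exact dividesSmoothPlane_dx ha hb j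
  · rintro P ⟨h1, hP⟩
    refine ⟨?_, hP⟩
    rw [mem_A_iff_dx ha hP] at h1
    rw [mem_H_iff_dx ha hP]
    by_cases hjk : k = j
    · rw [← hjk, h1]
    · exact (dx_neg ha hb (hmem P hP) hjk h1.ge).le
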